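/- \textbf{Conventions.} All vector spaces are complex. A \emph{vertex superalgebra} is $(V,\Omega,T,Y)$, where $V$ is a vector space with a linear map $\Gamma_V$, $\Gamma_V^2=1_V$, and even and odd parts $V_{\bar p}=\{a\mid \Gamma_V a=(-1)^p a\}$, $\bar p\in\mathbb Z/2$; $\Omega\in V_{\bar 0}$; $T$ is an even endomorphism; and $a\mapsto Y(a,z)=\sum_{n\in\mathbb Z}a_{(n)}z^{-n-1}\in \mathrm{End}(V)[[z^{\pm1}]]$ is linear, such that: $a_{(n)}V_{\bar q}\subseteq V_{\bar p+\bar q}$ for $a\in V_{\bar p}$; for all $a,b$ one has $a_{(n)}b=0$ for $n$ large; $[T,Y(a,z)]=\frac{d}{dz}Y(a,z)$; $Y(\Omega,z)=1_V$, $T\Omega=0$, $a_{(-1)}\Omega=a$; and, for $a\in V_{\bar p}$, $b\in V_{\bar q}$, $(z-w)^N\big(Y(a,z)Y(b,w)-(-1)^{pq}Y(b,w)Y(a,z)\big)=0$ for all large $N$. A \emph{VOSA} (vertex operator superalgebra) is a vertex superalgebra with a vector $\nu\in V_{\bar 0}$ such that the operators $L_n:=\nu_{(n+1)}$ satisfy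 $[L_n,L_m]=(n-m)L_{n+m}+\frac{c(n^3-n)}{12}\delta_{n,-m}1_V$ for some $c\in\mathbb C$, $L_{-1}=T$, $L_0$ is diagonalizable, and, with $V_n=\ker(L_0-n1_V)$: $V_n=0$ for $n\notin\frac12\mathbb Z$, $V_{\bar 0}=\bigoplus_{n\in\mathbb Z}V_n$, $V_{\bar 1}=\bigoplus_{n\in\mathbb Z-\frac12}V_n$, $\dim V_n<\infty$, and there is an integer $N\le 0$ with $V_n=0$ for $n<N$. It is a \emph{VOA} if $V_{\bar 1}=0$. An \emph{ideal} is a $T$-invariant subspace $J$ with $a_{(n)}J\subseteq J$ for all $a\in V$, $n\in\mathbb Z$; $V$ is \emph{simple} if its only ideals are $\{0\}$ and $V$. A \emph{scalar product} is a positive-definite Hermitian form, linear in the second variable. A VOSA $V$ is \emph{unitary} if there are an antilinear map $\theta:V\to V$ with $\theta^2=1_V$, $\theta(a_{(n)}b)=\theta(a)_{(n)}\theta(b)$, $\theta(\Omega)=\Omega$, $\theta(\nu)=\nu$, and a scalar product on $V$ with $(\Omega|\Omega)=1$ and $$(Y(\theta(a),z)b|c)=(b|Y(e^{zL_1}(-1)^{2L_0^2+L_0}z^{-2L_0}a,z^{-1})c)\qquad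 (a,b,c\in V),$$ as an identity of formal series in $z$ ($z$ is not conjugated). A \emph{$V$-module} is a vector space $M=M_{\bar 0}\oplus M_{\bar 1}$ with a linear map $a\mapsto Y^M(a,z)=\sum_{n\in\mathbb Z} a^M_{(n)}z^{-n-1}\in\mathrm{End}(M)[[z^{\pm1}]]$ such that $a^M_{(n)}M_{\bar q}\subseteq M_{\bar p+\bar q}$ for $a\in V_{\bar p}$; for all $a\in V$, $b\in M$ one has $a^M_{(n)}b=0$ for $n$ large; $\frac{d}{dz}Y^M(a,z)=Y^M(L_{-1}a,z)$; $Y^M(\Omega,z)=1_M$; for $a\in V_{\bar p}$, $b\in V_{\bar q}$, $c\in M$, $m,n,k\in\mathbb Z$ the Borcherds identity $$\sum_{j\ge0}\binom mj(a_{(n+j)}b)^M_{(m+k-j)}c=\sum_{j\ge0}(-1)^j\binom nj\big(a^M_{(m+n-j)}b^M_{(k+j)}-(-1)^{pq}(-1)^n b^M_{(n+k-j)}a^M_{(m+j)}\big)c$$ holds; and, with $L_0^M=\nu^M_{(1)}$ and $M_n=\ker(L^M_0-n1_M)$, $n\in\mathbb C$: $M=\bigoplus_n M_n$, $M_{\bar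 p}=\bigoplus_n(M_{\bar p}\cap M_n)$, $\dim M_n<\infty$, and $M_n\ne0$ for at most countably many $n$. It is \emph{irreducible} if it has no subspaces invariant under all $a^M_{(n)}$ other than $\{0\}$ and $M$. If $V$ is unitary with given $\theta$, then $M$ is a \emph{unitary $V$-module} if there is a scalar product on $M$ with $(Y^M(\theta(a),z)b|c)=(b|Y^M(e^{zL_1}(-1)^{2L_0^2+L_0}z^{-2L_0}a,z^{-1})c)$ for all $a\in V$, $b,c\in M$. The even part $V_{\bar 0}$ of a VOSA is a VOA by restriction, and it acts on $V_{\bar 1}$ by restriction of $Y$. \textbf{Theorem.} Let $V$ be a simple VOSA. Then $V$ is unitary if and only if $V_{\bar 0}$ is a unitary VOA and $V_{\bar 1}$ is a unitary $V_{\bar 0}$-module (that is, for some unitary structure on $V_{\bar 0}$, there is a scalar product making $V_{\bar 1}$ a unitary $V_{\bar 0}$-module with respect to it). In that case, $V_{\bar 0}$ is simple and $V_{\bar 1}$ is an irreducible $V_{\bar 0}$-module. -/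

import Mathlib

/-- The data of a vertex superalgebra structure on a complex vector space `V`. The state-field correspondence
`Y(a,z) = ∑ₙ a₍ₙ₎ z^(-n-1)` is recorded by its modes, `Y a n = a₍ₙ₎`. -/
structure PreVertexSuperalgebra (V : Type*) [AddCommGroup V] [Module ℂ V] where
  /-- the parity operator `Γ_V` -/
  Γ : Module.End ℂ V
  /-- the vacuum vector `Ω` -/
  vac : V
  /-- the infinitesimal translation operator -/
  T : Module.End ℂ V
  /-- the modes `Y a n = a₍ₙ₎` of the state-field correspondence -/
  Y : V →ₗ[ℂ] (ℤ → Module.End ℂ V)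

/-- The subspace of parity `p`, that is, the eigenspace of `Γ_V` of eigenvalue `(-1)^p`. -/
def PreVertexSuperalgebra.part {V : Type*} [AddCommGroup V] [Module ℂ V]
    (A : PreVertexSuperalgebra V) (p : ZMod 2) : Submodule ℂ V :=
  Module.End.eigenspace A.Γ ((-1 : ℂ) ^ p.val)

/-- The sign `(-1)^(p q)` of two parities. -/
def paritySign (p q : ZMod 2) : ℂ := (-1 : ℂ) ^ (p.val * q.val)

/-- Multiplication by `z - w` of the formal distribution
`F(z,w) = ∑ F m k z^(-m-1) w^(-k-1)` in two variables. -/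
def mulZSubW {E : Type*} [AddCommGroup E] (F : ℤ → ℤ → E) : ℤ → ℤ → E :=
  fun m k => F (m + 1) k - F m (k + 1)

/-- The graded commutator `[Y(a,z), Y(b,w)]` of the fields of vectors `a`, `b` of parities
`p`, `q`, as a formal distribution in `z` and `w`. -/
def PreVertexSuperalgebra.gradedComm {V : Type*} [AddCommGroup V] [Module ℂ V]
    (A : PreVertexSuperalgebra V) (p q : ZMod 2) (a b : V) : ℤ → ℤ → Module.End ℂ V :=
  fun m k => A.Y a m * A.Y b k - paritySign p q • (A.Y b k * A.Y a m)

/-- Vertex superalgebras `(V, Ω, T, Y)`. -/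
structure VertexSuperalgebra (V : Type*) [AddCommGroup V] [Module ℂ V] extends
    PreVertexSuperalgebra V where
  Γ_sq : ∀ a, Γ (Γ a) = a
  vac_mem : vac ∈ toPreVertexSuperalgebra.part 0
  T_even : ∀ p, ∀ a ∈ toPreVertexSuperalgebra.part p, T a ∈ toPreVertexSuperalgebra.part p
  parity : ∀ p q, ∀ a ∈ toPreVertexSuperalgebra.part p, ∀ b ∈ toPreVertexSuperalgebra.part q,
    ∀ n : ℤ, Y a n b ∈ toPreVertexSuperalgebra.part (p + q)
  field : ∀ a b : V, ∃ N : ℕ, ∀ n : ℤ, (N : ℤ) ≤ n → Y a n b = 0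
  /-- `[T, Y(a,z)] = d/dz Y(a,z)` -/
  translation : ∀ (a : V) (n : ℤ), T * Y a n - Y a n * T = (-n : ℤ) • Y a (n - 1)
  vac_field : ∀ n : ℤ, Y vac n = if n = -1 then 1 else 0
  T_vac : T vac = 0
  creation : ∀ a : V, Y a (-1) vac = a
  /-- `(z - w)^N [Y(a,z), Y(b,w)] = 0` for all large `N` -/
  locality : ∀ p q, ∀ a ∈ toPreVertexSuperalgebra.part p, ∀ b ∈ toPreVertexSuperalgebra.part q,
    ∃ M : ℕ, 0 < M ∧ ∀ N : ℕ, M ≤ N →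
      mulZSubW^[N] (toPreVertexSuperalgebra.gradedComm p q a b) = 0

/-- Vertex operator superalgebras `(V, Ω, T, Y, ν)`; here `Lₙ = ν₍ₙ₊₁₎`. -/
structure VOSA (V : Type*) [AddCommGroup V] [Module ℂ V] extends VertexSuperalgebra V where
  /-- the conformal vector -/
  ν : V
  /-- the central charge -/
  c : ℂ
  ν_mem : ν ∈ toPreVertexSuperalgebra.part 0
  virasoro : ∀ n m : ℤ, Y ν (n + 1) * Y ν (m + 1) - Y ν (m + 1) * Y ν (n + 1) =
    (n - m) • Y ν (n + m + 1) +
      (if n = -m then c * ((n : ℂ) ^ 3 - n) / 12 else 0) • (1 : Module.End ℂ V)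
  /-- `L₋₁ = T` -/
  L_neg_one : Y ν 0 = T
  /-- `L₀` is diagonalizable -/
  diagonalizable : ⨆ μ : ℂ, (Y ν 1).eigenspace μ = ⊤
  weight_half_int : ∀ μ : ℂ, (∀ D : ℤ, μ ≠ (D : ℂ) / 2) → (Y ν 1).eigenspace μ = ⊥
  even_eq : toPreVertexSuperalgebra.part 0 = ⨆ n : ℤ, (Y ν 1).eigenspace (n : ℂ)
  odd_eq : toPreVertexSuperalgebra.part 1 = ⨆ n : ℤ, (Y ν 1).eigenspace ((n : ℂ) - 1 / 2)
  finite_dim : ∀ D : ℤ, FiniteDimensional ℂ ((Y ν 1).eigenspace ((D : ℂ) / 2))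
  bounded_below : ∃ N : ℤ, N ≤ 0 ∧ ∀ D : ℤ, (D : ℚ) / 2 < N →
    (Y ν 1).eigenspace ((D : ℂ) / 2) = ⊥

/-- A Hermitian (antilinear in the first, linear in the second variable) positive definite form. -/
structure IsScalarProduct {M : Type*} [AddCommGroup M] [Module ℂ M]
    (B : M →ₗ⋆[ℂ] M →ₗ[ℂ] ℂ) : Prop where
  hermitian : ∀ b c, B b c = starRingEnd ℂ (B c b)
  pos : ∀ b, b ≠ 0 → 0 < (B b b).re

namespace VOSA

variable {V : Type*} [AddCommGroup V] [Module ℂ V]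

/-- The Virasoro modes `Lₙ = ν₍ₙ₊₁₎`. -/
def L (A : VOSA V) (n : ℤ) : Module.End ℂ V := A.Y A.ν (n + 1)

/-- The `L₀`-eigenspace of eigenvalue (conformal weight) `μ`. -/
def weightSpace (A : VOSA V) (μ : ℂ) : Submodule ℂ V := (A.L 0).eigenspace μ

/-- A VOSA is a VOA if its odd part vanishes. -/
def IsVOA (A : VOSA V) : Prop := A.part 1 = ⊥

/-- Ideals: `T`-invariant subspaces `J` with `a₍ₙ₎ J ⊆ J` for all `a ∈ V`, `n ∈ ℤ`. -/
def IsIdeal (A : VOSA V) (J : Submodule ℂ V) : Prop :=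
  (∀ b ∈ J, A.T b ∈ J) ∧ ∀ (a : V) (n : ℤ), ∀ b ∈ J, A.Y a n b ∈ J

/-- A VOSA is simple if its only ideals are `{0}` and `V`. -/
def IsSimple (A : VOSA V) : Prop := ∀ J : Submodule ℂ V, A.IsIdeal J → J = ⊥ ∨ J = ⊤

/-- For an action `YM` of `V` on `M` by modes and `a` homogeneous of weight `d = D/2`, the
coefficient of `z^(-n-1)` in
`(b | YM(e^(z L₁) (-1)^(2 L₀² + L₀) z^(-2 L₀) a, z⁻¹) c)`, which is
`(-1)^(2d²+d) ∑ₗ (b | (L₁^l a)₍₂d-l-n-2₎ c) / l!`. Note `2d² + d = D (D + 1) / 2`; the sum has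
only finitely many non-zero terms, because the weights of `V` are bounded below. -/
noncomputable def adjointCoeff (A : VOSA V) {M : Type*} [AddCommGroup M] [Module ℂ M]
    (YM : V →ₗ[ℂ] (ℤ → Module.End ℂ M)) (B : M →ₗ⋆[ℂ] M →ₗ[ℂ] ℂ)
    (D : ℤ) (a : V) (n : ℤ) (b c : M) : ℂ :=
  (-1 : ℂ) ^ (D * (D + 1) / 2) *
    ∑ᶠ l : ℕ, B b (YM (((A.L 1) ^ l) a) (D - l - n - 2) c) / (l.factorial : ℂ)

/-- The invariance of a form `B` on `M` under an action `YM` of `V` with respect to `θ`: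
`(YM(θ(a),z)b | c) = (b | YM(e^(z L₁) (-1)^(2 L₀² + L₀) z^(-2 L₀) a, z⁻¹)c)` for all `a`
(by linearity: all homogeneous `a`), `b` and `c`. -/
def IsInvariantForm (A : VOSA V) {M : Type*} [AddCommGroup M] [Module ℂ M]
    (YM : V →ₗ[ℂ] (ℤ → Module.End ℂ M)) (θ : V →ₗ⋆[ℂ] V) (B : M →ₗ⋆[ℂ] M →ₗ[ℂ] ℂ) : Prop :=
  ∀ D : ℤ, ∀ a ∈ A.weightSpace ((D : ℂ) / 2), ∀ (n : ℤ) (b c : M),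
    B (YM (θ a) n b) c = A.adjointCoeff YM B D a n b c

/-- A unitary structure on a VOSA: a PCT operator `θ` (an involutive antilinear VOSA automorphism)
and a normalized invariant scalar product. -/
structure UnitaryStructure (A : VOSA V) where
  θ : V →ₗ⋆[ℂ] V
  form : V →ₗ⋆[ℂ] V →ₗ[ℂ] ℂ
  θ_Y : ∀ (a b : V) (n : ℤ), θ (A.Y a n b) = A.Y (θ a) n (θ b)
  θ_vac : θ A.vac = A.vac
  θ_ν : θ A.ν = A.ν
  θ_invol : ∀ a, θ (θ a) = a
  scalarProduct : IsScalarProduct form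
  normalized : form A.vac A.vac = 1
  invariant : A.IsInvariantForm A.Y θ form

/-- A VOSA is unitary if it admits a unitary structure. -/
def IsUnitary (A : VOSA V) : Prop := Nonempty A.UnitaryStructure

/-- The data of a module over a VOSA: a `ℤ/2`-grading and the modes of `Y^M`. -/
structure PreModule (A : VOSA V) (M : Type*) [AddCommGroup M] [Module ℂ M] where
  part : ZMod 2 → Submodule ℂ M
  Y : V →ₗ[ℂ] (ℤ → Module.End ℂ M)

/-- The data `P` make `M` a module over the VOSA `A`. -/
structure PreModule.IsModule {A : VOSA V} {M : Type*} [AddCommGroup M] [Module ℂ M]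
    (P : A.PreModule M) : Prop where
  /-- `M = M_0 ⊕ M_1` -/
  isCompl : IsCompl (P.part 0) (P.part 1)
  parity : ∀ p q, ∀ a ∈ A.part p, ∀ b ∈ P.part q, ∀ n : ℤ, P.Y a n b ∈ P.part (p + q)
  field : ∀ (a : V) (b : M), ∃ N : ℕ, ∀ n : ℤ, (N : ℤ) ≤ n → P.Y a n b = 0
  /-- `d/dz Y^M(a,z) = Y^M(L₋₁ a,z)` -/
  translation : ∀ (a : V) (n : ℤ), (-n : ℤ) • P.Y a (n - 1) = P.Y (A.L (-1) a) n
  vac_field : ∀ n : ℤ, P.Y A.vac n = if n = -1 then 1 else 0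
  /-- The Borcherds identity; by the field axiom all sums are finite. -/
  borcherds : ∀ p q, ∀ a ∈ A.part p, ∀ b ∈ A.part q, ∀ (c : M) (m n k : ℤ),
    ∑ᶠ j : ℕ, Ring.choose m j • P.Y (A.Y a (n + j) b) (m + k - j) c =
      ∑ᶠ j : ℕ, ((-1) ^ j * Ring.choose n j) •
        (P.Y a (m + n - j) (P.Y b (k + j) c) -
          (paritySign p q * (-1 : ℂ) ^ n) • P.Y b (n + k - j) (P.Y a (m + j) c))
  /-- `M` is the sum of the `L₀^M`-eigenspaces (which are always independent) -/
  diagonalizable : ⨆ μ : ℂ, (P.Y A.ν 1).eigenspace μ = ⊤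
  part_graded : ∀ p, P.part p = ⨆ μ : ℂ, P.part p ⊓ (P.Y A.ν 1).eigenspace μ
  finite_dim : ∀ μ : ℂ, FiniteDimensional ℂ ((P.Y A.ν 1).eigenspace μ)
  countable : {μ : ℂ | (P.Y A.ν 1).eigenspace μ ≠ ⊥}.Countable

/-- The data `P` make `M` a module over the VOSA `A` which is unitary (for some scalar product)
with respect to the given unitary structure on `A`. -/
def PreModule.IsUnitaryModule {A : VOSA V} {M : Type*} [AddCommGroup M] [Module ℂ M]
    (P : A.PreModule M) (U : A.UnitaryStructure) : Prop :=
  P.IsModule ∧ ∃ B : M →ₗ⋆[ℂ] M →ₗ[ℂ] ℂ, IsScalarProduct B ∧ A.IsInvariantForm P.Y U.θ B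

/-- The data `P` make `M` a module over the VOSA `A` which is irreducible, that is, without
submodules other than `{0}` and `M`. -/
def PreModule.IsIrreducibleModule {A : VOSA V} {M : Type*} [AddCommGroup M] [Module ℂ M]
    (P : A.PreModule M) : Prop :=
  P.IsModule ∧ ∀ S : Submodule ℂ M, (∀ (a : V) (n : ℤ), ∀ b ∈ S, P.Y a n b ∈ S) →
    S = ⊥ ∨ S = ⊤

/-- The action of the even part of `V` on the part of parity `p`, by restriction of `Y`. -/
def evenAct (A : VOSA V) (p : ZMod 2) :
    A.part 0 →ₗ[ℂ] (ℤ → Module.End ℂ (A.part p)) where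
  toFun a n := (A.Y a n).restrict fun b hb => by
    simpa using A.parity 0 p a a.2 b hb n
  map_add' a b := by ext; simp
  map_smul' r a := by ext; simp

@[simp] theorem coe_evenAct (A : VOSA V) (p : ZMod 2) (a : A.part 0) (n : ℤ) (b : A.part p) :
    (A.evenAct p a n b : V) = A.Y a n b := rfl

/-- Restriction of the vacuum, translation operator and fields to the even part. -/
def evenPre (A : VOSA V) : PreVertexSuperalgebra (A.part 0) where
  Γ := 1
  vac := ⟨A.vac, A.vac_mem⟩
  T := A.T.restrict (A.T_even 0)
  Y := A.evenAct 0

theorem self_eq_neg_of_complex {W : Type*} [AddCommGroup W] [Module ℂ W] {x : W}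
    (h : x = -x) : x = 0 := by
  have h2 : (2 : ℂ) • x = 0 := by
    rw [two_smul]; nth_rewrite 1 [h]; exact neg_add_cancel x
  exact (smul_eq_zero.1 h2).resolve_left two_ne_zero

theorem evenPre_part_zero (A : VOSA V) : A.evenPre.part 0 = ⊤ := by
  refine (Submodule.eq_top_iff').2 fun x => Module.End.mem_eigenspace_iff.2 ?_
  simp [evenPre]

theorem evenPre_part_one (A : VOSA V) : A.evenPre.part 1 = ⊥ := by
  refine (Submodule.eq_bot_iff _).2 fun x hx => ?_
  have e : (1 : ZMod 2).val = 1 := rfl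
  have h := Module.End.mem_eigenspace_iff.1 hx
  rw [e, pow_one, neg_smul, one_smul] at h
  exact self_eq_neg_of_complex h

theorem mulZSubW_iterate_coe (A : VOSA V) (N : ℕ) (F : ℤ → ℤ → Module.End ℂ (A.part 0))
    (G : ℤ → ℤ → Module.End ℂ V)
    (h : ∀ m k x, ((F m k x : A.part 0) : V) = G m k x) (m k : ℤ) (x : A.part 0) :
    ((mulZSubW^[N] F m k x : A.part 0) : V) = mulZSubW^[N] G m k x := by
  induction N generalizing F G with
  | zero => exact h m k x
  | succ N ih =>
    rw [Function.iterate_succ_apply, Function.iterate_succ_apply]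
    exact ih _ _ fun m k x => by simp [mulZSubW, h]

theorem part_zero_inf_one (A : VOSA V) {x : V} (h0 : x ∈ A.part 0) (h1 : x ∈ A.part 1) :
    x = 0 := by
  have e : (1 : ZMod 2).val = 1 := rfl
  simp only [PreVertexSuperalgebra.part, Module.End.mem_eigenspace_iff, ZMod.val_zero, pow_zero,
    one_smul, e, pow_one, neg_smul] at h0 h1
  exact self_eq_neg_of_complex (h0.symm.trans h1)

theorem map_even_eigenspace (A : VOSA V) (μ : ℂ) :
    ((A.evenAct 0 ⟨A.ν, A.ν_mem⟩ 1).eigenspace μ).map (A.part 0).subtype =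
      A.part 0 ⊓ (A.Y A.ν 1).eigenspace μ := by
  ext x
  simp [Subtype.ext_iff, and_comm]

theorem even_eigenspace_eq_bot (A : VOSA V) {μ : ℂ}
    (h : A.part 0 ⊓ (A.Y A.ν 1).eigenspace μ = ⊥) :
    (A.evenAct 0 ⟨A.ν, A.ν_mem⟩ 1).eigenspace μ = ⊥ := by
  rw [← map_even_eigenspace] at h
  refine Submodule.map_injective_of_injective (Submodule.subtype_injective (A.part 0)) ?_
  rw [h, Submodule.map_bot]

theorem iSup_even_eigenspace (A : VOSA V) :
    ⨆ n : ℤ, (A.evenAct 0 ⟨A.ν, A.ν_mem⟩ 1).eigenspace (n : ℂ) = ⊤ := by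
  apply Submodule.map_injective_of_injective (Submodule.subtype_injective (A.part 0))
  rw [Submodule.map_iSup, Submodule.map_subtype_top]
  simp only [map_even_eigenspace]
  conv_rhs => rw [A.even_eq]
  refine iSup_congr fun n => inf_eq_right.2 ?_
  rw [A.even_eq]
  exact le_iSup (fun n : ℤ => (A.Y A.ν 1).eigenspace (n : ℂ)) n

theorem even_finiteDimensional (A : VOSA V) (μ : ℂ)
    (h : FiniteDimensional ℂ ((A.Y A.ν 1).eigenspace μ)) :
    FiniteDimensional ℂ ((A.evenAct 0 ⟨A.ν, A.ν_mem⟩ 1).eigenspace μ) := by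
  have h1 : FiniteDimensional ℂ
      (((A.evenAct 0 ⟨A.ν, A.ν_mem⟩ 1).eigenspace μ).map (A.part 0).subtype) := by
    rw [map_even_eigenspace]
    exact Submodule.finiteDimensional_of_le inf_le_right
  exact LinearEquiv.finiteDimensional (Submodule.equivMapOfInjective _
    (Submodule.subtype_injective (A.part 0)) _).symm

theorem parity_cases (p : ZMod 2) : p = 0 ∨ p = 1 := by
  revert p; decide

theorem evenPre_mem_zero (A : VOSA V) (x : A.part 0) : x ∈ A.evenPre.part 0 := by
  rw [evenPre_part_zero]; exact Submodule.mem_top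

theorem evenPre_eq_zero (A : VOSA V) {x : A.part 0} (h : x ∈ A.evenPre.part 1) : x = 0 := by
  rw [evenPre_part_one] at h; exact h

theorem evenPre_parity (A : VOSA V) (p q : ZMod 2) (a : A.part 0) (ha : a ∈ A.evenPre.part p)
    (b : A.part 0) (hb : b ∈ A.evenPre.part q) (n : ℤ) :
    A.evenPre.Y a n b ∈ A.evenPre.part (p + q) := by
  rcases parity_cases p with rfl | rfl
  · rcases parity_cases q with rfl | rfl
    · exact A.evenPre_mem_zero _
    · rw [A.evenPre_eq_zero hb, map_zero]; exact Submodule.zero_mem _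
  · rw [A.evenPre_eq_zero ha, map_zero]; exact Submodule.zero_mem _

theorem evenPre_gradedComm (A : VOSA V) (p q : ZMod 2) (a : A.part 0)
    (ha : a ∈ A.evenPre.part p) (b : A.part 0) (hb : b ∈ A.evenPre.part q) :
    A.evenPre.gradedComm p q a b = A.evenPre.gradedComm 0 0 a b := by
  rcases parity_cases p with rfl | rfl
  · rcases parity_cases q with rfl | rfl
    · rfl
    · funext m k
      simp [PreVertexSuperalgebra.gradedComm, A.evenPre_eq_zero hb]
  · funext m k
    simp [PreVertexSuperalgebra.gradedComm, A.evenPre_eq_zero ha]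

theorem evenPre_locality (A : VOSA V) (p q : ZMod 2) (a : A.part 0)
    (ha : a ∈ A.evenPre.part p) (b : A.part 0) (hb : b ∈ A.evenPre.part q) :
    ∃ M : ℕ, 0 < M ∧ ∀ N : ℕ, M ≤ N → mulZSubW^[N] (A.evenPre.gradedComm p q a b) = 0 := by
  obtain ⟨M, hM, h⟩ := A.locality 0 0 a a.2 b b.2
  refine ⟨M, hM, fun N hN => ?_⟩
  rw [A.evenPre_gradedComm p q a ha b hb]
  funext m k
  ext x
  rw [mulZSubW_iterate_coe A N _ (A.gradedComm 0 0 a b), h N hN]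
  · simp
  · intro m k x
    simp [PreVertexSuperalgebra.gradedComm, evenPre]

/-- The even part of a VOSA, with the restricted structure. -/
def evenPart (A : VOSA V) : VOSA (A.part 0) where
  toPreVertexSuperalgebra := A.evenPre
  Γ_sq _ := rfl
  vac_mem := A.evenPre_mem_zero _
  T_even p a ha := by
    rcases parity_cases p with rfl | rfl
    · exact A.evenPre_mem_zero _
    · rw [A.evenPre_eq_zero ha, map_zero]; exact Submodule.zero_mem _
  parity := A.evenPre_parity
  locality := A.evenPre_locality
  ν_mem := A.evenPre_mem_zero _
  finite_dim D := A.even_finiteDimensional _ (A.finite_dim D)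
  field a b := by
    obtain ⟨N, hN⟩ := A.field a b
    exact ⟨N, fun n hn => Subtype.ext (hN n hn)⟩
  translation a n := by
    ext x
    simpa [evenPre] using LinearMap.congr_fun (A.translation a n) (x : V)
  vac_field n := by
    ext x
    have := LinearMap.congr_fun (A.vac_field n) (x : V)
    simp only [evenPre, coe_evenAct]
    rw [this]
    split_ifs <;> simp
  T_vac := Subtype.ext A.T_vac
  creation a := Subtype.ext (A.creation a)
  ν := ⟨A.ν, A.ν_mem⟩
  c := A.c
  virasoro n m := by
    ext x
    have := LinearMap.congr_fun (A.virasoro n m) (x : V)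
    split_ifs at this ⊢ with h <;> simpa [evenPre, h] using this
  L_neg_one := by
    ext x
    exact LinearMap.congr_fun A.L_neg_one (x : V)
  diagonalizable := by
    refine top_le_iff.1 ?_
    rw [← A.iSup_even_eigenspace]
    exact iSup_le fun n => le_iSup (fun μ : ℂ =>
      (A.evenAct 0 ⟨A.ν, A.ν_mem⟩ 1).eigenspace μ) (n : ℂ)
  weight_half_int μ hμ := A.even_eigenspace_eq_bot (by rw [A.weight_half_int μ hμ, inf_bot_eq])
  even_eq := by rw [evenPre_part_zero]; exact A.iSup_even_eigenspace.symm
  odd_eq := by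
    rw [evenPre_part_one]
    refine (iSup_eq_bot.2 fun n => A.even_eigenspace_eq_bot ?_).symm
    refine (Submodule.eq_bot_iff _).2 fun x hx => A.part_zero_inf_one hx.1 ?_
    rw [A.odd_eq]
    exact Submodule.mem_iSup_of_mem n hx.2
  bounded_below := by
    obtain ⟨N, hN, h⟩ := A.bounded_below
    exact ⟨N, hN, fun D hD => A.even_eigenspace_eq_bot (by rw [h D hD, inf_bot_eq])⟩

/-- The odd part of a VOSA with its grading and the restricted action of the even part. -/
def oddPart (A : VOSA V) : A.evenPart.PreModule (A.part 1) where
  part p := (A.part p).comap (A.part 1).subtype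
  Y := A.evenAct 1

end VOSA

open Function

/-! The substance is the construction of a conjugation on V out of the unitary data on its two
parts. Give V the orthogonal sum of the two forms. Then T and L₁ are adjoint, so every homogeneous
vector is a quasi-primary vector (one killed by L₁) plus a derivative T y (`exists_add_T`), and most
statements reduce to quasi-primary vectors. If θ exists, invariance forces (θ a | c) = ±(Ω | a_(D-1)
c) for a odd and quasi-primary of weight D/2. This formula, extended to derivatives, defines an
antilinear map `oddConj` on V₁. Locality and a uniqueness argument of Goddard type give its adjoint
relation on even vectors (`form_oddConj_Y`), and skew-symmetry then makes it equivariant over θ on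
V₀ (`oddConj_Y`).

Hence the square of `oddConj` commutes with V₀ up to θ² = 1, and by Schur's lemma it is a scalar μ
on the irreducible V₁. Since the squared norm of the conjugate of a is the conjugate of μ times that
of a, μ is positive as soon as `oddConj` is nonzero. If it were zero, all products of two odd
vectors would vanish and V₁ would be an ideal without Ω, so V₁ = 0 (`part_one_eq_bot`). Rescaling
the form on V₁ turns μ into 1 (`IsSimple.isUnitary`), and θ and `oddConj` together form the PCT
operator.

For simplicity and irreducibility: if S in V_p is stable under V₀, the span of all a_(n) s is an
ideal whose component in V_p is S. That unitarity passes to the two parts is a matter of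
restriction, because θ fixes ν and so preserves weights and parity.

All this rests on the Borcherds identity, which is not an axiom for V itself. It is derived from
locality through Dong's lemma (`residueModes_local`) and the n-th product formula
(`residueModes_zero`). -/

/-! ### Finite sums with binomial coefficients -/

theorem hasFiniteSupport_of_ge {E : Type*} [Zero E] {f : ℕ → E} (K : ℕ)
    (h : ∀ j, K ≤ j → f j = 0) : f.HasFiniteSupport :=
  (Set.finite_lt_nat K).subset fun j hj => by
    by_contra hn
    exact hj (h j (not_lt.1 hn))

theorem finsum_nat_eq_add {E : Type*} [AddCommMonoid E] {f : ℕ → E} (hf : f.HasFiniteSupport) :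
    ∑ᶠ j, f j = f 0 + ∑ᶠ j, f (j + 1) := by
  obtain ⟨K, hK⟩ : ∃ K, ∀ j, K ≤ j → f j = 0 := by
    obtain ⟨K, hK⟩ := hf.bddAbove
    exact ⟨K + 1, fun j hj => by
      by_contra hn
      exact absurd (hK hn) (by omega)⟩
  rw [finsum_eq_sum_of_support_subset f (s := Finset.range (K + 1)),
    finsum_eq_sum_of_support_subset _ (s := Finset.range K), Finset.sum_range_succ']
  · exact add_comm _ _
  · intro j hj
    by_contra hn
    exact hj (hK _ (by simpa using Nat.le_succ_of_le (by simpa using hn)))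
  · intro j hj
    by_contra hn
    exact hj (hK _ (by simp at hn; omega))

/-- Pascal's rule, summed over j. It gives the left side of the Borcherds identity its recursion in
the exponents. -/
theorem finsum_choose_succ {E : Type*} [AddCommGroup E] (m : ℤ) {X : ℕ → E}
    (hX : X.HasFiniteSupport) :
    ∑ᶠ j : ℕ, Ring.choose (m + 1) j • X j =
      ∑ᶠ j : ℕ, Ring.choose m j • X j + ∑ᶠ j : ℕ, Ring.choose m j • X (j + 1) := by
  have h (c : ℕ → ℤ) : (fun j => c j • X j).HasFiniteSupport :=
    hX.subset fun j hj h0 => hj (by simp [h0])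
  have hX' : (fun j => X (j + 1)).HasFiniteSupport :=
    Set.Finite.preimage (f := fun j : ℕ => j + 1) (add_left_injective 1).injOn hX
  have h' (c : ℕ → ℤ) : (fun j => c j • X (j + 1)).HasFiniteSupport :=
    hX'.subset fun j hj h0 => hj (by simp [h0])
  rw [finsum_nat_eq_add (h _), finsum_nat_eq_add (h fun j => Ring.choose m j)]
  simp only [Ring.choose_zero_right, Ring.choose_succ_succ, add_smul]
  rw [finsum_add_distrib (h' _) (h' fun j => Ring.choose m (j + 1))]
  abel

theorem finsum_signed_choose_succ {E : Type*} [AddCommGroup E] (n : ℤ) {X : ℕ → E}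
    (hX : X.HasFiniteSupport) :
    ∑ᶠ j : ℕ, ((-1) ^ j * Ring.choose (n + 1) j) • X j =
      ∑ᶠ j : ℕ, ((-1) ^ j * Ring.choose n j) • X j -
        ∑ᶠ j : ℕ, ((-1) ^ j * Ring.choose n j) • X (j + 1) := by
  have h := finsum_choose_succ n (X := fun j => (-1 : ℤ) ^ j • X j)
    (hX.subset fun j hj h0 => hj (by simp [h0]))
  simp only [smul_smul, pow_succ, mul_neg, mul_one] at h
  simpa only [mul_comm, sub_eq_add_neg, neg_mul, neg_smul, finsum_neg_distrib] using h

/-! ### Products of two fields with a factor (z - w)^n -/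

section Modes

variable {V : Type*} [AddCommGroup V] [Module ℂ V]

/-- A sequence of operators is a field if every vector is annihilated by all large modes. -/
def IsQuantumField (a : ℤ → Module.End ℂ V) : Prop :=
  ∀ v, ∃ N : ℕ, ∀ n : ℤ, (N : ℤ) ≤ n → a n v = 0

/-- The coefficients of `z^m w^k (z - w)^n a(z) b(w)`, expanded in the domain `|z| > |w|`. -/
noncomputable def prodModes (a b : ℤ → Module.End ℂ V) (m n k : ℤ) (v : V) : V :=
  ∑ᶠ j : ℕ, ((-1) ^ j * Ring.choose n j) • a (m + n - j) (b (k + j) v)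

/-- The residue in `z` of `z^m w^k (z - w)^n [a(z), b(w)]`, with both expansions. -/
noncomputable def residueModes (ε : ℂ) (a b : ℤ → Module.End ℂ V) (m n k : ℤ) (v : V) : V :=
  prodModes a b m n k v - (ε * (-1 : ℂ) ^ n) • prodModes b a k n m v

theorem IsQuantumField.hasFiniteSupport {b : ℤ → Module.End ℂ V} (hb : IsQuantumField b) (v : V) (k : ℤ)
    (f : ℕ → V → V) (hf : ∀ j, f j 0 = 0) :
    (fun j : ℕ => f j (b (k + j) v)).HasFiniteSupport := by
  obtain ⟨N, hN⟩ := hb v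
  refine hasFiniteSupport_of_ge (N + k.natAbs) fun j hj => ?_
  rw [hN _ (by omega), hf]

theorem prodModes_hasFiniteSupport (a : ℤ → Module.End ℂ V) {b : ℤ → Module.End ℂ V}
    (hb : IsQuantumField b) (m n k : ℤ) (v : V) :
    (fun j : ℕ => ((-1) ^ j * Ring.choose n j) • a (m + n - j) (b (k + j) v)).HasFiniteSupport :=
  hb.hasFiniteSupport v k (fun j x => ((-1) ^ j * Ring.choose n j) • a (m + n - j) x) (by simp)

/-- Comes from (z - w)^(n+1) = z (z - w)^n - w (z - w)^n. -/
theorem prodModes_succ (a : ℤ → Module.End ℂ V) {b : ℤ → Module.End ℂ V} (hb : IsQuantumField b)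
    (m n k : ℤ) (v : V) :
    prodModes a b m (n + 1) k v = prodModes a b (m + 1) n k v - prodModes a b m n (k + 1) v := by
  have h := finsum_signed_choose_succ n
    (hb.hasFiniteSupport v k (fun j x => a (m + 1 + n - j) x) (by simp))
  simp only [prodModes]
  convert h using 4 with j j
  · rw [add_right_comm, add_assoc m]
  · congr 2
    · congr 1; push_cast; ring
    · rw [show k + 1 + (j : ℤ) = k + ((j + 1 : ℕ) : ℤ) by push_cast; ring]

/-- Comes from z = (z - w) + w, where the sign (-1)^n accounts for w - z in the opposite expansion.
This recursion drives both Dong's lemma and the Borcherds identity. -/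
theorem residueModes_succ (ε : ℂ) {a b : ℤ → Module.End ℂ V} (ha : IsQuantumField a) (hb : IsQuantumField b)
    (m n k : ℤ) (v : V) :
    residueModes ε a b (m + 1) n k v =
      residueModes ε a b m (n + 1) k v + residueModes ε a b m n (k + 1) v := by
  simp only [residueModes, prodModes_succ a hb m n k v, prodModes_succ b ha k n m v,
    zpow_add_one₀ (show (-1 : ℂ) ≠ 0 by norm_num)]
  module

theorem prodModes_zero (a b : ℤ → Module.End ℂ V) (m k : ℤ) (v : V) :
    prodModes a b m 0 k v = a m (b k v) := by
  rw [prodModes, finsum_eq_single _ 0]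
  · simp
  · intro j hj
    rw [Ring.choose_zero_pos _ (Nat.pos_of_ne_zero hj), mul_zero, zero_smul]

theorem prodModes_natCast (a : ℤ → Module.End ℂ V) {b : ℤ → Module.End ℂ V} (hb : IsQuantumField b)
    (N : ℕ) (m k : ℤ) (v : V) :
    prodModes a b m N k v = mulZSubW^[N] (fun m k => a m (b k v)) m k := by
  induction N generalizing m k with
  | zero => simpa using prodModes_zero a b m k v
  | succ N ih =>
    rw [Nat.cast_succ, prodModes_succ a hb, ih, ih, iterate_succ_apply']
    rfl

theorem prodModes_swap_natCast {a : ℤ → Module.End ℂ V} (ha : IsQuantumField a)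
    (b : ℤ → Module.End ℂ V) (N : ℕ) (m k : ℤ) (v : V) :
    (-1 : ℂ) ^ (N : ℤ) • prodModes b a k N m v =
      mulZSubW^[N] (fun m k => b k (a m v)) m k := by
  induction N generalizing m k with
  | zero => simpa using prodModes_zero b a k m v
  | succ N ih =>
    rw [iterate_succ_apply', mulZSubW, ← ih, ← ih, Nat.cast_succ, prodModes_succ b ha,
      zpow_add_one₀ (by norm_num)]
    module

theorem mulZSubW_iterate_map {E F : Type*} [AddCommGroup E] [AddCommGroup F] (φ : E →+ F)
    (N : ℕ) (G : ℤ → ℤ → E) (m k : ℤ) :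
    mulZSubW^[N] (fun m k => φ (G m k)) m k = φ (mulZSubW^[N] G m k) := by
  induction N generalizing m k with
  | zero => rfl
  | succ N ih => simp only [iterate_succ_apply', mulZSubW, ih, map_sub]

theorem mulZSubW_iterate_sub_smul (N : ℕ) (ε : ℂ) (F G : ℤ → ℤ → V) (m k : ℤ) :
    mulZSubW^[N] (fun m k => F m k - ε • G m k) m k =
      mulZSubW^[N] F m k - ε • mulZSubW^[N] G m k := by
  induction N generalizing m k with
  | zero => rfl
  | succ N ih =>
    simp only [iterate_succ_apply', mulZSubW, ih]
    module

/-- Mutual locality of two fields with sign `ε`. -/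
def IsMutuallyLocal (ε : ℂ) (a b : ℤ → Module.End ℂ V) : Prop :=
  ∃ M : ℕ, ∀ N : ℕ, M ≤ N → ∀ v, mulZSubW^[N] (fun m k => a m (b k v) - ε • b k (a m v)) = 0

/-- For a natural exponent n the two expansions of (z - w)^n coincide, so the residue is a
coefficient of (z - w)^n times the commutator. -/
theorem IsMutuallyLocal.residueModes_eq_zero {ε : ℂ} {a b : ℤ → Module.End ℂ V} (h : IsMutuallyLocal ε a b)
    (ha : IsQuantumField a) (hb : IsQuantumField b) :
    ∃ N : ℤ, ∀ n, N ≤ n → ∀ m k v, residueModes ε a b m n k v = 0 := by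
  obtain ⟨M, hM⟩ := h
  refine ⟨M, fun n hn m k v => ?_⟩
  lift n to ℕ using by omega
  rw [residueModes, mul_smul, prodModes_natCast a hb, prodModes_swap_natCast ha,
    ← mulZSubW_iterate_sub_smul, hM n (by exact_mod_cast hn)]
  rfl

end Modes

/-! ### Dong's lemma, with variables z, w for the product and x for the third field -/

section Dong

variable {V : Type*} [AddCommGroup V] [Module ℂ V]

/-- Multiplication of a formal distribution in three variables by the difference of the last
two variables. -/
def diffSndThd (V : Type*) [AddCommGroup V] [Module ℂ V] : Module.End ℂ (ℤ → ℤ → ℤ → V) where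
  toFun h m k l := h m (k + 1) l - h m k (l + 1)
  map_add' f g := by funext m k l; simp only [Pi.add_apply]; abel
  map_smul' r f := by funext m k l; simp [smul_sub]

/-- Multiplication of a formal distribution in three variables by the difference of the first and
the last variable. -/
def diffFstThd (V : Type*) [AddCommGroup V] [Module ℂ V] : Module.End ℂ (ℤ → ℤ → ℤ → V) where
  toFun h m k l := h (m + 1) k l - h m k (l + 1)
  map_add' f g := by funext m k l; simp only [Pi.add_apply]; abel
  map_smul' r f := by funext m k l; simp [smul_sub]

theorem diffSndThd_apply (h : ℤ → ℤ → ℤ → V) (m k l : ℤ) :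
    diffSndThd V h m k l = h m (k + 1) l - h m k (l + 1) := rfl

theorem diffFstThd_apply (h : ℤ → ℤ → ℤ → V) (m k l : ℤ) :
    diffFstThd V h m k l = h (m + 1) k l - h m k (l + 1) := rfl

theorem commute_diffSndThd_diffFstThd : Commute (diffSndThd V) (diffFstThd V) := by
  refine LinearMap.ext fun h => ?_
  funext m k l
  simp only [Module.End.mul_apply, diffSndThd_apply, diffFstThd_apply]
  abel

theorem diffSndThd_pow_apply (N : ℕ) (h : ℤ → ℤ → ℤ → V) (m k l : ℤ) :
    (diffSndThd V ^ N) h m k l = mulZSubW^[N] (fun k l => h m k l) k l := by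
  induction N generalizing k l with
  | zero => rfl
  | succ N ih =>
    rw [pow_succ', Module.End.mul_apply, diffSndThd_apply, ih, ih, iterate_succ_apply']
    rfl

theorem diffFstThd_pow_apply (N : ℕ) (h : ℤ → ℤ → ℤ → V) (m k l : ℤ) :
    (diffFstThd V ^ N) h m k l = mulZSubW^[N] (fun m l => h m k l) m l := by
  induction N generalizing m l with
  | zero => rfl
  | succ N ih =>
    rw [pow_succ', Module.End.mul_apply, diffFstThd_apply, ih, ih, iterate_succ_apply']
    rfl

theorem mulZSubW_iterate_shift {E : Type*} [AddCommGroup E] (N : ℕ) (G : ℤ → ℤ → E)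
    (t k l : ℤ) :
    mulZSubW^[N] (fun k l => G (k + t) l) k l = mulZSubW^[N] G (k + t) l := by
  induction N generalizing k l with
  | zero => rfl
  | succ N ih => simp only [iterate_succ_apply', mulZSubW, ih, add_right_comm]

/-- The terms of the commutator of a product of two fields with a third field are killed by
`((z - x) (w - x))^N`. -/
theorem diff_pow_comm_eq_zero {a b c : ℤ → Module.End ℂ V} {ε η : ℂ} {N : ℕ}
    (hac : ∀ v, mulZSubW^[N] (fun m l => a m (c l v) - ε • c l (a m v)) = 0)
    (hbc : ∀ v, mulZSubW^[N] (fun k l => b k (c l v) - η • c l (b k v)) = 0) (s t : ℤ) (x : V) :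
    (diffFstThd V ^ N * diffSndThd V ^ N) (fun m k l =>
      a (m + s) (b (k + t) (c l x)) - (ε * η) • c l (a (m + s) (b (k + t) x))) = 0 := by
  have h1 : (diffSndThd V ^ N) (fun m k l =>
      a (m + s) (b (k + t) (c l x) - η • c l (b (k + t) x))) = 0 := by
    funext m k l
    rw [diffSndThd_pow_apply]
    refine (mulZSubW_iterate_map (a (m + s)).toAddMonoidHom N
        (fun k l => b (k + t) (c l x) - η • c l (b (k + t) x)) k l).trans ?_
    rw [mulZSubW_iterate_shift N (fun k l => b k (c l x) - η • c l (b k x)), hbc x]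
    simp
  have h2 : (diffFstThd V ^ N) (fun m k l =>
      a (m + s) (c l (b (k + t) x)) - ε • c l (a (m + s) (b (k + t) x))) = 0 := by
    funext m k l
    rw [diffFstThd_pow_apply,
      mulZSubW_iterate_shift N
        (fun m l => a m (c l (b (k + t) x)) - ε • c l (a m (b (k + t) x))), hac]
    simp
  -- The commutator of ab with c splits as a[b,c] plus η[a,c]b. The first term is killed by (w -
  -- x)^N, the second by (z - x)^N.
  have h3 : (fun m k l =>
      a (m + s) (b (k + t) (c l x)) - (ε * η) • c l (a (m + s) (b (k + t) x))) =
      (fun m k l : ℤ => a (m + s) (b (k + t) (c l x) - η • c l (b (k + t) x))) + η •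
      (fun m k l : ℤ =>
        a (m + s) (c l (b (k + t) x)) - ε • c l (a (m + s) (b (k + t) x))) := by
    funext m k l
    simp only [Pi.add_apply, Pi.smul_apply, map_sub, map_smul]
    module
  have hcomm : Commute (diffFstThd V ^ N) (diffSndThd V ^ N) :=
    (commute_diffSndThd_diffFstThd.pow_pow N N).symm
  rw [h3, map_add, map_smul, Module.End.mul_apply, h1, map_zero, hcomm.eq, Module.End.mul_apply,
    h2]
  simp

/-- The polynomial (z - x)^N (w - x)^N is symmetric in z and w. This covers the half of
`residueModes` in which the two fields are interchanged. -/
theorem diff_pow_swap (N : ℕ) (h : ℤ → ℤ → ℤ → V) (m k l : ℤ) :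
    (diffFstThd V ^ N * diffSndThd V ^ N) (fun m k l => h k m l) m k l =
      (diffFstThd V ^ N * diffSndThd V ^ N) h k m l := by
  have h1 (g : ℤ → ℤ → ℤ → V) : (diffSndThd V ^ N) (fun m k l => g k m l) =
      fun m k l => (diffFstThd V ^ N) g k m l := by
    funext m k l
    rw [diffSndThd_pow_apply, diffFstThd_pow_apply]
  have h2 (g : ℤ → ℤ → ℤ → V) : (diffFstThd V ^ N) (fun m k l => g k m l) =
      fun m k l => (diffSndThd V ^ N) g k m l := by
    funext m k l
    rw [diffSndThd_pow_apply, diffFstThd_pow_apply]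
  rw [Module.End.mul_apply, h1, h2, (commute_diffSndThd_diffFstThd.pow_pow N N).symm.eq]
  rfl

/-- The n-th product is an infinite sum that is finite only coefficientwise, so the vanishing of its
terms has to be carried through `finsum`. -/
theorem diff_finsum {Θ : ℕ → ℤ → ℤ → ℤ → V}
    (hΘ : ∀ m k l, (fun j => Θ j m k l).HasFiniteSupport) (N : ℕ)
    (h0 : ∀ j, (diffFstThd V ^ N * diffSndThd V ^ N) (Θ j) = 0) :
    (diffFstThd V ^ N * diffSndThd V ^ N) (fun m k l => ∑ᶠ j, Θ j m k l) = 0 := by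
  have key (i : ℕ) : ∀ Θ : ℕ → ℤ → ℤ → ℤ → V,
      (∀ m k l, (fun j => Θ j m k l).HasFiniteSupport) →
      (∀ m k l, (fun j => (diffSndThd V ^ i) (Θ j) m k l).HasFiniteSupport) ∧
      (diffSndThd V ^ i) (fun m k l => ∑ᶠ j, Θ j m k l) =
        fun m k l => ∑ᶠ j, (diffSndThd V ^ i) (Θ j) m k l := by
    induction i with
    | zero => exact fun Θ h => ⟨h, rfl⟩
    | succ i ih =>
      intro Θ h
      obtain ⟨h1, h2⟩ := ih Θ h
      simp only [pow_succ' _ i, Module.End.mul_apply, h2]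
      refine ⟨fun m k l => (h1 m (k + 1) l).sub (h1 m k (l + 1)), ?_⟩
      funext m k l
      exact (finsum_sub_distrib (h1 m (k + 1) l) (h1 m k (l + 1))).symm
  have key' (i : ℕ) : ∀ Θ : ℕ → ℤ → ℤ → ℤ → V,
      (∀ m k l, (fun j => Θ j m k l).HasFiniteSupport) →
      (∀ m k l, (fun j => (diffFstThd V ^ i) (Θ j) m k l).HasFiniteSupport) ∧
      (diffFstThd V ^ i) (fun m k l => ∑ᶠ j, Θ j m k l) =
        fun m k l => ∑ᶠ j, (diffFstThd V ^ i) (Θ j) m k l := by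
    induction i with
    | zero => exact fun Θ h => ⟨h, rfl⟩
    | succ i ih =>
      intro Θ h
      obtain ⟨h1, h2⟩ := ih Θ h
      simp only [pow_succ' _ i, Module.End.mul_apply, h2]
      refine ⟨fun m k l => (h1 (m + 1) k l).sub (h1 m k (l + 1)), ?_⟩
      funext m k l
      exact (finsum_sub_distrib (h1 (m + 1) k l) (h1 m k (l + 1))).symm
  obtain ⟨h1, h2⟩ := key N Θ hΘ
  rw [Module.End.mul_apply, h2, (key' N _ h1).2]
  funext m k l
  refine finsum_eq_zero_of_forall_eq_zero fun j => ?_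
  rw [← Module.End.mul_apply, h0]
  rfl

theorem diff_pow_prodModes_comm {a b c : ℤ → Module.End ℂ V} {ε η : ℂ} {N : ℕ}
    (hb : IsQuantumField b)
    (hac : ∀ v, mulZSubW^[N] (fun m l => a m (c l v) - ε • c l (a m v)) = 0)
    (hbc : ∀ v, mulZSubW^[N] (fun k l => b k (c l v) - η • c l (b k v)) = 0) (n : ℤ) (x : V) :
    (diffFstThd V ^ N * diffSndThd V ^ N) (fun m k l =>
      prodModes a b m n k (c l x) - (ε * η) • c l (prodModes a b m n k x)) = 0 := by
  have e : (fun m k l => prodModes a b m n k (c l x) - (ε * η) • c l (prodModes a b m n k x)) =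
      fun m k l => ∑ᶠ j : ℕ, ((((-1 : ℤ) ^ j * Ring.choose n j : ℤ) : ℂ) • (fun m k l : ℤ =>
        a (m + (n - j)) (b (k + j) (c l x)) -
          (ε * η) • c l (a (m + (n - j)) (b (k + j) x)))) m k l := by
    funext m k l
    have h1 := prodModes_hasFiniteSupport a hb m n k (c l x)
    have h2 := prodModes_hasFiniteSupport a hb m n k x
    rw [prodModes, prodModes, map_finsum _ h2, smul_finsum,
      ← finsum_sub_distrib h1 (h2.subset fun j hj h0 => hj (by simp [h0]))]
    refine finsum_congr fun j => ?_
    simp only [Pi.smul_apply, Int.cast_smul_eq_zsmul, smul_sub, ← add_sub_assoc, map_zsmul]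
    rw [smul_comm]
  rw [e]
  refine diff_finsum (fun m k l => ?_) N fun j => ?_
  · have h1 := prodModes_hasFiniteSupport a hb m n k (c l x)
    have h2 := prodModes_hasFiniteSupport a hb m n k x
    refine (h1.union h2).subset fun j hj => ?_
    by_contra hn
    simp only [Set.mem_union, mem_support, not_or, not_not] at hn
    refine hj ?_
    have := hn.2
    simp only [Pi.smul_apply, Int.cast_smul_eq_zsmul, smul_sub, ← add_sub_assoc, hn.1]
    rw [smul_comm, ← map_zsmul, hn.2]
    simp
  · rw [map_smul, diff_pow_comm_eq_zero hac hbc, smul_zero]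

/-- Dong's lemma: products of mutually local fields are local. -/
theorem residueModes_local {a b c : ℤ → Module.End ℂ V} {ε η κ : ℂ} (ha : IsQuantumField a)
    (hb : IsQuantumField b) (hac : IsMutuallyLocal ε a c) (hbc : IsMutuallyLocal η b c)
    (hab : IsMutuallyLocal κ a b) (n : ℤ) (x : V) :
    ∃ M : ℕ, (diffSndThd V ^ M) (fun m k l =>
      residueModes κ a b m n k (c l x) - (ε * η) • c l (residueModes κ a b m n k x)) = 0 := by
  obtain ⟨N0, hN0⟩ := hab.residueModes_eq_zero ha hb
  obtain ⟨N1, hN1⟩ := hac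
  obtain ⟨N2, hN2⟩ := hbc
  set N := max N1 N2
  set u := diffSndThd V
  set v := diffFstThd V
  have hcomm : Commute u v := commute_diffSndThd_diffFstThd
  set S : ℤ → ℤ → ℤ → ℤ → V := fun n m k l =>
    residueModes κ a b m n k (c l x) - (ε * η) • c l (residueModes κ a b m n k x) with hS
  have hkill (n : ℤ) : (v ^ N * u ^ N) (S n) = 0 := by
    have h1 := diff_pow_prodModes_comm hb (hN1 N (le_max_left _ _)) (hN2 N (le_max_right _ _)) n x
    have h2 := diff_pow_prodModes_comm ha (hN2 N (le_max_right _ _)) (hN1 N (le_max_left _ _)) n x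
    have e : S n = (fun m k l =>
        prodModes a b m n k (c l x) - (ε * η) • c l (prodModes a b m n k x)) -
        (κ * (-1 : ℂ) ^ n) • (fun m k l => (fun m k l =>
        prodModes b a m n k (c l x) - (η * ε) • c l (prodModes b a m n k x)) k m l) := by
      funext m k l
      simp only [hS, residueModes, map_sub, map_smul, Pi.sub_apply, Pi.smul_apply]
      module
    rw [e, map_sub, map_smul, h1]
    have h3 : (v ^ N * u ^ N) (fun m k l => (fun m k l =>
        prodModes b a m n k (c l x) - (η * ε) • c l (prodModes b a m n k x)) k m l) = 0 := by
      funext m k l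
      rw [diff_pow_swap, h2]
      rfl
    rw [h3]
    simp
  -- This is z - x = (w - x) + (z - w), the factor z - w raising n by one.
  have hrec (n : ℤ) : v (S n) = u (S n) + S (n + 1) := by
    funext m k l
    simp only [u, v, diffFstThd_apply, diffSndThd_apply, Pi.add_apply, hS,
      residueModes_succ κ ha hb m n k, map_add]
    module
  have hlarge (n : ℤ) (hn : N0 ≤ n) : S n = 0 := by
    funext m k l
    simp [hS, hN0 n hn]
  -- Downward induction on n, starting where locality of a and b makes S n vanish.
  suffices h : ∀ i : ℕ, ∀ n, N0 ≤ n + i → ∃ M : ℕ, (u ^ M) (S n) = 0 by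
    exact h (N0 - n).toNat n (by omega)
  intro i
  induction i with
  | zero => exact fun n hn => ⟨0, by simp [hlarge n (by simpa using hn)]⟩
  | succ i ih =>
    intro n hn
    obtain ⟨M, hM⟩ := ih (n + 1) (by push_cast at hn; omega)
    -- After applying u^M, the operator v acts on S n as u does: by `hrec` the discrepancy comes
    -- from S (n + 1), which u^M kills.
    have hc : ∀ j : ℕ, (u ^ M) ((v ^ j) (S n)) = (u ^ (M + j)) (S n) := by
      intro j
      induction j with
      | zero => simp
      | succ j ihj =>
        have h1 : (u ^ M) ((v ^ j) (S (n + 1))) = 0 := by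
          rw [← Module.End.mul_apply, (hcomm.pow_pow M j).eq, Module.End.mul_apply, hM, map_zero]
        have h2 : (u ^ M) ((v ^ j) (u (S n))) = u ((u ^ M) ((v ^ j) (S n))) := by
          simp only [← Module.End.mul_apply]
          rw [(((Commute.refl u).pow_right M).mul_right (hcomm.pow_right j)).eq, mul_assoc]
        rw [pow_succ v j, Module.End.mul_apply, hrec, map_add, map_add, h1, add_zero, h2, ihj,
          ← Module.End.mul_apply, ← pow_succ', add_assoc]
    -- M + N factors u replace u^M v^N, and the other N supply the u^N needed for `hkill`.
    refine ⟨M + N + N, ?_⟩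
    rw [add_comm, pow_add, Module.End.mul_apply, ← hc N]
    have := hkill n
    rw [(hcomm.pow_pow N N).symm.eq] at this
    rw [← Module.End.mul_apply, ← Module.End.mul_apply, mul_assoc, ((Commute.refl u).pow_pow N M).left_comm,
      Module.End.mul_apply, this, map_zero]

end Dong

/-! ### From locality to the Borcherds identity -/

namespace VOSA

variable {V : Type*} [AddCommGroup V] [Module ℂ V] (A : VOSA V)

theorem isQuantumField (a : V) : IsQuantumField (A.Y a) := A.field a

theorem isMutuallyLocal {p q : ZMod 2} {a b : V} (ha : a ∈ A.part p) (hb : b ∈ A.part q) :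
    IsMutuallyLocal (paritySign p q) (A.Y a) (A.Y b) := by
  obtain ⟨M, -, hM⟩ := A.locality p q a ha b hb
  refine ⟨M, fun N hN v => ?_⟩
  funext m k
  have h := mulZSubW_iterate_map (LinearMap.applyₗ (R := ℂ) (M₂ := V) v).toAddMonoidHom N
    (A.gradedComm p q a b) m k
  rw [hM N hN] at h
  simpa [PreVertexSuperalgebra.gradedComm] using h

theorem exists_parity_add (a : V) : ∃ b ∈ A.part 0, ∃ c ∈ A.part 1, a = b + c := by
  have e : (1 : ZMod 2).val = 1 := rfl
  refine ⟨(1 / 2 : ℂ) • (a + A.Γ a), ?_, (1 / 2 : ℂ) • (a - A.Γ a), ?_, by module⟩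
  · simp only [PreVertexSuperalgebra.part, Module.End.mem_eigenspace_iff, map_smul, map_add,
      A.Γ_sq, ZMod.val_zero]
    module
  · simp only [PreVertexSuperalgebra.part, Module.End.mem_eigenspace_iff, map_smul, map_sub,
      A.Γ_sq, e]
    module

theorem parity_induction {P : V → Prop} (hom : ∀ p, ∀ a ∈ A.part p, P a)
    (add : ∀ a b, P a → P b → P (a + b)) (a : V) : P a := by
  obtain ⟨b, hb, c, hc, rfl⟩ := A.exists_parity_add a
  exact add _ _ (hom 0 b hb) (hom 1 c hc)

theorem T_Y (a : V) (n : ℤ) (v : V) :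
    A.T (A.Y a n v) = A.Y a n (A.T v) - n • A.Y a (n - 1) v := by
  have h := LinearMap.congr_fun (A.translation a n) v
  simp only [LinearMap.sub_apply, Module.End.mul_apply, neg_smul, LinearMap.neg_apply] at h
  rw [sub_eq_iff_eq_add] at h
  rw [h, neg_add_eq_sub]
  rfl

theorem T_Y_vac (a : V) (n : ℤ) : A.T (A.Y a n A.vac) = -(n • A.Y a (n - 1) A.vac) := by
  rw [A.T_Y, A.T_vac, map_zero, zero_sub]

/-- True for large n by the field axiom. Applying T to a_(n+1) Ω = 0 then lowers the index, and the
factor n + 1 is nonzero as long as n ≥ 0. -/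
theorem Y_vac_eq_zero (a : V) {n : ℤ} (hn : 0 ≤ n) : A.Y a n A.vac = 0 := by
  obtain ⟨N, hN⟩ := A.field a A.vac
  suffices h : ∀ i : ℕ, ∀ n : ℤ, 0 ≤ n → (N : ℤ) ≤ n + i → A.Y a n A.vac = 0 from
    h N n hn (by omega)
  intro i
  induction i with
  | zero => exact fun n _ h => hN n (by simpa using h)
  | succ i ih =>
    intro n h0 h1
    have h := A.T_Y_vac a (n + 1)
    rw [ih (n + 1) (by omega) (by push_cast at h1; omega), map_zero, add_sub_cancel_right, eq_comm,
      neg_eq_zero, ← Int.cast_smul_eq_zsmul ℂ] at h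
    exact (smul_eq_zero.1 h).resolve_left (by exact_mod_cast (by omega : n + 1 ≠ 0))

theorem succ_mul_choose_succ (n : ℤ) (j : ℕ) :
    ((j : ℤ) + 1) * Ring.choose n (j + 1) = (n - j) * Ring.choose n j := by
  have h := Ring.choose_smul_choose n (Nat.le_succ j)
  rw [Nat.succ_eq_add_one, Nat.choose_succ_self_right, Nat.add_sub_cancel_left,
    Ring.choose_one_right, nsmul_eq_mul] at h
  push_cast at h
  rw [h, mul_comm]

/-- T lowers the mode of each factor in turn. Because (j+1) C(n,j+1) = (n-j) C(n,j), all
contributions except those with factor k telescope away. -/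
theorem T_prodModes_vac (a b : V) (n k : ℤ) :
    A.T (prodModes (A.Y a) (A.Y b) 0 n k A.vac) =
      -(k • prodModes (A.Y a) (A.Y b) 0 n (k - 1) A.vac) := by
  have hb := A.isQuantumField b
  set X : ℕ → V := fun j => A.Y a (0 + n - j) (A.Y b (k - 1 + j) A.vac) with hXdef
  have hX : X.HasFiniteSupport :=
    hb.hasFiniteSupport A.vac (k - 1) (fun j x => A.Y a (0 + n - j) x) (by simp)
  have hs (c : ℕ → ℤ) : (fun j => c j • X j).HasFiniteSupport :=
    hX.subset fun j hj h0 => hj (by simp [h0])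
  have hX' : (fun j => X (j + 1)).HasFiniteSupport :=
    Set.Finite.preimage (f := fun j : ℕ => j + 1) (add_left_injective 1).injOn hX
  have hs' (c : ℕ → ℤ) : (fun j => c j • X (j + 1)).HasFiniteSupport :=
    hX'.subset fun j hj h0 => hj (by simp [h0])
  have hshift := finsum_nat_eq_add (hs fun j => j * ((-1) ^ j * Ring.choose n j))
  have e1 (j : ℕ) : (((-1) ^ j * Ring.choose n j : ℤ)) •
      A.T (A.Y a (0 + n - j) (A.Y b (k + j) A.vac)) =
      (-k) • (((-1) ^ j * Ring.choose n j : ℤ) • X j) - ((j * ((-1) ^ j * Ring.choose n j)) • X j -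
        ((((j + 1 : ℕ) : ℤ) * ((-1) ^ (j + 1) * Ring.choose n (j + 1)))) • X (j + 1)) := by
    have e2 : A.Y a (0 + n - j - 1) (A.Y b (k + j) A.vac) = X (j + 1) := by
      simp only [hXdef]
      congr 2 <;> push_cast <;> ring_nf
    have e3 : A.Y a (0 + n - j) (A.Y b (k + j - 1) A.vac) = X j := by
      simp only [hXdef]
      congr 3
      ring_nf
    have e4 : (((j + 1 : ℕ) : ℤ) * ((-1) ^ (j + 1) * Ring.choose n (j + 1))) =
        -((n - j) * ((-1) ^ j * Ring.choose n j)) := by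
      have := succ_mul_choose_succ n j
      push_cast
      linear_combination (-1) ^ (j + 1) * this
    rw [A.T_Y, A.T_Y_vac, map_neg, map_zsmul, e2, e3, e4]
    module
  rw [prodModes, map_finsum _ (prodModes_hasFiniteSupport _ hb 0 n k A.vac)]
  simp only [map_zsmul, e1]
  have hs2 := hs' fun j => (((j + 1 : ℕ) : ℤ) * ((-1) ^ (j + 1) * Ring.choose n (j + 1)))
  have hs1 := hs fun j => j * ((-1) ^ j * Ring.choose n j)
  rw [finsum_sub_distrib, finsum_sub_distrib hs1 hs2, hshift, prodModes,
    ← neg_smul, smul_finsum' (-k) (hs _)]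
  · simp
  · exact (hs _).subset fun j hj h0 => hj ((congrArg _ h0).trans (smul_zero (-k)))
  · exact hs1.sub hs2

theorem mulZSubW_iterate_apply_neg_one {E : Type*} [AddCommGroup E] {h : ℤ → ℤ → E}
    (h0 : ∀ r l, 0 ≤ l → h r l = 0) (M : ℕ) (r : ℤ) :
    mulZSubW^[M] h r (-1) = h (r + M) (-1) := by
  have key : ∀ M : ℕ, ∀ r l : ℤ, 0 ≤ l → mulZSubW^[M] h r l = 0 := by
    intro M
    induction M with
    | zero => exact h0
    | succ M ih =>
      intro r l hl
      rw [iterate_succ_apply', mulZSubW, ih _ _ hl, ih _ _ (by omega), sub_zero]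
  induction M generalizing r with
  | zero => simp
  | succ M ih =>
    rw [iterate_succ_apply', mulZSubW, ih, key M _ _ (by norm_num), sub_zero]
    push_cast
    ring_nf

/-- In the coefficient with l = -1, every term of (z - w)^M other than z^M raises l to a nonnegative
value, where h vanishes. For a family evaluated on c_(l) Ω this gives the value on c = c_(-1) Ω,
which is the core of Goddard's uniqueness argument. -/
theorem eq_zero_of_mulZSubW_iterate {E : Type*} [AddCommGroup E] {h : ℤ → ℤ → E}
    (h0 : ∀ r l, 0 ≤ l → h r l = 0) {M : ℕ} (hM : mulZSubW^[M] h = 0) (r : ℤ) :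
    h r (-1) = 0 := by
  have := mulZSubW_iterate_apply_neg_one h0 M (r - M)
  rwa [hM, sub_add_cancel, eq_comm] at this

theorem prodModes_vac_eq_zero (a b : V) {m : ℤ} (hm : 0 ≤ m) (n k : ℤ) :
    prodModes (A.Y b) (A.Y a) k n m A.vac = 0 :=
  finsum_eq_zero_of_forall_eq_zero fun j => by
    rw [A.Y_vac_eq_zero a (by omega), map_zero, smul_zero]

/-- Both sides vanish for k ≥ 0 and agree at k = -1, where only b_(-1) Ω = b contributes. Below
that, T lowers k with the same nonzero factor on both sides. -/
theorem prodModes_vac (a b : V) (n k : ℤ) :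
    prodModes (A.Y a) (A.Y b) 0 n k A.vac = A.Y (A.Y a n b) k A.vac := by
  rcases le_or_gt 0 k with hk | hk
  · rw [A.prodModes_vac_eq_zero b a hk, A.Y_vac_eq_zero _ hk]
  · suffices h : ∀ i : ℕ, prodModes (A.Y a) (A.Y b) 0 n (-1 - i) A.vac =
        A.Y (A.Y a n b) (-1 - i) A.vac by
      have := h (-1 - k).toNat
      rwa [show -1 - ((-1 - k).toNat : ℤ) = k by omega] at this
    intro i
    induction i with
    | zero =>
      rw [prodModes, finsum_eq_single _ 0]
      · simp [A.creation]
      · intro j hj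
        rw [A.Y_vac_eq_zero b (by push_cast; omega), map_zero, smul_zero]
    | succ i ih =>
      have h1 := A.T_prodModes_vac a b n (-1 - i)
      rw [ih, A.T_Y_vac, neg_inj, ← Int.cast_smul_eq_zsmul ℂ, ← Int.cast_smul_eq_zsmul ℂ] at h1
      have h2 := smul_right_injective V
        (show (((-1 - i : ℤ)) : ℂ) ≠ 0 by exact_mod_cast (by omega : (-1 - i : ℤ) ≠ 0)) h1
      rw [show (-1 - ((i + 1 : ℕ) : ℤ)) = -1 - i - 1 by push_cast; ring]
      exact h2.symm

theorem paritySign_add (p q r : ZMod 2) :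
    paritySign (p + q) r = paritySign p r * paritySign q r := by
  have e : (1 : ZMod 2).val = 1 := rfl
  have e' : ((1 : ZMod 2) + 1).val = 0 := rfl
  rcases parity_cases p with rfl | rfl <;> rcases parity_cases q with rfl | rfl <;>
    rcases parity_cases r with rfl | rfl <;> simp [paritySign, e, e']

/-- The field of `a₍ₙ₎b` is the `n`-th product of the fields of `a` and `b`. -/
theorem residueModes_zero {p q : ZMod 2} {a b : V} (ha : a ∈ A.part p) (hb : b ∈ A.part q)
    (n k : ℤ) (c : V) :
    residueModes (paritySign p q) (A.Y a) (A.Y b) 0 n k c = A.Y (A.Y a n b) k c := by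
  set κ := paritySign p q
  set R := residueModes κ (A.Y a) (A.Y b) with hR
  have haf := A.isQuantumField a
  have hbf := A.isQuantumField b
  have hvac (k : ℤ) : R 0 n k A.vac = A.Y (A.Y a n b) k A.vac := by
    rw [hR, residueModes, A.prodModes_vac_eq_zero a b le_rfl, smul_zero, sub_zero,
      A.prodModes_vac]
  have hadd (k : ℤ) (x y : V) : R 0 n k (x + y) = R 0 n k x + R 0 n k y := by
    have key {f g : V} (hg : IsQuantumField (A.Y g)) (m k : ℤ) :
        prodModes (A.Y f) (A.Y g) m n k (x + y) =
          prodModes (A.Y f) (A.Y g) m n k x + prodModes (A.Y f) (A.Y g) m n k y := by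
      rw [prodModes, prodModes, prodModes, ← finsum_add_distrib
        (prodModes_hasFiniteSupport _ hg m n k x) (prodModes_hasFiniteSupport _ hg m n k y)]
      simp only [map_add, smul_add]
    simp only [hR, residueModes, key haf, key hbf]
    module
  refine A.parity_induction (P := fun c => R 0 n k c = A.Y (A.Y a n b) k c) (fun r c hc => ?_)
    (fun x y hx hy => ?_) c
  -- Goddard uniqueness: both fields are local with respect to Y(c) and agree on Ω, so a power of z
  -- - w kills their difference applied to Y(c) Ω.
  · obtain ⟨M, hM⟩ := residueModes_local haf hbf (A.isMutuallyLocal ha hc)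
      (A.isMutuallyLocal hb hc) (A.isMutuallyLocal ha hb) n A.vac
    obtain ⟨M', hM'⟩ := A.isMutuallyLocal (A.parity p q a ha b hb n) hc
    have hM2 : mulZSubW^[M + M'] (fun k l => R 0 n k (A.Y c l A.vac) -
        (paritySign p r * paritySign q r) • A.Y c l (R 0 n k A.vac)) = 0 := by
      funext k l
      have h := diffSndThd_pow_apply (M + M') (fun m k l => R m n k (A.Y c l A.vac) -
        (paritySign p r * paritySign q r) • A.Y c l (R m n k A.vac)) 0 k l
      rw [← h, add_comm, pow_add, Module.End.mul_apply, hM, map_zero]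
      rfl
    have hM3 := hM' (M + M') (by omega) A.vac
    rw [paritySign_add] at hM3
    have hM4 : mulZSubW^[M + M'] (fun k l => R 0 n k (A.Y c l A.vac) -
        A.Y (A.Y a n b) k (A.Y c l A.vac)) = 0 := by
      have e : (fun k l => R 0 n k (A.Y c l A.vac) - A.Y (A.Y a n b) k (A.Y c l A.vac)) =
          fun k l => (R 0 n k (A.Y c l A.vac) -
            (paritySign p r * paritySign q r) • A.Y c l (R 0 n k A.vac)) -
          (1 : ℂ) • (A.Y (A.Y a n b) k (A.Y c l A.vac) -
            (paritySign p r * paritySign q r) • A.Y c l (A.Y (A.Y a n b) k A.vac)) := by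
        funext k l
        rw [hvac]
        module
      funext k l
      rw [e, mulZSubW_iterate_sub_smul, hM2, hM3]
      simp
    have hz : ∀ k : ℤ, R 0 n k 0 = 0 := fun k => by
      have := hadd k 0 0
      simpa using this
    have := eq_zero_of_mulZSubW_iterate (h := fun k l => R 0 n k (A.Y c l A.vac) -
        A.Y (A.Y a n b) k (A.Y c l A.vac)) (fun k l hl => by
          rw [A.Y_vac_eq_zero c hl, hz, map_zero, sub_zero]) hM4 k
    rw [A.creation] at this
    exact sub_eq_zero.1 this
  · rw [hadd, hx, hy, map_add]

/-- The Borcherds identity. -/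
theorem borcherds {p q : ZMod 2} {a b : V} (ha : a ∈ A.part p) (hb : b ∈ A.part q)
    (m n k : ℤ) (c : V) :
    ∑ᶠ j : ℕ, Ring.choose m j • A.Y (A.Y a (n + j) b) (m + k - j) c =
      residueModes (paritySign p q) (A.Y a) (A.Y b) m n k c := by
  set R := residueModes (paritySign p q) (A.Y a) (A.Y b) with hR
  set Q : ℤ → ℤ → ℤ → V := fun m n k =>
    ∑ᶠ j : ℕ, Ring.choose m j • A.Y (A.Y a (n + j) b) (m + k - j) c with hQ
  have hfin (m n r : ℤ) :
      (fun j : ℕ => A.Y (A.Y a (n + j) b) (r - j) c).HasFiniteSupport :=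
    (A.isQuantumField a).hasFiniteSupport b n (fun j x => A.Y x (r - j) c) (by simp)
  have hQrec (m n k : ℤ) : Q (m + 1) n k = Q m (n + 1) k + Q m n (k + 1) := by
    have h := finsum_choose_succ m (hfin m n (m + 1 + k))
    simp only [hQ, h]
    rw [add_comm]
    congr 1
    · refine finsum_congr fun j => ?_
      congr 3
      · push_cast; ring_nf
    · refine finsum_congr fun j => ?_
      congr 3
      ring_nf
  have hRrec (m n k : ℤ) : R (m + 1) n k c = R m (n + 1) k c + R m n (k + 1) c :=
    residueModes_succ _ (A.isQuantumField a) (A.isQuantumField b) m n k c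
  obtain ⟨N0, hN0⟩ := (A.isMutuallyLocal ha hb).residueModes_eq_zero (A.isQuantumField a)
    (A.isQuantumField b)
  obtain ⟨N1, hN1⟩ := A.field a b
  have hQ0 (n k : ℤ) : Q 0 n k = A.Y (A.Y a n b) k c := by
    simp only [hQ]
    rw [finsum_eq_single _ 0]
    · simp
    · intro j hj
      rw [Ring.choose_zero_pos _ (Nat.pos_of_ne_zero hj), zero_smul]
  -- Downward induction on n. For large n, R vanishes by locality, and Q because a_(n+j) b = 0.
  suffices h : ∀ i : ℕ, ∀ n, max N0 N1 ≤ n + i → ∀ m k, Q m n k = R m n k c from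
    h (max N0 N1 - n).toNat n (by omega) m k
  intro i
  induction i with
  | zero =>
    intro n hn m k
    have hn0 : N0 ≤ n := by simp at hn; omega
    have hn1 : N1 ≤ n := by simp at hn; omega
    rw [hR, hN0 n hn0]
    refine finsum_eq_zero_of_forall_eq_zero fun j => ?_
    rw [hN1 _ (by omega), map_zero]
    simp
  | succ i ih =>
    intro n hn
    have ih1 := ih (n + 1) (by push_cast at hn; omega)
    -- Given the identity at n + 1, the common recursion makes Q - R depend only on m + k. At m = 0
    -- it vanishes by the n-th product formula.
    have hstep (m k : ℤ) : Q (m + 1) n k - R (m + 1) n k c = Q m n (k + 1) - R m n (k + 1) c := by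
      rw [hQrec, hRrec, ih1]
      abel
    have hzero (k : ℤ) : Q 0 n k - R 0 n k c = 0 := by
      rw [hQ0, hR, A.residueModes_zero ha hb, sub_self]
    intro m
    rw [forall_congr' fun k => sub_eq_zero.symm]
    induction m using Int.induction_on with
    | zero => exact hzero
    | succ m ihm => exact fun k => by rw [hstep, ihm]
    | pred m ihm =>
      intro k
      have := hstep (-m - 1) (k - 1)
      rw [sub_add_cancel, sub_add_cancel, ihm] at this
      exact this.symm

end VOSA

/-! ### Virasoro commutators, conformal weights and skew-symmetry -/

namespace VOSA

variable {V : Type*} [AddCommGroup V] [Module ℂ V] (A : VOSA V)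

theorem paritySign_zero_left (q : ZMod 2) : paritySign 0 q = 1 := by simp [paritySign]

theorem paritySign_zero_right (q : ZMod 2) : paritySign q 0 = 1 := by simp [paritySign]

theorem paritySign_one_one : paritySign 1 1 = -1 := by
  have e : (1 : ZMod 2).val = 1 := rfl
  simp [paritySign, e]

theorem paritySign_mul_self (p q : ZMod 2) : paritySign p q * paritySign p q = 1 := by
  simp only [paritySign, ← mul_pow]
  norm_num

theorem residueModes_eq_finsum (ε : ℂ) {a b : ℤ → Module.End ℂ V} (ha : IsQuantumField a)
    (hb : IsQuantumField b) (m n k : ℤ) (c : V) :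
    residueModes ε a b m n k c = ∑ᶠ j : ℕ, ((-1) ^ j * Ring.choose n j) •
      (a (m + n - j) (b (k + j) c) - (ε * (-1 : ℂ) ^ n) • b (n + k - j) (a (m + j) c)) := by
  have h1 := prodModes_hasFiniteSupport a hb m n k c
  have h2 := prodModes_hasFiniteSupport b ha k n m c
  rw [residueModes, prodModes, prodModes, smul_finsum,
    ← finsum_sub_distrib h1 (h2.subset fun j hj h0 => hj (by simp [h0]))]
  refine finsum_congr fun j => ?_
  rw [smul_sub, smul_comm (ε * (-1 : ℂ) ^ n), add_comm k n]

theorem commutator {p q : ZMod 2} {a b : V} (ha : a ∈ A.part p) (hb : b ∈ A.part q)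
    (m k : ℤ) (c : V) :
    A.Y a m (A.Y b k c) - paritySign p q • A.Y b k (A.Y a m c) =
      ∑ᶠ j : ℕ, Ring.choose m j • A.Y (A.Y a j b) (m + k - j) c := by
  have h := A.borcherds ha hb m 0 k c
  simp only [zero_add] at h
  rw [h, residueModes, prodModes_zero, prodModes_zero, zpow_zero, mul_one]

/-- The case n = 0 of the Borcherds identity. As ν is even no sign appears, so b may have mixed
parity. The values m = 0, 1, 2 give the commutators with T, L₀ and L₁. -/
theorem commutator_ν (b : V) (m : ℕ) (k : ℤ) (c : V) :
    A.Y A.ν m (A.Y b k c) = A.Y b k (A.Y A.ν m c) +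
      ∑ j ∈ Finset.range (m + 1), m.choose j • A.Y (A.Y A.ν j b) (m + k - j) c := by
  refine A.parity_induction (P := fun b => A.Y A.ν m (A.Y b k c) = A.Y b k (A.Y A.ν m c) +
      ∑ j ∈ Finset.range (m + 1), m.choose j • A.Y (A.Y A.ν j b) (m + k - j) c)
    (fun q b hb => ?_) (fun x y hx hy => ?_) b
  · have h := A.commutator A.ν_mem hb m k c
    rw [paritySign_zero_left, one_smul, sub_eq_iff_eq_add'] at h
    rw [h, finsum_eq_sum_of_support_subset _ (s := Finset.range (m + 1))]
    · simp only [Ring.choose_natCast, natCast_zsmul]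
    · intro j hj
      by_contra hn
      refine hj ?_
      simp only [Finset.coe_range, Set.mem_Iio, not_lt] at hn
      simp [Ring.choose_natCast, Nat.choose_eq_zero_of_lt hn]
  · simp only [map_add, Pi.add_apply, LinearMap.add_apply, hx, hy, smul_add,
      Finset.sum_add_distrib]
    abel

theorem Y_T (a : V) (n : ℤ) (c : V) : A.Y (A.T a) n c = -(n • A.Y a (n - 1) c) := by
  have h := A.commutator_ν a 0 n c
  simp only [zero_add, Finset.sum_range_one, Nat.choose_self, one_smul, Nat.cast_zero, sub_zero,
    A.L_neg_one] at h
  rw [A.T_Y] at h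
  rw [sub_eq_add_neg] at h
  exact (add_left_cancel h).symm

theorem L_zero_Y (b : V) (k : ℤ) (c : V) :
    A.L 0 (A.Y b k c) = A.Y b k (A.L 0 c) + A.Y (A.L 0 b) k c - (k + 1) • A.Y b k c := by
  have h := A.commutator_ν b 1 k c
  simp only [Finset.sum_range_succ, Finset.sum_range_zero, Nat.cast_one, Nat.cast_zero,
    Nat.choose_zero_right, Nat.choose_self, one_smul, A.L_neg_one, Y_T] at h
  simp only [L, zero_add]
  rw [h, show (1 : ℤ) + k - 1 = k by ring, show (1 : ℤ) + k - 0 - 1 = k by ring]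
  module

theorem L_one_Y (b : V) (k : ℤ) (c : V) :
    A.L 1 (A.Y b k c) = A.Y b k (A.L 1 c) + A.Y (A.L 1 b) k c +
      (2 : ℂ) • A.Y (A.L 0 b) (k + 1) c - (k + 2) • A.Y b (k + 1) c := by
  have h := A.commutator_ν b 2 k c
  simp only [Finset.sum_range_succ, Finset.sum_range_zero, Nat.cast_one, Nat.cast_zero,
    Nat.choose_zero_right, Nat.choose_self, one_smul, A.L_neg_one, Y_T, Nat.cast_ofNat,
    Nat.choose_one_right] at h
  simp only [L, zero_add, show (1 : ℤ) + 1 = 2 by norm_num]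
  rw [h, show (2 : ℤ) + k - 1 = k + 1 by ring, show (2 : ℤ) + k - 0 - 1 = k + 1 by ring,
    show (2 : ℤ) + k - 2 = k by ring]
  module

/-- The subspace of conformal weight `D / 2`. -/
noncomputable abbrev wt (D : ℤ) : Submodule ℂ V := A.weightSpace ((D : ℂ) / 2)

variable {A}

theorem mem_wt {D : ℤ} {a : V} : a ∈ A.wt D ↔ A.L 0 a = ((D : ℂ) / 2) • a :=
  Module.End.mem_eigenspace_iff

variable (A)

theorem L_neg_one_eq : A.L (-1) = A.T := A.L_neg_one

theorem L_comm (n m : ℤ) (x : V) :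
    A.L n (A.L m x) = A.L m (A.L n x) + (n - m) • A.L (n + m) x +
      (if n = -m then A.c * ((n : ℂ) ^ 3 - n) / 12 else 0) • x := by
  have h := LinearMap.congr_fun (A.virasoro n m) x
  simp only [LinearMap.sub_apply, Module.End.mul_apply, LinearMap.add_apply,
    LinearMap.smul_apply, Module.End.one_apply] at h
  rw [sub_eq_iff_eq_add'] at h
  simp only [L]
  rw [h, ← add_assoc]

theorem L_one_T (x : V) : A.L 1 (A.T x) = A.T (A.L 1 x) + (2 : ℂ) • A.L 0 x := by
  have h := A.L_comm 1 (-1) x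
  rw [L_neg_one_eq] at h
  rw [h]
  norm_num
  norm_cast

theorem L_zero_T (x : V) : A.L 0 (A.T x) = A.T (A.L 0 x) + A.T x := by
  have h := A.L_comm 0 (-1) x
  rw [L_neg_one_eq] at h
  rw [h]
  simp [L_neg_one_eq]

theorem L_zero_L_one (x : V) : A.L 0 (A.L 1 x) = A.L 1 (A.L 0 x) - A.L 1 x := by
  rw [A.L_comm 0 1 x]
  norm_num
  abel

theorem Y_mem_wt {D E : ℤ} {a b : V} (ha : a ∈ A.wt D) (hb : b ∈ A.wt E) (n : ℤ) :
    A.Y a n b ∈ A.wt (D + E - 2 * n - 2) := by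
  rw [mem_wt] at *
  rw [A.L_zero_Y, ha, hb]
  simp only [map_smul, Pi.smul_apply, LinearMap.smul_apply]
  push_cast
  rw [← Int.cast_smul_eq_zsmul ℂ]
  push_cast
  module

theorem T_mem_wt {D : ℤ} {a : V} (ha : a ∈ A.wt D) : A.T a ∈ A.wt (D + 2) := by
  rw [mem_wt] at *
  rw [A.L_zero_T, ha, map_smul]
  push_cast
  module

theorem L_one_mem_wt {D : ℤ} {a : V} (ha : a ∈ A.wt D) : A.L 1 a ∈ A.wt (D - 2) := by
  rw [mem_wt] at *
  rw [A.L_zero_L_one, ha, map_smul]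
  push_cast
  module

theorem vac_mem_wt : A.vac ∈ A.wt 0 := by
  rw [mem_wt, L, A.Y_vac_eq_zero _ (by norm_num)]
  simp

theorem L_one_vac : A.L 1 A.vac = 0 := A.Y_vac_eq_zero _ (by norm_num)

theorem L_neg_two_vac : A.L (-2) A.vac = A.ν := A.creation _

theorem ν_mem_wt : A.ν ∈ A.wt 4 := by
  rw [mem_wt, ← L_neg_two_vac, L_comm, mem_wt.1 A.vac_mem_wt]
  norm_num
  norm_cast

theorem L_one_ν : A.L 1 A.ν = 0 := by
  rw [← L_neg_two_vac, L_comm, L_one_vac]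
  norm_num [L_neg_one_eq, A.T_vac]

theorem iSup_wt : ⨆ D : ℤ, A.wt D = ⊤ := by
  rw [← top_le_iff, ← A.diagonalizable]
  refine iSup_le fun μ => ?_
  by_cases h : ∃ D : ℤ, μ = (D : ℂ) / 2
  · obtain ⟨D, rfl⟩ := h
    exact le_iSup A.wt D
  · push Not at h
    rw [A.weight_half_int μ h]
    exact bot_le

theorem wt_induction {P : V → Prop} (hom : ∀ D, ∀ a ∈ A.wt D, P a)
    (add : ∀ a b, P a → P b → P (a + b)) (a : V) : P a :=
  Submodule.iSup_induction (motive := P) A.wt (by rw [A.iSup_wt]; trivial : a ∈ ⨆ D, A.wt D) hom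
    (hom 0 0 (zero_mem _)) add

theorem wt_le_part (D : ℤ) : A.wt D ≤ A.part (D : ZMod 2) := by
  rcases Int.even_or_odd' D with ⟨n, rfl | rfl⟩
  · have : ((2 * n : ℤ) : ZMod 2) = 0 := by
      push_cast; rw [show (2 : ZMod 2) = 0 from rfl, zero_mul]
    rw [this, A.even_eq]
    refine le_trans (le_of_eq ?_) (le_iSup _ n)
    simp [wt, weightSpace, L]
  · have : ((2 * n + 1 : ℤ) : ZMod 2) = 1 := by
      push_cast; rw [show (2 : ZMod 2) = 0 from rfl, zero_mul, zero_add]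
    rw [this, A.odd_eq]
    refine le_trans (le_of_eq ?_) (le_iSup _ (n + 1))
    simp only [wt, weightSpace, L, zero_add]
    congr 1
    push_cast
    ring

theorem part_induction {p : ZMod 2} {P : V → Prop}
    (hom : ∀ D : ℤ, (D : ZMod 2) = p → ∀ a ∈ A.wt D, P a)
    (add : ∀ a b, P a → P b → P (a + b)) {a : V} (ha : a ∈ A.part p) : P a := by
  rcases parity_cases p with rfl | rfl
  · rw [A.even_eq] at ha
    have hom' (n : ℤ) (a : V) (h : a ∈ (A.Y A.ν 1).eigenspace (n : ℂ)) : P a :=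
      hom (2 * n) (by push_cast; rw [show (2 : ZMod 2) = 0 from rfl, zero_mul]) a
        (by simpa [wt, weightSpace, L] using h)
    exact Submodule.iSup_induction (motive := P) _ ha hom' (hom' 0 0 (zero_mem _)) add
  · rw [A.odd_eq] at ha
    have hom' (n : ℤ) (a : V) (h : a ∈ (A.Y A.ν 1).eigenspace ((n : ℂ) - 1 / 2)) : P a :=
      hom (2 * n - 1) (by push_cast; rw [show (2 : ZMod 2) = 0 from rfl, zero_mul]; rfl) a
        (by
          rw [wt, weightSpace, L, zero_add]
          convert h using 2
          push_cast
          ring)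
    exact Submodule.iSup_induction (motive := P) _ ha hom' (hom' 0 0 (zero_mem _)) add

theorem exists_wt_eq_bot : ∃ N : ℤ, ∀ D, D < N → A.wt D = ⊥ := by
  obtain ⟨N, -, hN⟩ := A.bounded_below
  refine ⟨2 * N, fun D hD => ?_⟩
  rw [wt, weightSpace, L, zero_add]
  refine hN D ?_
  rw [div_lt_iff₀ (by norm_num)]
  exact_mod_cast (by linarith : D < N * 2)

theorem L_one_pow_mem_wt {D : ℤ} {a : V} (ha : a ∈ A.wt D) (l : ℕ) :
    (A.L 1 ^ l) a ∈ A.wt (D - 2 * l) := by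
  induction l with
  | zero => simpa using ha
  | succ l ih =>
    rw [pow_succ', Module.End.mul_apply]
    convert A.L_one_mem_wt ih using 2
    push_cast
    ring

/-- L₁ lowers the weight, and the weights are bounded below. -/
theorem exists_L_one_pow_eq_zero (a : V) : ∃ s : ℕ, ∀ l, s ≤ l → (A.L 1 ^ l) a = 0 := by
  refine A.wt_induction (P := fun a => ∃ s : ℕ, ∀ l, s ≤ l → (A.L 1 ^ l) a = 0)
    (fun D a ha => ?_) (fun a b h1 h2 => ?_) a
  · obtain ⟨N, hN⟩ := A.exists_wt_eq_bot
    refine ⟨(D - N).toNat + 1, fun l hl => ?_⟩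
    have h := A.L_one_pow_mem_wt ha l
    rw [hN _ (by omega)] at h
    exact h
  · obtain ⟨s, hs⟩ := h1
    obtain ⟨t, ht⟩ := h2
    exact ⟨max s t, fun l hl => by
      rw [map_add, hs l (le_trans (le_max_left _ _) hl), ht l (le_trans (le_max_right _ _) hl),
        add_zero]⟩

/-- Skew-symmetry, in terms of the vectors `x₍₋₁₋ⱼ₎Ω = T^j x / j!`. -/
theorem skew_symmetry {p q : ZMod 2} {a b : V} (ha : a ∈ A.part p) (hb : b ∈ A.part q) (n : ℤ) :
    (paritySign p q * (-1 : ℂ) ^ n) • A.Y b n a =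
      -∑ᶠ j : ℕ, Ring.choose (-1 : ℤ) j • A.Y (A.Y a (n + j) b) (-1 - j) A.vac := by
  -- With k = 0 the modes b_(j) Ω vanish, and with m = -1 the reversed product is (b_(n) a)_(-1) Ω =
  -- b_(n) a.
  have h := A.borcherds ha hb (-1) n 0 A.vac
  rw [residueModes, A.prodModes_vac_eq_zero b a le_rfl, A.prodModes_vac, A.creation, zero_sub] at h
  simp only [add_zero] at h
  rw [h, neg_neg]

/-- In `skew_symmetry` the term j = 0 is a_(n) b and all later ones lie in the range of T. Working
modulo T is enough whenever the result is paired with a quasi-primary vector. -/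
theorem exists_skew {p q : ZMod 2} {a b : V} (ha : a ∈ A.part p) (hb : b ∈ A.part q) (n : ℤ) :
    ∃ y, A.Y b n a = (-(paritySign p q * (-1 : ℂ) ^ n)) • A.Y a n b + A.T y := by
  have h := A.skew_symmetry ha hb n
  have hfin : (fun j : ℕ => Ring.choose (-1 : ℤ) j •
      A.Y (A.Y a (n + j) b) (-1 - j) A.vac).HasFiniteSupport :=
    (A.isQuantumField a).hasFiniteSupport b n
      (fun j x => Ring.choose (-1 : ℤ) j • A.Y x (-1 - j) A.vac) (by simp)
  have hT : ∀ s : ℕ → V, (∀ j, s j ∈ LinearMap.range A.T) → s.HasFiniteSupport →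
      ∑ᶠ j, s j ∈ LinearMap.range A.T := fun s hs _ =>
    finsum_induction (fun x => x ∈ LinearMap.range A.T) (zero_mem _) (fun _ _ => add_mem) hs
  rw [finsum_nat_eq_add hfin] at h
  obtain ⟨y, hy⟩ := hT (fun j : ℕ => Ring.choose (-1 : ℤ) (j + 1) •
      A.Y (A.Y a (n + (j + 1 : ℕ)) b) (-1 - (j + 1 : ℕ)) A.vac) (fun j => by
        have h1 := A.T_Y_vac (A.Y a (n + (j + 1 : ℕ)) b) (-1 - j)
        refine Submodule.smul_of_tower_mem _ _ ⟨((j : ℂ) + 1)⁻¹ • A.Y (A.Y a (n + (j + 1 : ℕ)) b)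
          (-1 - j) A.vac, ?_⟩
        rw [map_smul, h1, ← neg_smul, ← Int.cast_smul_eq_zsmul ℂ, smul_smul]
        have e : ((j : ℂ) + 1)⁻¹ * ((-(-1 - (j : ℤ)) : ℤ) : ℂ) = 1 := by
          push_cast
          rw [neg_sub, sub_neg_eq_add]
          exact inv_mul_cancel₀ (Nat.cast_add_one_ne_zero j)
        rw [e, one_smul]
        congr 2
        push_cast
        ring_nf)
      (Set.Finite.preimage (f := fun j : ℕ => j + 1) (add_left_injective 1).injOn hfin)
  have hy' : ∑ᶠ j : ℕ, Ring.choose (-1 : ℤ) (j + 1) •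
      A.Y (A.Y a (n + (j + 1 : ℕ)) b) (-1 - (j + 1 : ℕ)) A.vac = A.T y := hy.symm
  rw [hy'] at h
  simp only [Ring.choose_zero_right, one_smul, Nat.cast_zero, add_zero, sub_zero, A.creation] at h
  have hs : (paritySign p q * (-1 : ℂ) ^ n) * (paritySign p q * (-1 : ℂ) ^ n) = 1 := by
    rw [mul_mul_mul_comm, paritySign_mul_self, ← mul_zpow]
    norm_num
  refine ⟨(-(paritySign p q * (-1 : ℂ) ^ n)) • y, ?_⟩
  have h2 := congrArg ((paritySign p q * (-1 : ℂ) ^ n) • ·) h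
  simp only [smul_smul, hs, one_smul] at h2
  rw [h2, map_smul]
  module

end VOSA

/-! ### Generated ideals, simplicity of the even part, irreducibility of the odd part -/

namespace VOSA

variable {V : Type*} [AddCommGroup V] [Module ℂ V] (A : VOSA V)

/-- The span of all `a₍ₙ₎ s` with `s` in a given subspace. -/
def actionSpan (S : Submodule ℂ V) : Submodule ℂ V :=
  Submodule.span ℂ {y | ∃ (a : V) (n : ℤ), ∃ s ∈ S, y = A.Y a n s}

theorem Y_mem_actionSpan {S : Submodule ℂ V} (a : V) (n : ℤ) {s : V} (hs : s ∈ S) :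
    A.Y a n s ∈ A.actionSpan S := Submodule.subset_span ⟨a, n, s, hs, rfl⟩

theorem finsum_zsmul_mem {J : Submodule ℂ V} {f : ℕ → V} (c : ℕ → ℤ) (h : ∀ j, f j ∈ J) :
    ∑ᶠ j, c j • f j ∈ J :=
  finsum_induction (fun x => x ∈ J) (zero_mem _) (fun _ _ => add_mem)
    fun j => zsmul_mem (h j) _

theorem Y_Y_mem_actionSpan {S : Submodule ℂ V} (x : V) (m : ℤ) (a : V) (k : ℤ) {c : V}
    (hc : c ∈ S) : A.Y x m (A.Y a k c) ∈ A.actionSpan S := by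
  refine A.parity_induction (P := fun x => A.Y x m (A.Y a k c) ∈ A.actionSpan S)
    (fun p x hx => ?_) (fun x y h1 h2 => by simpa using add_mem h1 h2) x
  refine A.parity_induction (P := fun a => A.Y x m (A.Y a k c) ∈ A.actionSpan S)
    (fun q a ha => ?_) (fun x y h1 h2 => by simpa using add_mem h1 h2) a
  obtain ⟨N, hN⟩ := A.field a c
  obtain ⟨M, hM⟩ := A.field x c
  suffices h : ∀ i : ℕ, ∀ k : ℤ, (N : ℤ) ≤ k + i → ∀ m, A.Y x m (A.Y a k c) ∈ A.actionSpan S from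
    h (N - k).toNat k (by omega) m
  intro i
  induction i with
  | zero =>
    intro k hk m
    rw [hN k (by simpa using hk), map_zero]
    exact zero_mem _
  | succ i ih =>
    intro k hk m
    -- By the choice of M the reversed product vanishes. In the other one the term j = 0 is the
    -- wanted vector, and the rest involve a_(k+j) c with j > 0, where the induction applies.
    have h := A.borcherds hx ha M (m - M) k c
    have h0 : prodModes (A.Y a) (A.Y x) k (m - M) M c = 0 :=
      finsum_eq_zero_of_forall_eq_zero fun j => by rw [hM _ (by omega), map_zero, smul_zero]
    rw [residueModes, h0, smul_zero, sub_zero, prodModes,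
      finsum_nat_eq_add (prodModes_hasFiniteSupport _ (A.isQuantumField a) _ _ _ _)] at h
    simp only [pow_zero, Ring.choose_zero_right, mul_one, one_smul, Nat.cast_zero, sub_zero,
      add_zero, add_sub_cancel] at h
    rw [← sub_eq_iff_eq_add] at h
    rw [← h]
    refine sub_mem (finsum_zsmul_mem _ fun j => A.Y_mem_actionSpan _ _ hc)
      (finsum_zsmul_mem _ fun j => ih _ (by push_cast at hk ⊢; omega) _)

theorem actionSpan_isIdeal (S : Submodule ℂ V) : A.IsIdeal (A.actionSpan S) := by
  have h : ∀ (a : V) (n : ℤ), ∀ b ∈ A.actionSpan S, A.Y a n b ∈ A.actionSpan S := by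
    intro a n b hb
    induction hb using Submodule.span_induction with
    | mem x hx =>
      obtain ⟨c, k, s, hs, rfl⟩ := hx
      exact A.Y_Y_mem_actionSpan a n c k hs
    | zero => simp
    | add x y _ _ h1 h2 => simpa using add_mem h1 h2
    | smul r x _ h1 => simpa using Submodule.smul_mem _ r h1
  exact ⟨fun b hb => by rw [← A.L_neg_one]; exact h _ _ b hb, h⟩

theorem vac_Y_neg_one (x : V) : A.Y A.vac (-1) x = x := by simp [A.vac_field]

theorem le_actionSpan (S : Submodule ℂ V) : S ≤ A.actionSpan S := fun s hs => by
  rw [← A.vac_Y_neg_one s]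
  exact A.Y_mem_actionSpan _ _ hs

theorem exists_parity_add' (p : ZMod 2) (a : V) :
    ∃ b ∈ A.part p, ∃ c ∈ A.part (1 + p), a = b + c := by
  obtain ⟨b, hb, c, hc, h⟩ := A.exists_parity_add a
  rcases parity_cases p with rfl | rfl
  · exact ⟨b, hb, c, hc, h⟩
  · exact ⟨c, hc, b, hb, h.trans (add_comm _ _)⟩

theorem part_inf_part {p : ZMod 2} {x : V} (h0 : x ∈ A.part p) (h1 : x ∈ A.part (1 + p)) :
    x = 0 := by
  rcases parity_cases p with rfl | rfl
  · exact A.part_zero_inf_one h0 h1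
  · exact A.part_zero_inf_one h1 h0

/-- In a simple VOSA the even and odd parts are irreducible under the even part. -/
theorem IsSimple.eq_bot_or_eq_part {A : VOSA V} (hA : A.IsSimple) {p : ZMod 2}
    {S : Submodule ℂ V} (hS : S ≤ A.part p)
    (hinv : ∀ a ∈ A.part 0, ∀ (n : ℤ), ∀ s ∈ S, A.Y a n s ∈ S) : S = ⊥ ∨ S = A.part p := by
  rcases hA _ (A.actionSpan_isIdeal S) with h | h
  · exact Or.inl (le_bot_iff.1 (h ▸ A.le_actionSpan S))
  · refine Or.inr (le_antisymm hS fun x hx => ?_)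
    -- Even modes keep S stable and odd modes change the parity, so the parity p component of the
    -- ideal does not exceed S.
    have key : ∀ y ∈ A.actionSpan S, ∃ s ∈ S, ∃ t ∈ A.part (1 + p), y = s + t := by
      intro y hy
      induction hy using Submodule.span_induction with
      | mem y hy =>
        obtain ⟨a, n, s, hs, rfl⟩ := hy
        obtain ⟨b, hb, c, hc, rfl⟩ := A.exists_parity_add a
        exact ⟨_, hinv b hb n s hs, _, A.parity 1 p c hc s (hS hs) n, by simp⟩
      | zero => exact ⟨0, zero_mem _, 0, zero_mem _, by simp⟩
      | add y z _ _ h1 h2 =>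
        obtain ⟨s, hs, t, ht, rfl⟩ := h1
        obtain ⟨s', hs', t', ht', rfl⟩ := h2
        exact ⟨_, add_mem hs hs', _, add_mem ht ht', by abel⟩
      | smul r y _ h1 =>
        obtain ⟨s, hs, t, ht, rfl⟩ := h1
        exact ⟨_, Submodule.smul_mem _ r hs, _, Submodule.smul_mem _ r ht, smul_add _ _ _⟩
    obtain ⟨s, hs, t, ht, rfl⟩ := key x (h ▸ Submodule.mem_top)
    have : t = 0 := A.part_inf_part (p := p)
      (by simpa using sub_mem hx (hS hs)) ht
    rwa [this, add_zero]

theorem evenPart_Y_coe (a : A.part 0) (n : ℤ) (b : A.part 0) :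
    ((A.evenPart.Y a n b : A.part 0) : V) = A.Y a n b := rfl

theorem evenPart_L_coe (n : ℤ) (b : A.part 0) : ((A.evenPart.L n b : A.part 0) : V) = A.L n b := rfl

theorem evenPart_L_pow_coe (n : ℤ) (l : ℕ) (b : A.part 0) :
    (((A.evenPart.L n ^ l) b : A.part 0) : V) = (A.L n ^ l) b := by
  induction l with
  | zero => rfl
  | succ l ih => simp only [pow_succ', Module.End.mul_apply, evenPart_L_coe, ih]

theorem oddPart_Y_coe (a : A.part 0) (n : ℤ) (b : A.part 1) :
    ((A.oddPart.Y a n b : A.part 1) : V) = A.Y a n b := rfl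

theorem mem_evenPart_wt {D : ℤ} {a : A.part 0} : a ∈ A.evenPart.wt D ↔ (a : V) ∈ A.wt D := by
  rw [mem_wt, mem_wt, Subtype.ext_iff, evenPart_L_coe]
  rfl

theorem evenPart_isVOA : A.evenPart.IsVOA := A.evenPre_part_one

theorem IsSimple.evenPart {A : VOSA V} (hA : A.IsSimple) : A.evenPart.IsSimple := by
  intro I hI
  have h := hA.eq_bot_or_eq_part (p := 0) (S := I.map (A.part 0).subtype)
    (Submodule.map_subtype_le _ _) (by
      rintro a ha n _ ⟨s, hs, rfl⟩
      exact ⟨_, hI.2 ⟨a, ha⟩ n s hs, rfl⟩)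
  have hinj := Submodule.map_injective_of_injective (Submodule.subtype_injective (A.part 0))
  refine h.imp (fun h => hinj (by rw [h, Submodule.map_bot])) fun h => hinj ?_
  simp only [h, Submodule.map_subtype_top]

theorem oddPart_eigenspace_map (μ : ℂ) :
    ((A.oddPart.Y A.evenPart.ν 1).eigenspace μ).map (A.part 1).subtype =
      A.part 1 ⊓ (A.Y A.ν 1).eigenspace μ := by
  ext x
  simp only [Submodule.mem_map, Module.End.mem_eigenspace_iff, Submodule.mem_inf,
    Submodule.subtype_apply, Subtype.exists, Subtype.ext_iff, oddPart_Y_coe]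
  constructor
  · rintro ⟨a, ha, h, rfl⟩
    exact ⟨ha, h⟩
  · rintro ⟨ha, h⟩
    exact ⟨x, ha, h, rfl⟩

theorem oddPart_eigenspace_iSup : ⨆ μ : ℂ, (A.oddPart.Y A.evenPart.ν 1).eigenspace μ = ⊤ := by
  apply Submodule.map_injective_of_injective (Submodule.subtype_injective (A.part 1))
  rw [Submodule.map_iSup, Submodule.map_subtype_top]
  simp only [oddPart_eigenspace_map]
  refine le_antisymm (iSup_le fun _ => inf_le_left) ?_
  conv_lhs => rw [A.odd_eq]
  refine iSup_le fun n => le_trans (le_inf ?_ le_rfl)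
    (le_iSup (fun μ => A.part 1 ⊓ (A.Y A.ν 1).eigenspace μ) ((n : ℂ) - 1 / 2))
  rw [A.odd_eq]
  exact le_iSup (fun n : ℤ => (A.Y A.ν 1).eigenspace ((n : ℂ) - 1 / 2)) n

theorem oddPart_eigenspace_eq_bot {μ : ℂ} (h : (A.Y A.ν 1).eigenspace μ = ⊥) :
    (A.oddPart.Y A.evenPart.ν 1).eigenspace μ = ⊥ := by
  apply Submodule.map_injective_of_injective (Submodule.subtype_injective (A.part 1))
  rw [oddPart_eigenspace_map, h, inf_bot_eq, Submodule.map_bot]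

theorem oddPart_part_zero : A.oddPart.part 0 = ⊥ :=
  (Submodule.eq_bot_iff _).2 fun x hx => Subtype.ext (A.part_zero_inf_one hx x.2)

theorem oddPart_part_one : A.oddPart.part 1 = ⊤ :=
  Submodule.eq_top_iff'.2 fun x => x.2

theorem oddPart_borcherds (a b : A.part 0) (c : A.part 1) (m n k : ℤ) :
    ∑ᶠ j : ℕ, Ring.choose m j • A.oddPart.Y (A.evenPart.Y a (n + j) b) (m + k - j) c =
      ∑ᶠ j : ℕ, ((-1) ^ j * Ring.choose n j) •
        (A.oddPart.Y a (m + n - j) (A.oddPart.Y b (k + j) c) -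
          (paritySign 0 0 * (-1 : ℂ) ^ n) •
            A.oddPart.Y b (n + k - j) (A.oddPart.Y a (m + j) c)) := by
  have h := A.borcherds a.2 b.2 m n k c
  rw [residueModes_eq_finsum _ (A.isQuantumField _) (A.isQuantumField _)] at h
  have hinj : Function.Injective (A.part 1).subtype.toAddMonoidHom := Subtype.val_injective
  refine hinj ?_
  rw [AddMonoidHom.map_finsum_of_injective _ hinj, AddMonoidHom.map_finsum_of_injective _ hinj]
  simpa [oddPart_Y_coe, evenPart_Y_coe] using h

theorem oddPart_isModule : A.oddPart.IsModule where
  isCompl := by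
    rw [oddPart_part_zero, oddPart_part_one]
    exact isCompl_bot_top
  parity p q a ha b hb n := by
    rcases parity_cases p with rfl | rfl
    · exact A.parity 0 q a a.2 b hb n
    · rw [A.evenPre_eq_zero ha, map_zero]
      exact zero_mem _
  field a b := by
    obtain ⟨N, hN⟩ := A.field a b
    exact ⟨N, fun n hn => Subtype.ext (hN n hn)⟩
  translation a n := by
    refine LinearMap.ext fun x => Subtype.ext ?_
    rw [oddPart_Y_coe, evenPart_L_coe, L_neg_one_eq, Y_T, neg_smul]
    rfl
  vac_field n := by
    refine LinearMap.ext fun x => Subtype.ext ?_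
    have := LinearMap.congr_fun (A.vac_field n) (x : V)
    refine Eq.trans this ?_
    split_ifs <;> rfl
  borcherds p q a ha b hb c m n k := by
    rcases parity_cases p with rfl | rfl
    · rcases parity_cases q with rfl | rfl
      · exact A.oddPart_borcherds a b c m n k
      · simp [A.evenPre_eq_zero hb]
    · simp [A.evenPre_eq_zero ha]
  diagonalizable := A.oddPart_eigenspace_iSup
  part_graded p := by
    rcases parity_cases p with rfl | rfl
    · simp [oddPart_part_zero]
    · simp only [oddPart_part_one, top_inf_eq, A.oddPart_eigenspace_iSup]
  finite_dim μ := by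
    have h1 : FiniteDimensional ℂ ((A.Y A.ν 1).eigenspace μ) := by
      by_cases h : ∃ D : ℤ, μ = (D : ℂ) / 2
      · obtain ⟨D, rfl⟩ := h
        exact A.finite_dim D
      · push Not at h
        rw [A.weight_half_int μ h]
        infer_instance
    have h2 : FiniteDimensional ℂ
        (((A.oddPart.Y A.evenPart.ν 1).eigenspace μ).map (A.part 1).subtype) := by
      rw [oddPart_eigenspace_map]
      exact Submodule.finiteDimensional_of_le inf_le_right
    exact LinearEquiv.finiteDimensional (Submodule.equivMapOfInjective _
      (Submodule.subtype_injective (A.part 1)) _).symm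
  countable := by
    refine (Set.countable_range fun D : ℤ => (D : ℂ) / 2).mono fun μ hμ => ?_
    by_contra h
    exact hμ (A.oddPart_eigenspace_eq_bot (A.weight_half_int μ fun D hD => h ⟨D, hD.symm⟩))

theorem IsSimple.oddPart {A : VOSA V} (hA : A.IsSimple) : A.oddPart.IsIrreducibleModule := by
  refine ⟨A.oddPart_isModule, fun S hS => ?_⟩
  have h := hA.eq_bot_or_eq_part (p := 1) (S := S.map (A.part 1).subtype)
    (Submodule.map_subtype_le _ _) (by
      rintro a ha n _ ⟨s, hs, rfl⟩
      exact ⟨_, hS ⟨a, ha⟩ n s hs, rfl⟩)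
  have hinj := Submodule.map_injective_of_injective (Submodule.subtype_injective (A.part 1))
  refine h.imp (fun h => hinj (by rw [h, Submodule.map_bot])) fun h => hinj ?_
  simp only [h, Submodule.map_subtype_top]

/-! ### Restriction of a unitary structure to the two parts -/

variable {A}

theorem UnitaryStructure.θ_L (U : A.UnitaryStructure) (n : ℤ) (x : V) :
    U.θ (A.L n x) = A.L n (U.θ x) := by
  rw [L, U.θ_Y, U.θ_ν]

/-- θ fixes ν, hence commutes with L₀, and the eigenvalue D/2 is real, so antilinearity does no
harm. -/
theorem UnitaryStructure.θ_mem_wt (U : A.UnitaryStructure) {D : ℤ} {x : V} (hx : x ∈ A.wt D) :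
    U.θ x ∈ A.wt D := by
  rw [mem_wt] at *
  rw [← U.θ_L, hx, map_smulₛₗ, map_div₀, map_intCast, Complex.conj_ofNat]

theorem UnitaryStructure.θ_mem_part (U : A.UnitaryStructure) {p : ZMod 2} {x : V}
    (hx : x ∈ A.part p) : U.θ x ∈ A.part p :=
  A.part_induction (P := fun x => U.θ x ∈ A.part p)
    (fun D hD a ha => by rw [← hD]; exact A.wt_le_part _ (U.θ_mem_wt ha))
    (fun a b ha hb => by rw [map_add]; exact add_mem ha hb) hx

/-- The restriction of a sesquilinear form to a subspace. -/
def restrictForm (B : V →ₗ⋆[ℂ] V →ₗ[ℂ] ℂ) (S : Submodule ℂ V) : S →ₗ⋆[ℂ] S →ₗ[ℂ] ℂ :=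
  LinearMap.mk₂'ₛₗ (starRingEnd ℂ) (RingHom.id ℂ) (fun x y => B x y) (by simp) (by simp) (by simp)
    (by simp)

@[simp] theorem restrictForm_apply (B : V →ₗ⋆[ℂ] V →ₗ[ℂ] ℂ) (S : Submodule ℂ V) (x y : S) :
    restrictForm B S x y = B x y := rfl

theorem _root_.IsScalarProduct.restrictForm {B : V →ₗ⋆[ℂ] V →ₗ[ℂ] ℂ} (hB : IsScalarProduct B)
    (S : Submodule ℂ V) : IsScalarProduct (restrictForm B S) where
  hermitian b c := hB.hermitian b c
  pos b hb := hB.pos b fun h => hb (Subtype.ext h)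

/-- The restriction of a unitary structure to the even part. -/
def UnitaryStructure.evenPart (U : A.UnitaryStructure) : A.evenPart.UnitaryStructure where
  θ :=
    { toFun := fun x => ⟨U.θ x, U.θ_mem_part x.2⟩
      map_add' := fun x y => by ext; simp
      map_smul' := fun r x => by ext; simp [map_smulₛₗ] }
  form := restrictForm U.form (A.part 0)
  θ_Y a b n := Subtype.ext (U.θ_Y a b n)
  θ_vac := Subtype.ext U.θ_vac
  θ_ν := Subtype.ext U.θ_ν
  θ_invol a := Subtype.ext (U.θ_invol a)
  scalarProduct := U.scalarProduct.restrictForm _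
  normalized := U.normalized
  invariant D a ha n b c := by
    refine (U.invariant D a (A.mem_evenPart_wt.1 ha) n b c).trans ?_
    simp only [adjointCoeff, restrictForm_apply, evenPart_Y_coe, evenPart_L_pow_coe]

theorem UnitaryStructure.oddPart (U : A.UnitaryStructure) :
    A.oddPart.IsUnitaryModule U.evenPart := by
  refine ⟨A.oddPart_isModule, restrictForm U.form (A.part 1), U.scalarProduct.restrictForm _,
    fun D a ha n b c => ?_⟩
  refine (U.invariant D a (A.mem_evenPart_wt.1 ha) n b c).trans ?_
  simp only [adjointCoeff, restrictForm_apply, oddPart_Y_coe, evenPart_L_pow_coe]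

end VOSA

/-- A linear functional is represented on every finite-dimensional subspace by a vector of it. -/
theorem IsScalarProduct.exists_mem_eq {V : Type*} [AddCommGroup V] [Module ℂ V]
    {B : V →ₗ⋆[ℂ] V →ₗ[ℂ] ℂ} (hB : IsScalarProduct B) (K : Submodule ℂ V)
    [FiniteDimensional ℂ K] (φ : V →ₗ[ℂ] ℂ) : ∃ k ∈ K, ∀ c ∈ K, B k c = φ c := by
  have hnn (x : V) : 0 ≤ (B x x).re := by
    by_cases h : x = 0
    · simp [h]
    · exact (hB.pos x h).le
  let core : InnerProductSpace.Core ℂ K :=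
    { inner := fun x y => B x y
      conj_inner_symm := fun x y => (hB.hermitian x y).symm
      re_inner_nonneg := fun x => hnn x
      add_left := fun x y z => by simp
      smul_left := fun x y r => by simp
      definite := fun x hx => by
        by_contra h
        have := hB.pos x fun h' => h (Subtype.ext h')
        have hx' : B x x = 0 := hx
        rw [hx'] at this
        simp at this }
  let _ : NormedAddCommGroup K := @InnerProductSpace.Core.toNormedAddCommGroup ℂ K _ _ _ core
  let _ : InnerProductSpace ℂ K := InnerProductSpace.ofCore core.toCore
  have : CompleteSpace K := FiniteDimensional.complete ℂ K
  refine ⟨((InnerProductSpace.toDual ℂ K).symm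
    (LinearMap.toContinuousLinearMap (φ ∘ₗ K.subtype)) : K), Submodule.coe_mem _, fun c hc => ?_⟩
  exact InnerProductSpace.toDual_symm_apply (x := (⟨c, hc⟩ : K))
    (y := LinearMap.toContinuousLinearMap (φ ∘ₗ K.subtype))

theorem IsScalarProduct.eq_zero {V : Type*} [AddCommGroup V] [Module ℂ V]
    {B : V →ₗ⋆[ℂ] V →ₗ[ℂ] ℂ} (hB : IsScalarProduct B) {x : V} (h : B x x = 0) : x = 0 := by
  by_contra hx
  have := hB.pos x hx
  rw [h] at this
  simp at this

/-! ### Weight signs, the action of T and L₁, and quasi-primary vectors -/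

namespace VOSA

variable {V : Type*} [AddCommGroup V] [Module ℂ V]

/-- The sign `(-1)^(2d² + d)` for the conformal weight `d = D / 2`. -/
noncomputable def wtSign (D : ℤ) : ℂ := (-1 : ℂ) ^ (D * (D + 1) / 2)

theorem wtSign_mul_self (D : ℤ) : wtSign D * wtSign D = 1 := by
  rw [wtSign, ← mul_zpow]
  norm_num

theorem wtSign_two_mul (d : ℤ) : wtSign (2 * d) = (-1) ^ d := by
  rw [wtSign, show 2 * d * (2 * d + 1) / 2 = 2 * (d * d) + d by
    rw [mul_assoc, Int.mul_ediv_cancel_left _ two_ne_zero]; ring, zpow_add₀ (by norm_num), zpow_mul]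
  norm_num

theorem wtSign_two_mul_add_one (d : ℤ) : wtSign (2 * d + 1) = (-1) ^ (d + 1) := by
  rw [wtSign, show (2 * d + 1) * (2 * d + 1 + 1) / 2 = 2 * (d * (d + 1)) + (d + 1) by
    rw [show (2 * d + 1) * (2 * d + 1 + 1) = 2 * ((2 * d + 1) * (d + 1)) by ring,
      Int.mul_ediv_cancel_left _ two_ne_zero]; ring, zpow_add₀ (by norm_num), zpow_mul]
  norm_num

theorem star_wtSign (D : ℤ) : starRingEnd ℂ (wtSign D) = wtSign D := by
  rw [wtSign, map_zpow₀, map_neg, map_one]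

theorem wtSign_add_two (D : ℤ) : wtSign (D + 2) = -wtSign D := by
  rw [wtSign, wtSign, show (D + 2) * (D + 2 + 1) / 2 = D * (D + 1) / 2 + (2 * (D + 1) + 1) by
    rw [show (D + 2) * (D + 2 + 1) = D * (D + 1) + 2 * (2 * (D + 1) + 1) by ring,
      Int.add_mul_ediv_left _ _ two_ne_zero], zpow_add₀ (by norm_num),
    zpow_add₀ (by norm_num), zpow_mul]
  norm_num

theorem exists_eq_of_parity_zero {D : ℤ} (h : (D : ZMod 2) = 0) : ∃ d, D = 2 * d := by
  rw [ZMod.intCast_zmod_eq_zero_iff_dvd] at h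
  exact_mod_cast h

theorem exists_eq_of_parity_one {D : ℤ} (h : (D : ZMod 2) = 1) : ∃ d, D = 2 * d + 1 := by
  rcases Int.even_or_odd' D with ⟨d, rfl | rfl⟩
  · exfalso
    push_cast at h
    rw [show (2 : ZMod 2) = 0 from rfl, zero_mul] at h
    exact zero_ne_one h
  · exact ⟨d, rfl⟩

theorem L_one_Y_of_wt (A : VOSA V) {D : ℤ} {a : V} (ha : a ∈ A.wt D) (h1 : A.L 1 a = 0) (k : ℤ)
    (c : V) :
    A.L 1 (A.Y a k c) = A.Y a k (A.L 1 c) + ((D - k - 2 : ℤ) : ℂ) • A.Y a (k + 1) c := by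
  rw [A.L_one_Y, h1, mem_wt.1 ha, ← Int.cast_smul_eq_zsmul ℂ]
  simp only [map_zero, map_smul, Pi.zero_apply, LinearMap.zero_apply, Pi.smul_apply,
    LinearMap.smul_apply]
  push_cast
  module

theorem Y_T_right (A : VOSA V) (a : V) (n : ℤ) (v : V) :
    A.Y a n (A.T v) = A.T (A.Y a n v) + (n : ℂ) • A.Y a (n - 1) v := by
  rw [A.T_Y, Int.cast_smul_eq_zsmul]
  abel

theorem Y_T' (A : VOSA V) (a : V) (n : ℤ) (c : V) :
    A.Y (A.T a) n c = (-n : ℂ) • A.Y a (n - 1) c := by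
  rw [Y_T, neg_smul, Int.cast_smul_eq_zsmul]

/-- Iterates the sl₂ relation [L₁, T] = 2 L₀. The factor (l+1)(D-l) is what makes the adjoint
formula compatible with derivatives. -/
theorem L_one_pow_succ_T (A : VOSA V) {D : ℤ} {a : V} (ha : a ∈ A.wt D) (l : ℕ) :
    (A.L 1 ^ (l + 1)) (A.T a) = A.T ((A.L 1 ^ (l + 1)) a) +
      (((l + 1) * (D - l) : ℤ) : ℂ) • (A.L 1 ^ l) a := by
  induction l with
  | zero =>
    simp only [zero_add, pow_one, pow_zero, Module.End.one_apply, L_one_T, mem_wt.1 ha]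
    push_cast
    module
  | succ l ih =>
    rw [pow_succ', Module.End.mul_apply, ih, map_add, L_one_T, map_smul,
      mem_wt.1 (A.L_one_pow_mem_wt ha (l + 1)), ← Module.End.mul_apply (A.L 1) (A.L 1 ^ l),
      ← pow_succ', ← Module.End.mul_apply (A.L 1) (A.L 1 ^ (l + 1)), ← pow_succ']
    push_cast
    module

theorem T_pow_mem_wt (A : VOSA V) {D : ℤ} {a : V} (ha : a ∈ A.wt D) (l : ℕ) :
    (A.T ^ l) a ∈ A.wt (D + 2 * l) := by
  induction l with
  | zero => simpa using ha
  | succ l ih =>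
    rw [pow_succ', Module.End.mul_apply]
    convert A.T_mem_wt ih using 2
    push_cast
    ring

theorem L_one_T_pow_succ (A : VOSA V) {D : ℤ} {a : V} (ha : a ∈ A.wt D) (h1 : A.L 1 a = 0)
    (l : ℕ) :
    A.L 1 ((A.T ^ (l + 1)) a) = (((l + 1) * (D + l) : ℤ) : ℂ) • (A.T ^ l) a := by
  induction l with
  | zero =>
    simp only [zero_add, pow_one, pow_zero, Module.End.one_apply, L_one_T, mem_wt.1 ha, h1,
      map_zero]
    push_cast
    module
  | succ l ih =>
    rw [pow_succ', Module.End.mul_apply, L_one_T, ih, mem_wt.1 (A.T_pow_mem_wt ha (l + 1)),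
      map_smul, pow_succ' _ l, Module.End.mul_apply]
    push_cast
    module

/-- A scalar product on a VOSA which is invariant under the even part, for which the even part is
unitary; `θ` is the PCT operator of the even part, extended by zero. -/
structure EvenUnitary (A : VOSA V) where
  form : V →ₗ⋆[ℂ] V →ₗ[ℂ] ℂ
  θ : V →ₗ⋆[ℂ] V
  scalarProduct : IsScalarProduct form
  orthogonal : ∀ x ∈ A.part 0, ∀ y ∈ A.part 1, form x y = 0
  normalized : form A.vac A.vac = 1
  θ_even : ∀ x ∈ A.part 0, θ x ∈ A.part 0
  θ_odd : ∀ x ∈ A.part 1, θ x = 0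
  θ_Y : ∀ a ∈ A.part 0, ∀ b ∈ A.part 0, ∀ n : ℤ, θ (A.Y a n b) = A.Y (θ a) n (θ b)
  θ_vac : θ A.vac = A.vac
  θ_ν : θ A.ν = A.ν
  θ_invol : ∀ a ∈ A.part 0, θ (θ a) = a
  invariant : ∀ D : ℤ, ∀ a ∈ A.wt D, a ∈ A.part 0 → A.L 1 a = 0 → ∀ (n : ℤ) (b c : V),
    form (A.Y (θ a) n b) c = wtSign D * form b (A.Y a (D - n - 2) c)

namespace EvenUnitary

variable {A : VOSA V} (E : A.EvenUnitary)

/-- ν is quasi-primary of weight 2, its sign is +1, and θ fixes it. In particular T and L₁ are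
mutually adjoint. -/
theorem form_L (n : ℤ) (x y : V) : E.form (A.L n x) y = E.form x (A.L (-n) y) := by
  have h := E.invariant 4 A.ν A.ν_mem_wt A.ν_mem A.L_one_ν (n + 1) x y
  rw [E.θ_ν, show (4 : ℤ) = 2 * 2 by norm_num, wtSign_two_mul] at h
  simp only [L]
  rw [h, show (2 * 2 - (n + 1) - 2 : ℤ) = -n + 1 by ring]
  norm_num

theorem form_T_left (x y : V) : E.form (A.T x) y = E.form x (A.L 1 y) := by
  rw [← L_neg_one_eq, E.form_L, neg_neg]

theorem form_L_one_left (x y : V) : E.form (A.L 1 x) y = E.form x (A.T y) := by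
  rw [← L_neg_one_eq, E.form_L]

theorem form_vac_T (y : V) : E.form A.vac (A.T y) = 0 := by
  rw [← E.form_L_one_left, A.L_one_vac, map_zero, LinearMap.zero_apply]

theorem form_symm (x y : V) : E.form x y = starRingEnd ℂ (E.form y x) :=
  E.scalarProduct.hermitian x y

theorem form_odd_even {x y : V} (hx : x ∈ A.part 1) (hy : y ∈ A.part 0) : E.form x y = 0 := by
  rw [E.form_symm, E.orthogonal y hy x hx, map_zero]

theorem form_smul_left (r : ℂ) (x y : V) : E.form (r • x) y = starRingEnd ℂ r * E.form x y := by
  simp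

theorem form_sub_left (x y z : V) : E.form (x - y) z = E.form x z - E.form y z := by simp

theorem form_add_left (x y z : V) : E.form (x + y) z = E.form x z + E.form y z := by simp

theorem form_wt_eq_zero {D C : ℤ} (h : D ≠ C) {x y : V} (hx : x ∈ A.wt D) (hy : y ∈ A.wt C) :
    E.form x y = 0 := by
  have h1 := E.form_L 0 x y
  rw [neg_zero, mem_wt.1 hx, mem_wt.1 hy, form_smul_left, (E.form x).map_smul, smul_eq_mul,
    map_div₀, map_intCast, Complex.conj_ofNat, ← sub_eq_zero,
    ← sub_mul] at h1
  refine (mul_eq_zero.1 h1).resolve_left fun h2 => h ?_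
  have h3 : (D : ℂ) = C := by linear_combination 2 * h2
  exact_mod_cast h3

theorem ext_form {x y : V} (h : ∀ c, E.form x c = E.form y c) : x = y := by
  rw [← sub_eq_zero]
  refine E.scalarProduct.eq_zero ?_
  rw [form_sub_left, h, sub_self]

theorem ext_form_part {p : ZMod 2} {x y : V} (hx : x ∈ A.part p) (hy : y ∈ A.part p)
    (h : ∀ c ∈ A.part p, E.form x c = E.form y c) : x = y := by
  rw [← sub_eq_zero]
  refine E.scalarProduct.eq_zero ?_
  rw [form_sub_left, h _ (sub_mem hx hy), sub_self]

/-- Every homogeneous vector is the sum of a quasi-primary vector and a derivative. -/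
theorem exists_add_T (E : A.EvenUnitary) {D : ℤ} {x : V} (hx : x ∈ A.wt D) :
    ∃ q ∈ A.wt D, A.L 1 q = 0 ∧ ∃ y ∈ A.wt (D - 2), x = q + A.T y := by
  have : FiniteDimensional ℂ (A.wt (D - 2)) := A.finite_dim (D - 2)
  -- T y is the orthogonal projection of x to the derivatives of its weight. The remainder q then
  -- satisfies (L₁ q | L₁ q) = (q | T L₁ q) = 0.
  obtain ⟨k, ⟨y, hy, rfl⟩, hk⟩ :=
    E.scalarProduct.exists_mem_eq ((A.wt (D - 2)).map A.T) (E.form x)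
  have hT : A.T y ∈ A.wt D := by simpa using A.T_mem_wt hy
  have hq : x - A.T y ∈ A.wt D := sub_mem hx hT
  refine ⟨x - A.T y, hq, ?_, y, hy, by abel⟩
  refine E.scalarProduct.eq_zero ?_
  rw [E.form_L_one_left, form_sub_left, hk _ ⟨_, A.L_one_mem_wt hq, rfl⟩, sub_self]

/-- Induction on quasi-primary vectors and their derivatives. -/
theorem part_induction (E : A.EvenUnitary) {p : ZMod 2} {P : V → Prop}
    (qp : ∀ D : ℤ, (D : ZMod 2) = p → ∀ a ∈ A.wt D, A.L 1 a = 0 → P a)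
    (deriv : ∀ D : ℤ, (D : ZMod 2) = p → ∀ a ∈ A.wt D, P a → P (A.T a))
    (add : ∀ a b, P a → P b → P (a + b)) {a : V} (ha : a ∈ A.part p) : P a := by
  obtain ⟨N, hN⟩ := A.exists_wt_eq_bot
  refine A.part_induction (P := P) (fun D hD a ha => ?_) add ha
  suffices h : ∀ i : ℕ, ∀ D : ℤ, D < N + i → (D : ZMod 2) = p → ∀ a ∈ A.wt D, P a from
    h (D - N + 1).toNat D (by omega) hD a ha
  intro i
  induction i with
  | zero =>
    intro D hD hp a ha
    refine qp D hp a ha ?_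
    rw [hN D (by simpa using hD)] at ha
    rw [(Submodule.mem_bot ℂ).1 ha, map_zero]
  | succ i ih =>
    intro D hD hp a ha
    obtain ⟨q, hq, hq1, y, hy, rfl⟩ := E.exists_add_T ha
    have hp' : ((D - 2 : ℤ) : ZMod 2) = p := by
      push_cast
      rw [hp, show (2 : ZMod 2) = 0 from rfl, sub_zero]
    exact add _ _ (qp D hp q hq hq1)
      (deriv (D - 2) hp' y hy (ih _ (by push_cast at hD; omega) hp' y hy))

theorem part_of_parity {p : ZMod 2} {D : ℤ} (h : (D : ZMod 2) = p) {a : V} (ha : a ∈ A.wt D) :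
    a ∈ A.part p := h ▸ A.wt_le_part D ha

theorem T_mem_part {p : ZMod 2} {a : V} (ha : a ∈ A.part p) : A.T a ∈ A.part p := A.T_even p a ha

theorem L_mem_part (n : ℤ) {p : ZMod 2} {a : V} (ha : a ∈ A.part p) : A.L n a ∈ A.part p := by
  have h := A.parity 0 p A.ν A.ν_mem a ha (n + 1)
  rwa [zero_add] at h

theorem θ_L (n : ℤ) {x : V} (hx : x ∈ A.part 0) : E.θ (A.L n x) = A.L n (E.θ x) := by
  rw [L, E.θ_Y _ A.ν_mem _ hx, E.θ_ν]

theorem θ_T {x : V} (hx : x ∈ A.part 0) : E.θ (A.T x) = A.T (E.θ x) := by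
  rw [← L_neg_one_eq, E.θ_L _ hx]

theorem θ_mem_wt {D : ℤ} {x : V} (hx : x ∈ A.wt D) (h0 : x ∈ A.part 0) : E.θ x ∈ A.wt D := by
  rw [mem_wt] at hx ⊢
  rw [← E.θ_L 0 h0, hx, map_smulₛₗ, map_div₀, map_intCast, Complex.conj_ofNat]

/-- Two-point functions of a quasi-primary vector vanish beyond its weight. -/
theorem form_vac_Y_eq_zero {D : ℤ} {a : V} (ha : a ∈ A.wt D) (h1 : A.L 1 a = 0) {r : ℤ}
    (hr : 0 ≤ r) (c : V) : E.form A.vac (A.Y a (D - r - 2) c) = 0 := by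
  obtain ⟨s, hs⟩ := A.exists_L_one_pow_eq_zero c
  replace hs := hs s le_rfl
  induction s generalizing c r with
  | zero =>
    rw [pow_zero, Module.End.one_apply] at hs
    simp [hs]
  | succ s ih =>
    -- Pair with Ω: the image of L₁ is orthogonal to Ω since T Ω = 0, the term with L₁ c vanishes by
    -- induction, and the remaining coefficient is r + 1 ≠ 0.
    have h2 := A.L_one_Y_of_wt ha h1 (D - (r + 1) - 2) c
    have h3 := congrArg (E.form A.vac) h2
    rw [map_add, map_smul, ih (by omega) (A.L 1 c)
      (by rwa [pow_succ, Module.End.mul_apply] at hs), zero_add] at h3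
    have h4 : E.form A.vac (A.L 1 (A.Y a (D - (r + 1) - 2) c)) = 0 := by
      have h5 := E.form_T_left A.vac (A.Y a (D - (r + 1) - 2) c)
      rwa [A.T_vac, map_zero, LinearMap.zero_apply, eq_comm] at h5
    rw [h4, eq_comm, smul_eq_mul, show D - (r + 1) - 2 + 1 = D - r - 2 by ring] at h3
    refine (mul_eq_zero.1 h3).resolve_left ?_
    exact_mod_cast (by omega : D - (D - (r + 1) - 2) - 2 ≠ 0)

end EvenUnitary

end VOSA

/-! ### The conjugation of the odd part and its adjoint relation -/

namespace VOSA.EvenUnitary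

variable {V : Type*} [AddCommGroup V] [Module ℂ V] {A : VOSA V} (E : A.EvenUnitary)

/-- Skew-symmetry modulo derivatives, which are orthogonal to Ω. For D = C the sign of two odd
vectors cancels the minus sign, as D - 1 is even. For D ≠ C the weights do not match. This symmetry
makes the formula for conjugates of quasi-primary vectors consistent with `IsConj`. -/
theorem form_Y_odd_symm {D C : ℤ} (hD : (D : ZMod 2) = 1) (hC : (C : ZMod 2) = 1) {a c : V}
    (ha : a ∈ A.wt D) (hc : c ∈ A.wt C) :
    wtSign D * E.form A.vac (A.Y a (D - 1) c) = wtSign C * E.form A.vac (A.Y c (C - 1) a) := by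
  rcases eq_or_ne D C with rfl | h
  · obtain ⟨y, hy⟩ := A.exists_skew (part_of_parity hC hc) (part_of_parity hD ha) (D - 1)
    obtain ⟨d, rfl⟩ := exists_eq_of_parity_one hD
    rw [hy, map_add, form_vac_T, add_zero, map_smul, paritySign_one_one, add_sub_cancel_right,
      zpow_mul]
    norm_num
  · have h1 := A.Y_mem_wt ha hc (D - 1)
    have h2 := A.Y_mem_wt hc ha (C - 1)
    rw [E.form_wt_eq_zero (by omega) A.vac_mem_wt h1, E.form_wt_eq_zero (by omega) A.vac_mem_wt h2,
      mul_zero, mul_zero]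

/-- The vector `a'` is conjugate to the odd vector `a`: the form pairs `a'` with
derivatives of quasi-primary vectors as the vacuum expectation values do with `a`. -/
def IsConj (a a' : V) : Prop :=
  a' ∈ A.part 1 ∧ ∀ C : ℤ, (C : ZMod 2) = 1 → ∀ c ∈ A.wt C, A.L 1 c = 0 → ∀ j : ℕ,
    E.form a' ((A.T ^ j) c) = wtSign C * E.form A.vac (A.Y c (C - 1) ((A.L 1 ^ j) a))

variable {E}

theorem IsConj.add {a a' b b' : V} (h1 : E.IsConj a a') (h2 : E.IsConj b b') :
    E.IsConj (a + b) (a' + b') :=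
  ⟨add_mem h1.1 h2.1, fun C hC c hc hc1 j => by
    rw [form_add_left, h1.2 C hC c hc hc1, h2.2 C hC c hc hc1, map_add, map_add, map_add, mul_add]⟩

theorem IsConj.smul {a a' : V} (h : E.IsConj a a') (r : ℂ) :
    E.IsConj (r • a) (starRingEnd ℂ r • a') :=
  ⟨Submodule.smul_mem _ _ h.1, fun C hC c hc hc1 j => by
    rw [form_smul_left, h.2 C hC c hc hc1, map_smul, map_smul, map_smul, Complex.conj_conj,
      smul_eq_mul, mul_left_comm]⟩

/-- The iterated derivatives of quasi-primary odd vectors span the odd part, and the form is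
nondegenerate there. -/
theorem IsConj.unique {a a' b' : V} (h1 : E.IsConj a a') (h2 : E.IsConj a b') : a' = b' := by
  refine E.ext_form_part h1.1 h2.1 fun c hc => ?_
  have key : ∀ j : ℕ, E.form a' ((A.T ^ j) c) = E.form b' ((A.T ^ j) c) := by
    refine E.part_induction (p := 1)
      (P := fun c => ∀ j : ℕ, E.form a' ((A.T ^ j) c) = E.form b' ((A.T ^ j) c))
      (fun D hD c hc hc1 j => ?_) (fun D hD c hc ih j => ?_) (fun x y hx hy j => ?_) hc
    · rw [h1.2 D hD c hc hc1, h2.2 D hD c hc hc1]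
    · rw [← Module.End.mul_apply, ← pow_succ, ih]
    · rw [map_add, map_add, map_add, hx, hy]
  exact key 0

theorem IsConj.L_one {a a' : V} (h : E.IsConj a a') : E.IsConj (A.L 1 a) (A.L 1 a') :=
  ⟨L_mem_part 1 h.1, fun C hC c hc hc1 j => by
    rw [form_L_one_left, ← Module.End.mul_apply, ← pow_succ', h.2 C hC c hc hc1,
      ← Module.End.mul_apply (A.L 1 ^ j), ← pow_succ]⟩

/-- Moving T across the form as L₁ gives the factor (j+1)(C+j) on one side and (j+1)(D-j) on the
other. They agree when C = D - 2j, and otherwise the common vacuum expectation is zero by weight. -/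
theorem IsConj.deriv {D : ℤ} {a a' : V} (ha : a ∈ A.wt D) (h : E.IsConj a a') :
    E.IsConj (A.T a) (A.T a') := by
  refine ⟨T_mem_part h.1, fun C hC c hc hc1 j => ?_⟩
  have hvac (y : V) : E.form A.vac (A.Y c (C - 1) (A.T y)) = 0 := by
    have h0 := E.form_vac_Y_eq_zero hc hc1 le_rfl y
    rw [Y_T_right, map_add, form_vac_T, map_smul, show C - 1 - 1 = C - 0 - 2 by ring, h0]
    simp
  rw [form_T_left]
  cases j with
  | zero => simp [hc1, hvac]
  | succ j =>
    rw [L_one_T_pow_succ A hc hc1, map_smul, h.2 C hC c hc hc1, L_one_pow_succ_T A ha, map_add,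
      map_add, hvac, zero_add, map_smul, map_smul, smul_eq_mul, smul_eq_mul]
    by_cases hCD : C = D - 2 * j
    · rw [show D - j = C + j by omega]
      ring
    · have h1 := A.Y_mem_wt hc (A.L_one_pow_mem_wt ha j) (C - 1)
      rw [E.form_wt_eq_zero (by omega) A.vac_mem_wt h1]
      simp

variable (E)

/-- The vector represents c ↦ ±(Ω | a_(D-1) c) on the finite-dimensional weight space of a. Both
sides vanish on all other weights, so the formula holds for every c. -/
theorem exists_isConj_of_quasiPrimary {D : ℤ} (hD : (D : ZMod 2) = 1) {a : V} (ha : a ∈ A.wt D)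
    (h1 : A.L 1 a = 0) : ∃ a' ∈ A.wt D, A.L 1 a' = 0 ∧ E.IsConj a a' ∧
      ∀ c, E.form a' c = wtSign D * E.form A.vac (A.Y a (D - 1) c) := by
  have : FiniteDimensional ℂ (A.wt D) := A.finite_dim D
  obtain ⟨a', ha', h⟩ := E.scalarProduct.exists_mem_eq (A.wt D)
    (wtSign D • E.form A.vac ∘ₗ A.Y a (D - 1))
  simp only [LinearMap.smul_apply, LinearMap.comp_apply, smul_eq_mul] at h
  have hall (c : V) : E.form a' c = wtSign D * E.form A.vac (A.Y a (D - 1) c) := by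
    refine A.wt_induction
      (P := fun c => E.form a' c = wtSign D * E.form A.vac (A.Y a (D - 1) c))
      (fun C c hc => ?_) (fun x y hx hy => ?_) c
    · rcases eq_or_ne C D with rfl | hne
      · exact h c hc
      · have h1 := A.Y_mem_wt ha hc (D - 1)
        rw [E.form_wt_eq_zero hne.symm ha' hc, E.form_wt_eq_zero (by omega) A.vac_mem_wt h1,
          mul_zero]
    · rw [map_add, map_add, map_add, hx, hy, mul_add]
  have hL : A.L 1 a' = 0 := by
    refine E.ext_form fun x => ?_
    have h0 := E.form_vac_Y_eq_zero ha h1 le_rfl x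
    rw [form_L_one_left, hall, Y_T_right, map_add, form_vac_T, map_smul,
      show D - 1 - 1 = D - 0 - 2 by ring, h0]
    simp
  refine ⟨a', ha', hL, ⟨part_of_parity hD ha', fun C hC c hc hc1 j => ?_⟩, hall⟩
  cases j with
  | zero =>
    rw [pow_zero, pow_zero, Module.End.one_apply, Module.End.one_apply, hall,
      E.form_Y_odd_symm hD hC ha hc]
  | succ j =>
    rw [pow_succ', Module.End.mul_apply, ← form_L_one_left, hL, pow_succ, Module.End.mul_apply, h1]
    simp

theorem exists_isConj {a : V} (ha : a ∈ A.part 1) : ∃ a', E.IsConj a a' := by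
  refine E.part_induction (P := fun a => ∃ a', E.IsConj a a') (fun D hD a ha h1 => ?_)
    (fun D hD a ha h => ?_) (fun x y hx hy => ?_) ha
  · obtain ⟨a', -, -, h, -⟩ := E.exists_isConj_of_quasiPrimary hD ha h1
    exact ⟨a', h⟩
  · obtain ⟨a', h⟩ := h
    exact ⟨_, h.deriv ha⟩
  · obtain ⟨x', hx⟩ := hx
    obtain ⟨y', hy⟩ := hy
    exact ⟨_, hx.add hy⟩

/-- The projection onto the part of parity `p`. -/
noncomputable def _root_.VOSA.parityProj (A : VOSA V) (p : ZMod 2) : Module.End ℂ V :=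
  (1 / 2 : ℂ) • (1 + (-1 : ℂ) ^ p.val • A.Γ)

theorem _root_.VOSA.parityProj_mem (A : VOSA V) (p : ZMod 2) (x : V) :
    A.parityProj p x ∈ A.part p := by
  have e : (1 : ZMod 2).val = 1 := rfl
  rcases parity_cases p with rfl | rfl <;>
  · simp only [PreVertexSuperalgebra.part, Module.End.mem_eigenspace_iff, parityProj, map_smul,
      map_add, A.Γ_sq, ZMod.val_zero, e, LinearMap.smul_apply, LinearMap.add_apply,
      Module.End.one_apply]
    module

theorem _root_.VOSA.parityProj_add (A : VOSA V) (x : V) :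
    A.parityProj 0 x + A.parityProj 1 x = x := by
  have e : (1 : ZMod 2).val = 1 := rfl
  simp only [parityProj, ZMod.val_zero, e, LinearMap.smul_apply, LinearMap.add_apply,
    Module.End.one_apply]
  module

theorem _root_.VOSA.parityProj_of_mem (A : VOSA V) {p : ZMod 2} {x : V} (hx : x ∈ A.part p) :
    A.parityProj p x = x := by
  have e : (1 : ZMod 2).val = 1 := rfl
  rcases parity_cases p with rfl | rfl <;>
  · simp only [PreVertexSuperalgebra.part, Module.End.mem_eigenspace_iff] at hx
    simp only [parityProj, LinearMap.smul_apply, LinearMap.add_apply,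
      Module.End.one_apply, hx, ZMod.val_zero, e]
    module

theorem _root_.VOSA.parityProj_of_mem' (A : VOSA V) {p : ZMod 2} {x : V}
    (hx : x ∈ A.part (1 + p)) : A.parityProj p x = 0 := by
  have e : (1 : ZMod 2).val = 1 := rfl
  have e' : ((1 : ZMod 2) + 1).val = 0 := rfl
  rcases parity_cases p with rfl | rfl <;>
  · simp only [PreVertexSuperalgebra.part, Module.End.mem_eigenspace_iff] at hx
    simp only [parityProj, LinearMap.smul_apply, LinearMap.add_apply,
      Module.End.one_apply, hx, ZMod.val_zero, e, e', add_zero]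
    module

/-- The conjugation of the odd part, extended by zero to the even part. -/
noncomputable def oddConj : V →ₗ⋆[ℂ] V where
  toFun x := (E.exists_isConj (A.parityProj_mem 1 x)).choose
  map_add' x y := by
    have h := (E.exists_isConj (A.parityProj_mem 1 (x + y))).choose_spec
    have hx := (E.exists_isConj (A.parityProj_mem 1 x)).choose_spec
    have hy := (E.exists_isConj (A.parityProj_mem 1 y)).choose_spec
    exact IsConj.unique h (by rw [map_add]; exact hx.add hy)
  map_smul' r x := by
    have h := (E.exists_isConj (A.parityProj_mem 1 (r • x))).choose_spec
    have hx := (E.exists_isConj (A.parityProj_mem 1 x)).choose_spec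
    exact IsConj.unique h (by rw [map_smul]; exact hx.smul r)

theorem isConj_oddConj {a : V} (ha : a ∈ A.part 1) : E.IsConj a (E.oddConj a) := by
  have h := (E.exists_isConj (A.parityProj_mem 1 a)).choose_spec
  nth_rw 1 [A.parityProj_of_mem ha] at h
  exact h

theorem oddConj_even {a : V} (ha : a ∈ A.part 0) : E.oddConj a = 0 := by
  have h := (E.exists_isConj (A.parityProj_mem 1 a)).choose_spec
  have h0 : A.parityProj 1 a = 0 := A.parityProj_of_mem' ha
  nth_rw 1 [h0] at h
  exact h.unique ⟨zero_mem _, by simp⟩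

theorem IsConj.oddConj_eq {E : A.EvenUnitary} {a a' : V} (ha : a ∈ A.part 1)
    (h : E.IsConj a a') : E.oddConj a = a' :=
  (E.isConj_oddConj ha).unique h

theorem oddConj_mem {a : V} (ha : a ∈ A.part 1) : E.oddConj a ∈ A.part 1 :=
  (E.isConj_oddConj ha).1

theorem oddConj_L_one {a : V} (ha : a ∈ A.part 1) : E.oddConj (A.L 1 a) = A.L 1 (E.oddConj a) :=
  (E.isConj_oddConj ha).L_one.oddConj_eq (L_mem_part 1 ha)

theorem oddConj_T {a : V} (ha : a ∈ A.part 1) : E.oddConj (A.T a) = A.T (E.oddConj a) := by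
  refine A.part_induction (P := fun a => E.oddConj (A.T a) = A.T (E.oddConj a))
    (fun D hD a ha => ?_) (fun x y hx hy => ?_) ha
  · have h1 := part_of_parity hD ha
    exact ((E.isConj_oddConj h1).deriv ha).oddConj_eq (T_mem_part h1)
  · simp only [map_add, hx, hy]

theorem oddConj_quasiPrimary {D : ℤ} (hD : (D : ZMod 2) = 1) {a : V} (ha : a ∈ A.wt D)
    (h1 : A.L 1 a = 0) : E.oddConj a ∈ A.wt D ∧ A.L 1 (E.oddConj a) = 0 ∧
      ∀ c, E.form (E.oddConj a) c = wtSign D * E.form A.vac (A.Y a (D - 1) c) := by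
  obtain ⟨a', h2, h3, h4, h5⟩ := E.exists_isConj_of_quasiPrimary hD ha h1
  rw [h4.oddConj_eq (part_of_parity hD ha)]
  exact ⟨h2, h3, h5⟩

theorem oddConj_L_zero {a : V} (ha : a ∈ A.part 1) :
    E.oddConj (A.L 0 a) = A.L 0 (E.oddConj a) := by
  have key : a ∈ A.part 1 ∧ E.oddConj (A.L 0 a) = A.L 0 (E.oddConj a) := by
    refine E.part_induction (p := 1)
      (P := fun a => a ∈ A.part 1 ∧ E.oddConj (A.L 0 a) = A.L 0 (E.oddConj a))
      (fun D hD a ha h1 => ⟨part_of_parity hD ha, ?_⟩)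
      (fun D hD a ha h => ⟨T_mem_part h.1, ?_⟩) (fun x y hx hy => ⟨add_mem hx.1 hy.1, ?_⟩) ha
    · rw [mem_wt.1 ha, map_smulₛₗ, mem_wt.1 (E.oddConj_quasiPrimary hD ha h1).1, map_div₀,
        map_intCast, Complex.conj_ofNat]
    · rw [L_zero_T, map_add, E.oddConj_T (L_mem_part 0 h.1), E.oddConj_T h.1, h.2, L_zero_T]
    · rw [map_add, map_add, map_add, map_add, hx.2, hy.2]
  exact key.2

theorem oddConj_mem_wt {D : ℤ} (hD : (D : ZMod 2) = 1) {a : V} (ha : a ∈ A.wt D) :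
    E.oddConj a ∈ A.wt D := by
  rw [mem_wt, ← E.oddConj_L_zero (part_of_parity hD ha), mem_wt.1 ha, map_smulₛₗ, map_div₀,
    map_intCast, Complex.conj_ofNat]

/-- For a quasi-primary, the explicit formula for its conjugate coincides with the defining pairing
of the conjugate of c with a. The step to derivatives uses that T and L₁ are adjoint. -/
theorem form_oddConj_symm {a c : V} (ha : a ∈ A.part 1) (hc : c ∈ A.part 1) :
    E.form (E.oddConj a) c = E.form (E.oddConj c) a := by
  have key : a ∈ A.part 1 ∧ ∀ c ∈ A.part 1, E.form (E.oddConj a) c = E.form (E.oddConj c) a := by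
    refine E.part_induction (p := 1)
      (P := fun a => a ∈ A.part 1 ∧
        ∀ c ∈ A.part 1, E.form (E.oddConj a) c = E.form (E.oddConj c) a)
      (fun D hD a ha h1 => ⟨part_of_parity hD ha, fun c hc => ?_⟩)
      (fun D hD a ha h => ⟨T_mem_part h.1, fun c hc => ?_⟩)
      (fun x y hx hy => ⟨add_mem hx.1 hy.1, fun c hc => ?_⟩) ha
    · rw [(E.oddConj_quasiPrimary hD ha h1).2.2 c]
      exact ((E.isConj_oddConj hc).2 D hD a ha h1 0).symm
    · rw [E.oddConj_T h.1, form_T_left, h.2 _ (L_mem_part 1 hc), E.oddConj_L_one hc,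
        form_L_one_left]
    · rw [map_add, form_add_left, map_add, hx.2 c hc, hy.2 c hc]
  exact key.2 c hc

/-- The adjoint relation on the vacuum, from which the general case is deduced. Both sides vanish
for r ≥ 0, r = -1 is the formula for the conjugate, and T on the left against L₁ on the right lowers
r further. -/
theorem form_oddConj_Y_vac {D : ℤ} (hD : (D : ZMod 2) = 1) {a : V} (ha : a ∈ A.wt D)
    (h1 : A.L 1 a = 0) (r : ℤ) (c : V) :
    E.form (A.Y (E.oddConj a) r A.vac) c = wtSign D * E.form A.vac (A.Y a (D - r - 2) c) := by
  rcases le_or_gt 0 r with hr | hr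
  · rw [A.Y_vac_eq_zero _ hr, E.form_vac_Y_eq_zero ha h1 hr]
    simp
  · suffices h : ∀ i : ℕ, ∀ c, E.form (A.Y (E.oddConj a) (-1 - i) A.vac) c =
        wtSign D * E.form A.vac (A.Y a (D - (-1 - i) - 2) c) by
      have := h (-1 - r).toNat c
      rwa [show -1 - ((-1 - r).toNat : ℤ) = r by omega] at this
    intro i
    induction i with
    | zero =>
      intro c
      have := (E.oddConj_quasiPrimary hD ha h1).2.2 c
      simp only [CharP.cast_eq_zero, sub_zero, A.creation, this]
      ring_nf
    | succ i ih =>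
      intro c
      have h2 := congrArg (E.form · c) (A.T_Y_vac (E.oddConj a) (-1 - i))
      simp only [form_T_left] at h2
      rw [ih, ← neg_smul, ← Int.cast_smul_eq_zsmul ℂ, form_smul_left, map_intCast] at h2
      have h3 := congrArg (E.form A.vac) (A.L_one_Y_of_wt ha h1 (D - (-1 - i) - 2) c)
      rw [map_add, map_smul, ← E.form_T_left, A.T_vac, map_zero, LinearMap.zero_apply,
        smul_eq_mul] at h3
      have h4 : ((-(-1 - i : ℤ) : ℤ) : ℂ) ≠ 0 := by exact_mod_cast (by omega : -(-1 - i : ℤ) ≠ 0)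
      refine mul_left_cancel₀ h4 ?_
      rw [show (-1 - ((i + 1 : ℕ) : ℤ)) = -1 - i - 1 by push_cast; ring, ← h2,
        show D - (-1 - (i : ℤ) - 1) - 2 = D - (-1 - i) - 2 + 1 by ring]
      push_cast at h3 ⊢
      linear_combination (-wtSign D) * h3

/-- Adjoints replace z by 1/z, thus reverse the modes. Up to a sign and a shift, z - w is preserved,
so locality survives the passage to adjoints. -/
theorem mulZSubW_iterate_reflect {W : Type*} [AddCommGroup W] (N : ℕ) (G : ℤ → ℤ → W)
    (p q r l : ℤ) :
    mulZSubW^[N] (fun r l => G (p - r) (q - l)) r l =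
      (-1 : ℤ) ^ N • mulZSubW^[N] G (p - r - N) (q - l - N) := by
  induction N generalizing r l with
  | zero => simp
  | succ N ih =>
    rw [iterate_succ_apply', mulZSubW, ih, ih, iterate_succ_apply', mulZSubW, pow_succ, mul_neg_one,
      neg_smul, smul_sub, neg_sub]
    congr 3 <;> push_cast <;> ring_nf

/-- The adjoint relation for an odd quasi-primary vector. -/
theorem form_oddConj_Y {D : ℤ} (hD : (D : ZMod 2) = 1) {a : V} (ha : a ∈ A.wt D)
    (h1 : A.L 1 a = 0) {b : V} (hb : b ∈ A.part 0) (r : ℤ) (c : V) :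
    E.form (A.Y (E.oddConj a) r b) c = wtSign D * E.form b (A.Y a (D - r - 2) c) := by
  have haodd := part_of_parity hD ha
  suffices key : ∀ (r : ℤ) (c : V),
      E.form (A.Y (E.oddConj a) r b) c = wtSign D * E.form b (A.Y a (D - r - 2) c) from key r c
  refine E.part_induction (p := 0) (P := fun b => ∀ (r : ℤ) (c : V),
      E.form (A.Y (E.oddConj a) r b) c = wtSign D * E.form b (A.Y a (D - r - 2) c))
    (fun C hC b hb hb1 r c => ?_) (fun C hC b hb ih r c => ?_) (fun x y hx hy r c => ?_) hb
  · have hbev := part_of_parity hC hb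
    have hb' := E.θ_mem_wt hb hbev
    have hb'ev := E.θ_even b hbev
    have hinv (n : ℤ) (x y : V) :
        E.form (A.Y b n x) y = wtSign C * E.form x (A.Y (E.θ b) (C - n - 2) y) := by
      have h := E.invariant C _ hb' hb'ev (by rw [← E.θ_L 1 hbev, hb1, map_zero]) n x y
      rwa [E.θ_invol b hbev] at h
    obtain ⟨M1, hM1⟩ := A.isMutuallyLocal (E.oddConj_mem haodd) hbev
    obtain ⟨M2, hM2⟩ := A.isMutuallyLocal haodd hb'ev
    set M := max M1 M2
    have e1 := hM1 M (le_max_left _ _) A.vac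
    have e2 := hM2 M (le_max_right _ _) c
    simp only [paritySign_zero_right, one_smul] at e1 e2
    set h : ℤ → ℤ → ℂ := fun r l => E.form (A.Y (E.oddConj a) r (A.Y b l A.vac)) c -
      wtSign D * E.form (A.Y b l A.vac) (A.Y a (D - r - 2) c) with hdef
    -- Move b to the left of the conjugate of a, then use the adjoint of b and the vacuum case. The
    -- error is a commutator for each side, and locality kills both, so the defect h satisfies the
    -- hypotheses of `eq_zero_of_mulZSubW_iterate`.
    have hsplit : h = fun r l => E.form (A.Y (E.oddConj a) r (A.Y b l A.vac) -
        A.Y b l (A.Y (E.oddConj a) r A.vac)) c - (-(wtSign C * wtSign D)) •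
        E.form A.vac (A.Y a (D - 2 - r) (A.Y (E.θ b) (C - 2 - l) c) -
          A.Y (E.θ b) (C - 2 - l) (A.Y a (D - 2 - r) c)) := by
      funext r l
      simp only [hdef, form_sub_left, (E.form A.vac).map_sub, hinv, E.form_oddConj_Y_vac hD ha h1, smul_eq_mul,
        show D - r - 2 = D - 2 - r by ring, show C - l - 2 = C - 2 - l by ring]
      ring
    have hM : mulZSubW^[M] h = 0 := by
      funext r l
      rw [hsplit, mulZSubW_iterate_sub_smul]
      have f1 := mulZSubW_iterate_map (E.form.flip c).toAddMonoidHom M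
        (fun r l => A.Y (E.oddConj a) r (A.Y b l A.vac) -
          A.Y b l (A.Y (E.oddConj a) r A.vac)) r l
      have f2 := mulZSubW_iterate_map (E.form A.vac).toAddMonoidHom M
        (fun r l => A.Y a (D - 2 - r) (A.Y (E.θ b) (C - 2 - l) c) -
          A.Y (E.θ b) (C - 2 - l) (A.Y a (D - 2 - r) c)) r l
      rw [e1] at f1
      rw [mulZSubW_iterate_reflect M (fun r l => A.Y a r (A.Y (E.θ b) l c) -
        A.Y (E.θ b) l (A.Y a r c)), e2] at f2
      simp only [LinearMap.toAddMonoidHom_coe, LinearMap.flip_apply, Pi.zero_apply, map_zero,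
        smul_zero] at f1 f2
      rw [f1, f2]
      simp
    have := eq_zero_of_mulZSubW_iterate (fun r l hl => by
      simp [hdef, A.Y_vac_eq_zero b hl]) hM r
    rw [hdef] at this
    simp only [A.creation] at this
    exact sub_eq_zero.1 this
  · rw [Y_T_right, form_add_left, form_T_left, form_smul_left, ih, ih, form_T_left,
      A.L_one_Y_of_wt ha h1, map_add, map_smul, map_intCast, smul_eq_mul,
      show D - (r - 1) - 2 = D - r - 2 + 1 by ring]
    push_cast
    ring
  · rw [map_add, form_add_left, form_add_left, hx, hy, mul_add]

end VOSA.EvenUnitary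

/-! ### Equivariance of the conjugation and Schur's lemma -/

namespace VOSA.EvenUnitary

variable {V : Type*} [AddCommGroup V] [Module ℂ V] {A : VOSA V} (E : A.EvenUnitary)

/-- Skew-symmetry modulo derivatives, on the left of a quasi-primary vector. -/
theorem form_skew_left {p q : ZMod 2} {a b c : V} (ha : a ∈ A.part p) (hb : b ∈ A.part q)
    (hc : A.L 1 c = 0) (n : ℤ) :
    E.form (A.Y b n a) c = -(paritySign p q * (-1 : ℂ) ^ n) * E.form (A.Y a n b) c := by
  obtain ⟨y, hy⟩ := A.exists_skew ha hb n
  rw [hy, form_add_left, form_smul_left, form_T_left, hc, map_zero, add_zero]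
  simp [paritySign]

/-- Skew-symmetry modulo derivatives, on the right of a quasi-primary vector. -/
theorem form_skew_right {p q : ZMod 2} {a b c : V} (ha : a ∈ A.part p) (hb : b ∈ A.part q)
    (hc : A.L 1 c = 0) (n : ℤ) :
    E.form c (A.Y b n a) = -(paritySign p q * (-1 : ℂ) ^ n) * E.form c (A.Y a n b) := by
  obtain ⟨y, hy⟩ := A.exists_skew ha hb n
  rw [hy, map_add, ← form_L_one_left, hc, map_zero, LinearMap.zero_apply, add_zero, map_smul,
    smul_eq_mul]

theorem neg_one_zpow_mul_self (n : ℤ) : (-1 : ℂ) ^ n * (-1 : ℂ) ^ n = 1 := by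
  rw [← mul_zpow]
  norm_num

theorem form_oddConj_Y_of_quasiPrimary {D C F n : ℤ} (hD : (D : ZMod 2) = 0)
    (hC : (C : ZMod 2) = 1) (hF : (F : ZMod 2) = 1) {y a c : V}
    (hy : y ∈ A.wt D) (hy1 : A.L 1 y = 0) (ha : a ∈ A.wt C) (ha1 : A.L 1 a = 0)
    (hc : c ∈ A.wt F) (hc1 : A.L 1 c = 0) :
    E.form (E.oddConj (A.Y y n a)) c = E.form (A.Y (E.θ y) n (E.oddConj a)) c := by
  have hye := part_of_parity hD hy
  have hao := part_of_parity hC ha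
  have hco := part_of_parity hF hc
  have hya : A.Y y n a ∈ A.part 1 := by simpa using A.parity 0 1 y hye a hao n
  have hθy := E.θ_mem_wt hy hye
  have hθye := E.θ_even y hye
  have hθy1 : A.L 1 (E.θ y) = 0 := by rw [← E.θ_L 1 hye, hy1, map_zero]
  obtain ⟨hu, hu1, -⟩ := E.oddConj_quasiPrimary hC ha ha1
  obtain ⟨hw, hw1, -⟩ := E.oddConj_quasiPrimary hF hc hc1
  have huo := E.oddConj_mem hao
  have hwo := E.oddConj_mem hco
  by_cases hwt : F = D + C - 2 * n - 2
  -- Write a bar for conjugates and omit modes and signs. The chain is (c̄ | y a), (ȳ c̄ | a), (c̄ ȳ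
  -- | a), (ȳ | c a), (ȳ | a c), (ā ȳ | c), (ȳ ā | c). It alternates adjoints with skew-symmetry,
  -- the latter always against a quasi-primary vector.
  · rw [E.form_oddConj_symm hya hco]
    have h1 : E.form (E.oddConj c) (A.Y y n a) =
        wtSign D * E.form (A.Y (E.θ y) (D - n - 2) (E.oddConj c)) a := by
      rw [E.invariant D y hy hye hy1, ← mul_assoc, wtSign_mul_self, one_mul,
        show D - (D - n - 2) - 2 = n by ring]
    rw [h1, E.form_skew_left hwo hθye ha1, E.form_oddConj_Y hF hc hc1 hθye,
      E.form_skew_right hao hco hθy1]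
    have h2 := E.form_oddConj_Y hC ha ha1 hθye n c
    rw [E.form_skew_left hθye huo hc1] at h2
    have h3 : E.form (E.θ y) (A.Y a (F - (D - n - 2) - 2) c) =
        wtSign C * (-(paritySign 0 1 * (-1 : ℂ) ^ n) * E.form (A.Y (E.θ y) n (E.oddConj a)) c) := by
      rw [h2, ← mul_assoc, wtSign_mul_self, one_mul, hwt]
      ring_nf
    rw [h3, paritySign_one_one, paritySign_zero_left, paritySign_zero_right]
    obtain ⟨d, rfl⟩ := exists_eq_of_parity_zero hD
    obtain ⟨k, rfl⟩ := exists_eq_of_parity_one hC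
    obtain ⟨f, rfl⟩ := exists_eq_of_parity_one hF
    obtain rfl : f = d + k - n - 1 := by omega
    simp only [wtSign_two_mul, wtSign_two_mul_add_one]
    rw [show 2 * d - n - 2 = 2 * (d - 1) - n by ring,
      show 2 * (d + k - n - 1) + 1 - (2 * (d - 1) - n) - 2 = 2 * (k - n - 1) + 1 + n by ring,
      show d + k - n - 1 + 1 = d + k - n by ring]
    have hneg : (-1 : ℂ) ≠ 0 := by norm_num
    have h4 : (-1 : ℂ) ^ (2 * (d - 1) - n) = (-1 : ℂ) ^ n := by
      rw [show 2 * (d - 1) - n = 2 * (d - 1 - n) + n by ring, zpow_add₀ hneg, zpow_mul]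
      norm_num
    have h5 : (-1 : ℂ) ^ (2 * (k - n - 1) + 1 + n) = -(-1 : ℂ) ^ n := by
      rw [zpow_add₀ hneg, zpow_add₀ hneg, zpow_mul]
      norm_num
    have h6 : (-1 : ℂ) ^ (d + k - n) = (-1 : ℂ) ^ d * (-1 : ℂ) ^ k * (-1 : ℂ) ^ n := by
      rw [show d + k - n = d + k + n + 2 * (-n) by ring, zpow_add₀ hneg (d + k + n), zpow_mul,
        zpow_add₀ hneg, zpow_add₀ hneg]
      norm_num
    rw [h4, h5, h6, zpow_add₀ hneg, zpow_one]
    have s1 := neg_one_zpow_mul_self d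
    have s2 := neg_one_zpow_mul_self k
    have s3 := neg_one_zpow_mul_self n
    set X := E.form (A.Y (E.θ y) n (E.oddConj a)) c
    set x := (-1 : ℂ) ^ d
    set z := (-1 : ℂ) ^ k
    set w := (-1 : ℂ) ^ n
    -- Each of the three signs occurs to an even power, so the total sign is +1.
    have : x * (-(1 * w) * (x * z * w * (-(-1 * -w) * (z * (-1) * (-(1 * w) * X))))) =
        (x * x) * (z * z) * (w * w) * (w * w) * X := by ring
    rw [this, s1, s2, s3]
    ring
  · have h1 := A.Y_mem_wt hy ha n
    have hpar : ((D + C - 2 * n - 2 : ℤ) : ZMod 2) = 1 := by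
      push_cast
      rw [hD, hC, show (2 : ZMod 2) = 0 from rfl]
      ring
    have h2 := A.Y_mem_wt hθy hu n
    rw [E.form_wt_eq_zero (Ne.symm hwt) (E.oddConj_mem_wt hpar h1) hc,
      E.form_wt_eq_zero (Ne.symm hwt) h2 hc]

/-- The conjugation of the odd part is equivariant under the even part. -/
theorem oddConj_Y {y a : V} (hy : y ∈ A.part 0) (ha : a ∈ A.part 1) (n : ℤ) :
    E.oddConj (A.Y y n a) = A.Y (E.θ y) n (E.oddConj a) := by
  have hYodd {y a : V} (hy : y ∈ A.part 0) (ha : a ∈ A.part 1) (n : ℤ) :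
      A.Y y n a ∈ A.part 1 := by simpa using A.parity 0 1 y hy a ha n
  have key : y ∈ A.part 0 ∧ ∀ a ∈ A.part 1, ∀ n : ℤ,
      E.oddConj (A.Y y n a) = A.Y (E.θ y) n (E.oddConj a) := by
    refine E.part_induction (p := 0) (P := fun y => y ∈ A.part 0 ∧ ∀ a ∈ A.part 1, ∀ n : ℤ,
      E.oddConj (A.Y y n a) = A.Y (E.θ y) n (E.oddConj a))
      (fun D hD y hy hy1 => ⟨part_of_parity hD hy, fun a ha => ?_⟩)
      (fun D hD y hy ih => ⟨T_mem_part ih.1, fun a ha n => ?_⟩)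
      (fun x y hx hy => ⟨add_mem hx.1 hy.1, fun a ha n => ?_⟩) hy
    · have hye := part_of_parity hD hy
      have hθy := E.θ_mem_wt hy hye
      have hθye := E.θ_even y hye
      have hθy1 : A.L 1 (E.θ y) = 0 := by rw [← E.θ_L 1 hye, hy1, map_zero]
      have key2 : a ∈ A.part 1 ∧ ∀ n : ℤ,
          E.oddConj (A.Y y n a) = A.Y (E.θ y) n (E.oddConj a) := by
        refine E.part_induction (p := 1) (P := fun a => a ∈ A.part 1 ∧ ∀ n : ℤ,
            E.oddConj (A.Y y n a) = A.Y (E.θ y) n (E.oddConj a))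
          (fun C hC a ha ha1 => ⟨part_of_parity hC ha, fun n => ?_⟩)
          (fun C hC a ha ih => ⟨T_mem_part ih.1, fun n => ?_⟩)
          (fun x z hx hz => ⟨add_mem hx.1 hz.1, fun n => ?_⟩) ha
        · have hao := part_of_parity hC ha
          obtain ⟨hu, hu1, -⟩ := E.oddConj_quasiPrimary hC ha ha1
          refine E.ext_form_part (E.oddConj_mem (hYodd hye hao n))
            (hYodd hθye (E.oddConj_mem hao) n) fun c hc => ?_
          suffices h : ∀ n : ℤ, E.form (E.oddConj (A.Y y n a)) c =
              E.form (A.Y (E.θ y) n (E.oddConj a)) c from h n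
          refine E.part_induction (p := 1) (P := fun c => ∀ n : ℤ,
              E.form (E.oddConj (A.Y y n a)) c = E.form (A.Y (E.θ y) n (E.oddConj a)) c)
            (fun F hF c hc hc1 n => ?_) (fun F hF c hc ih n => ?_) (fun x z hx hz n => ?_) hc
          · exact E.form_oddConj_Y_of_quasiPrimary hD hC hF hy hy1 ha ha1 hc hc1
          -- As y and a are quasi-primary, applying L₁ just raises n by one, with the same real
          -- coefficient on both sides.
          · rw [← form_L_one_left, ← E.oddConj_L_one (hYodd hye hao n), ← form_L_one_left,
              A.L_one_Y_of_wt hy hy1, A.L_one_Y_of_wt hθy hθy1, ha1, hu1, map_zero, map_zero,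
              zero_add, zero_add, map_smulₛₗ, form_smul_left, form_smul_left, map_intCast,
              map_intCast, ih]
          · rw [map_add, map_add, hx, hz]
        · rw [E.oddConj_T ih.1, Y_T_right, Y_T_right, map_add, E.oddConj_T (hYodd hye ih.1 n),
            map_smulₛₗ, map_intCast, ih.2, ih.2]
        · rw [map_add, map_add, map_add, map_add, hx.2, hz.2]
      exact key2.2
    · rw [E.θ_T ih.1, Y_T', Y_T', map_smulₛₗ, ih.2 a ha, map_neg, map_intCast]
    · simp only [map_add, Pi.add_apply, LinearMap.add_apply, hx.2 a ha, hy.2 a ha]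
  exact key.2 a ha n

theorem form_self_eq_re (x : V) : E.form x x = (E.form x x).re :=
  (Complex.conj_eq_iff_re.1 (E.form_symm x x).symm).symm

theorem vac_ne_zero (E : A.EvenUnitary) : A.vac ≠ 0 := fun h => by
  have := E.normalized
  rw [h, map_zero] at this
  exact zero_ne_one this

/-- If the conjugation vanishes then there is no odd part. -/
theorem part_one_eq_bot (hA : A.IsSimple) (h : ∀ a ∈ A.part 1, E.oddConj a = 0) :
    A.part 1 = ⊥ := by
  have hodd : ∀ a ∈ A.part 1, ∀ n : ℤ, ∀ c ∈ A.part 1, A.Y a n c = 0 := by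
    intro a ha
    refine E.part_induction (p := 1) (P := fun a => ∀ n : ℤ, ∀ c ∈ A.part 1, A.Y a n c = 0)
      (fun D hD a ha ha1 n c hc => ?_) (fun D hD a ha ih n c hc => ?_)
      (fun x y hx hy n c hc => ?_) ha
    · have hao := part_of_parity hD ha
      have hac : A.Y a n c ∈ A.part 0 := A.parity 1 1 a hao c hc n
      refine E.scalarProduct.eq_zero ?_
      -- Testing the adjoint relation on a_(n) c itself: the left side is zero and the right side is
      -- ± its squared norm.
      have h1 := E.form_oddConj_Y hD ha ha1 hac (D - n - 2) c
      rw [h a hao, show D - (D - n - 2) - 2 = n by ring] at h1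
      have h2 : wtSign D ≠ 0 := left_ne_zero_of_mul_eq_one (wtSign_mul_self D)
      simpa [h2] using h1
    · rw [Y_T', ih _ c hc, smul_zero]
    · simp [hx n c hc, hy n c hc]
  have hideal : A.IsIdeal (A.part 1) := by
    refine ⟨fun b hb => T_mem_part hb, fun a n b hb => ?_⟩
    obtain ⟨x, hx, y, hy, rfl⟩ := A.exists_parity_add a
    have h1 : A.Y x n b ∈ A.part 1 := by simpa using A.parity 0 1 x hx b hb n
    simpa [hodd y hy n b hb] using h1
  refine (hA _ hideal).resolve_right fun htop => E.vac_ne_zero ?_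
  exact A.part_zero_inf_one A.vac_mem (htop ▸ Submodule.mem_top)

/-- Schur's lemma for the square of the conjugation of the odd part. -/
theorem exists_oddConj_sq (hA : A.IsSimple) :
    ∃ r : ℝ, 0 < r ∧ ∀ a ∈ A.part 1, E.oddConj (E.oddConj a) = ((r ^ 2 : ℝ) : ℂ) • a := by
  by_cases hbot : A.part 1 = ⊥
  · refine ⟨1, one_pos, fun a ha => ?_⟩
    rw [hbot] at ha
    rw [(Submodule.mem_bot ℂ).1 ha]
    simp
  obtain ⟨D, hD, hne⟩ : ∃ D : ℤ, (D : ZMod 2) = 1 ∧ A.wt D ≠ ⊥ := by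
    by_contra hn
    push Not at hn
    refine hbot ((Submodule.eq_bot_iff _).2 fun x hx => ?_)
    refine VOSA.part_induction A (P := fun x => x = 0) (fun D hD a ha => ?_)
      (fun a b ha hb => by rw [ha, hb, add_zero]) hx
    rwa [hn D hD] at ha
  have : FiniteDimensional ℂ (A.wt D) := A.finite_dim D
  have : Nontrivial (A.wt D) := Submodule.nontrivial_iff_ne_bot.2 hne
  -- The square of an antilinear map is linear. It preserves this nonzero finite-dimensional weight
  -- space, so it has an eigenvalue there.
  let f : Module.End ℂ (A.wt D) :=
    (E.oddConj.comp E.oddConj).restrict fun x hx => E.oddConj_mem_wt hD (E.oddConj_mem_wt hD hx)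
  obtain ⟨μ, hμ⟩ := Module.End.exists_eigenvalue f
  obtain ⟨v, hv⟩ := hμ.exists_hasEigenvector
  have hv1 : E.oddConj (E.oddConj v) = μ • (v : V) := congrArg Subtype.val hv.apply_eq_smul
  have hv0 : (v : V) ≠ 0 := fun h => hv.2 (Subtype.ext h)
  have hvo : (v : V) ∈ A.part 1 := part_of_parity hD v.2
  let S : Submodule ℂ V := A.part 1 ⊓ LinearMap.ker (E.oddConj.comp E.oddConj - μ • LinearMap.id)
  have hS {x : V} : x ∈ S ↔ x ∈ A.part 1 ∧ E.oddConj (E.oddConj x) = μ • x := by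
    simp [S, sub_eq_zero]
  have hStop : S = A.part 1 := by
    -- The eigenspace is stable under V₀: equivariance used twice produces θ² = 1 on the even
    -- factor.
    refine (hA.eq_bot_or_eq_part (p := 1) (S := S) inf_le_left fun a ha n s hs => ?_).resolve_left
      fun h => hv0 ?_
    · rw [hS] at hs ⊢
      refine ⟨by simpa using A.parity 0 1 a ha s hs.1 n, ?_⟩
      rw [E.oddConj_Y ha hs.1, E.oddConj_Y (E.θ_even a ha) (E.oddConj_mem hs.1), hs.2,
        E.θ_invol a ha, map_smul]
    · have : (v : V) ∈ S := hS.2 ⟨hvo, hv1⟩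
      rw [h] at this
      exact this
  have hsq (a : V) (ha : a ∈ A.part 1) : E.oddConj (E.oddConj a) = μ • a :=
    (hS.1 (hStop ▸ ha)).2
  have hnorm (a : V) (ha : a ∈ A.part 1) :
      E.form (E.oddConj a) (E.oddConj a) = starRingEnd ℂ μ * E.form a a := by
    rw [E.form_oddConj_symm ha (E.oddConj_mem ha), hsq a ha, form_smul_left]
  -- With w and its conjugate both nonzero, `hnorm` shows that μ is a quotient of two positive
  -- numbers.
  obtain ⟨w, hwo, hw⟩ : ∃ w ∈ A.part 1, E.oddConj w ≠ 0 := by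
    by_contra hn
    push Not at hn
    exact hbot (E.part_one_eq_bot hA hn)
  have hw0 : w ≠ 0 := fun h => hw (by rw [h, map_zero])
  have h1 := E.scalarProduct.pos _ hw
  have h2 := E.scalarProduct.pos _ hw0
  have h3 := hnorm w hwo
  rw [E.form_self_eq_re, E.form_self_eq_re w] at h3
  set s := (E.form (E.oddConj w) (E.oddConj w)).re / (E.form w w).re with hs
  have h4 : starRingEnd ℂ μ = (s : ℂ) := by
    have : ((E.form w w).re : ℂ) ≠ 0 := by exact_mod_cast h2.ne'
    rw [hs]
    push_cast
    rw [h3, mul_div_cancel_right₀ _ this]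
  have h5 : μ = (s : ℂ) := by
    rw [← Complex.conj_conj μ, h4, Complex.conj_ofReal]
  have hspos : 0 < s := div_pos h1 h2
  refine ⟨√s, Real.sqrt_pos.2 hspos, fun a ha => ?_⟩
  rw [Real.sq_sqrt hspos.le, hsq a ha, h5]

/-- Invariance applied to Ω writes (θ a | c) as a vacuum expectation for a quasi-primary, and
skew-symmetry makes this symmetric in a and c. With θ² = 1 it expresses that θ is antiunitary on the
even part. -/
theorem form_θ_symm {a c : V} (ha : a ∈ A.part 0) (hc : c ∈ A.part 0) :
    E.form (E.θ a) c = E.form (E.θ c) a := by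
  have hvac {D : ℤ} (hD : (D : ZMod 2) = 0) {a : V} (ha : a ∈ A.wt D) (h1 : A.L 1 a = 0) (c : V) :
      E.form (E.θ a) c = wtSign D * E.form A.vac (A.Y a (D - 1) c) := by
    have h := E.invariant D a ha (part_of_parity hD ha) h1 (-1) A.vac c
    rwa [A.creation, show D - -1 - 2 = D - 1 by ring] at h
  have key : a ∈ A.part 0 ∧ ∀ c ∈ A.part 0, E.form (E.θ a) c = E.form (E.θ c) a := by
    refine E.part_induction (p := 0)
      (P := fun a => a ∈ A.part 0 ∧ ∀ c ∈ A.part 0, E.form (E.θ a) c = E.form (E.θ c) a)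
      (fun D hD a ha h1 => ⟨part_of_parity hD ha, fun c hc => ?_⟩)
      (fun D hD a ha h => ⟨T_mem_part h.1, fun c hc => ?_⟩)
      (fun x y hx hy => ⟨add_mem hx.1 hy.1, fun c hc => ?_⟩) ha
    · have hae := part_of_parity hD ha
      have hθ1 : A.L 1 (E.θ a) = 0 := by rw [← E.θ_L 1 hae, h1, map_zero]
      have key2 : c ∈ A.part 0 ∧ E.form (E.θ a) c = E.form (E.θ c) a := by
        refine E.part_induction (p := 0)
          (P := fun c => c ∈ A.part 0 ∧ E.form (E.θ a) c = E.form (E.θ c) a)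
          (fun C hC c hc hc1 => ⟨part_of_parity hC hc, ?_⟩)
          (fun C hC c hc h => ⟨T_mem_part h.1, ?_⟩)
          (fun x y hx hy => ⟨add_mem hx.1 hy.1, ?_⟩) hc
        · rcases eq_or_ne D C with rfl | hne
          · rw [hvac hD ha h1, hvac hC hc hc1,
              E.form_skew_right (part_of_parity hC hc) hae A.L_one_vac, paritySign_zero_left]
            obtain ⟨d, rfl⟩ := exists_eq_of_parity_zero hD
            rw [zpow_sub₀ (by norm_num), zpow_mul]
            norm_num
          · rw [E.form_wt_eq_zero hne (E.θ_mem_wt ha hae) hc,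
              E.form_wt_eq_zero hne.symm (E.θ_mem_wt hc (part_of_parity hC hc)) ha]
        · rw [← form_L_one_left, hθ1, E.θ_T h.1, form_T_left, h1]
          simp
        · rw [map_add, map_add, form_add_left, hx.2, hy.2]
      exact key2.2
    · rw [E.θ_T h.1, form_T_left, h.2 _ (L_mem_part 1 hc), E.θ_L 1 hc, form_L_one_left]
    · rw [map_add, form_add_left, map_add, hx.2 c hc, hy.2 c hc]
  exact key.2 c hc

end VOSA.EvenUnitary

/-! ### Assembling the unitary structure -/

namespace VOSA

variable {V : Type*} [AddCommGroup V] [Module ℂ V] {A : VOSA V}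

theorem adjointCoeff_of_L_one_eq_zero {M : Type*} [AddCommGroup M] [Module ℂ M]
    (YM : V →ₗ[ℂ] (ℤ → Module.End ℂ M)) (B : M →ₗ⋆[ℂ] M →ₗ[ℂ] ℂ) (D : ℤ) {a : V}
    (h1 : A.L 1 a = 0) (n : ℤ) (b c : M) :
    A.adjointCoeff YM B D a n b c = wtSign D * B b (YM a (D - n - 2) c) := by
  rw [adjointCoeff, wtSign, finsum_eq_single _ 0]
  · simp
  · intro l hl
    obtain ⟨l, rfl⟩ := Nat.exists_eq_succ_of_ne_zero hl
    rw [Nat.succ_eq_add_one, pow_succ, Module.End.mul_apply, h1]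
    simp

theorem adjointCoeff_hasFiniteSupport (B : V →ₗ⋆[ℂ] V →ₗ[ℂ] ℂ) (D : ℤ) (a : V) (n : ℤ)
    (b c : V) : (fun l : ℕ => B b (A.Y ((A.L 1 ^ l) a) (D - l - n - 2) c) /
      (l.factorial : ℂ)).HasFiniteSupport := by
  obtain ⟨s, hs⟩ := A.exists_L_one_pow_eq_zero a
  refine hasFiniteSupport_of_ge s fun l hl => ?_
  simp [hs l hl]

theorem adjointCoeff_add (B : V →ₗ⋆[ℂ] V →ₗ[ℂ] ℂ) (D : ℤ) (x y : V) (n : ℤ) (b c : V) :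
    A.adjointCoeff A.Y B D (x + y) n b c =
      A.adjointCoeff A.Y B D x n b c + A.adjointCoeff A.Y B D y n b c := by
  rw [adjointCoeff, adjointCoeff, adjointCoeff, ← mul_add, ← finsum_add_distrib
    (adjointCoeff_hasFiniteSupport B D x n b c) (adjointCoeff_hasFiniteSupport B D y n b c)]
  simp only [map_add, Pi.add_apply, LinearMap.add_apply, add_div]

/-- The sl₂ relation expresses the l-th term for T y through terms l and l - 1 for y. In the sum the
coefficient of each term is -(D-l-n) + (D-l) = n, and `wtSign` changes sign when the weight goes up
by one. -/
theorem adjointCoeff_T (B : V →ₗ⋆[ℂ] V →ₗ[ℂ] ℂ) {D : ℤ} {y : V} (hy : y ∈ A.wt D) (n : ℤ)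
    (b c : V) :
    A.adjointCoeff A.Y B (D + 2) (A.T y) n b c = -n * A.adjointCoeff A.Y B D y (n - 1) b c := by
  have hg := adjointCoeff_hasFiniteSupport (A := A) B D y (n - 1) b c
  have hs : wtSign (D + 2) = -wtSign D := wtSign_add_two D
  rw [wtSign, wtSign] at hs
  rw [adjointCoeff, adjointCoeff, hs]
  set g : ℕ → ℂ := fun l => B b (A.Y ((A.L 1 ^ l) y) (D - l - (n - 1) - 2) c) / (l.factorial : ℂ)
    with hgdef
  set t : ℕ → ℂ := fun l => B b (A.Y ((A.L 1 ^ l) (A.T y)) (D + 2 - l - n - 2) c) /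
    (l.factorial : ℂ) with htdef
  have hgl (r : ℕ → ℂ) : (fun l => r l * g l).HasFiniteSupport :=
    hg.subset fun l hl h0 => hl (mul_eq_zero_of_right _ h0)
  have ht0 : t 0 = -(D - (0 : ℕ) - n) * g 0 := by
    simp only [htdef, hgdef, pow_zero, Module.End.one_apply, Y_T', map_smul, smul_eq_mul]
    rw [show D + 2 - ((0 : ℕ) : ℤ) - n - 2 - 1 = D - ((0 : ℕ) : ℤ) - (n - 1) - 2 by ring]
    push_cast
    ring
  have ht1 (l : ℕ) : t (l + 1) = -(D - (l + 1 : ℕ) - n) * g (l + 1) + (D - l) * g l := by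
    simp only [htdef, hgdef, L_one_pow_succ_T A hy, map_add, Pi.add_apply, LinearMap.add_apply,
      Y_T', map_smul, Pi.smul_apply, LinearMap.smul_apply, smul_eq_mul]
    rw [show D + 2 - ((l + 1 : ℕ) : ℤ) - n - 2 - 1 = D - ((l + 1 : ℕ) : ℤ) - (n - 1) - 2 by ring,
      show D + 2 - ((l + 1 : ℕ) : ℤ) - n - 2 = D - (l : ℤ) - (n - 1) - 2 by push_cast; ring,
      Nat.factorial_succ]
    have h1 : (l.factorial : ℂ) ≠ 0 := by exact_mod_cast l.factorial_ne_zero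
    have h2 : ((l : ℂ) + 1) ≠ 0 := Nat.cast_add_one_ne_zero l
    push_cast
    field_simp
    ring
  have hshift := finsum_nat_eq_add (hgl fun l => -(D - l - n))
  have hpre {f : ℕ → ℂ} (hf : f.HasFiniteSupport) : (fun j => f (j + 1)).HasFiniteSupport :=
    Set.Finite.preimage (f := fun j : ℕ => j + 1) (add_left_injective 1).injOn hf
  have hsum : ∑ᶠ l, t l = n * ∑ᶠ l, g l := by
    rw [finsum_nat_eq_add (adjointCoeff_hasFiniteSupport B (D + 2) (A.T y) n b c)]
    change t 0 + ∑ᶠ l, t (l + 1) = _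
    simp only [ht0, ht1]
    rw [finsum_add_distrib (hpre (hgl fun l => -(D - l - n))) (hgl fun l => D - l), ← add_assoc,
      ← hshift, ← finsum_add_distrib (hgl _) (hgl _), ← smul_eq_mul, smul_finsum]
    refine finsum_congr fun l => ?_
    rw [smul_eq_mul]
    ring
  change -(-1 : ℂ) ^ (D * (D + 1) / 2) * ∑ᶠ l, t l = -n * ((-1 : ℂ) ^ (D * (D + 1) / 2) * ∑ᶠ l, g l)
  rw [hsum]
  ring

namespace EvenUnitary

variable (E : A.EvenUnitary)

/-- Invariance follows from the invariance under quasi-primary vectors. -/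
theorem isInvariantForm {θ : V →ₗ⋆[ℂ] V} (hT : ∀ x, θ (A.T x) = A.T (θ x))
    (h : ∀ D : ℤ, ∀ a ∈ A.wt D, A.L 1 a = 0 → ∀ (n : ℤ) (b c : V),
      E.form (A.Y (θ a) n b) c = wtSign D * E.form b (A.Y a (D - n - 2) c)) :
    A.IsInvariantForm A.Y θ E.form := by
  obtain ⟨N, hN⟩ := A.exists_wt_eq_bot
  suffices key : ∀ i : ℕ, ∀ D : ℤ, D < N + i → ∀ a ∈ A.wt D, ∀ (n : ℤ) (b c : V),
      E.form (A.Y (θ a) n b) c = A.adjointCoeff A.Y E.form D a n b c from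
    fun D a ha n b c => key (D - N + 1).toNat D (by omega) a ha n b c
  intro i
  induction i with
  | zero =>
    intro D hD a ha n b c
    rw [hN D (by simpa using hD)] at ha
    rw [(Submodule.mem_bot ℂ).1 ha]
    simp [adjointCoeff]
  | succ i ih =>
    intro D hD a ha n b c
    obtain ⟨q, hq, hq1, y, hy, rfl⟩ := E.exists_add_T ha
    have h2 := adjointCoeff_T E.form hy n b c
    rw [sub_add_cancel] at h2
    rw [adjointCoeff_add, adjointCoeff_of_L_one_eq_zero _ _ _ hq1, h2,
      ← ih (D - 2) (by push_cast at hD; omega) y hy, ← h D q hq hq1, map_add, hT, map_add,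
      Pi.add_apply, LinearMap.add_apply, form_add_left, Y_T', form_smul_left, map_neg, map_intCast]

/-- The conjugation of the whole VOSA. -/
noncomputable def conj : V →ₗ⋆[ℂ] V := E.θ + E.oddConj

theorem conj_even {x : V} (hx : x ∈ A.part 0) : E.conj x = E.θ x := by
  rw [conj, LinearMap.add_apply, E.oddConj_even hx, add_zero]

theorem conj_odd {x : V} (hx : x ∈ A.part 1) : E.conj x = E.oddConj x := by
  rw [conj, LinearMap.add_apply, E.θ_odd x hx, zero_add]

theorem conj_mem {p : ZMod 2} {x : V} (hx : x ∈ A.part p) : E.conj x ∈ A.part p := by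
  rcases parity_cases p with rfl | rfl
  · rw [E.conj_even hx]
    exact E.θ_even x hx
  · rw [E.conj_odd hx]
    exact E.oddConj_mem hx

theorem conj_T (x : V) : E.conj (A.T x) = A.T (E.conj x) := by
  refine A.parity_induction (P := fun x => E.conj (A.T x) = A.T (E.conj x)) (fun p x hx => ?_)
    (fun a b ha hb => by simp only [map_add, ha, hb]) x
  rcases parity_cases p with rfl | rfl
  · rw [E.conj_even hx, E.conj_even (T_mem_part hx), E.θ_T hx]
  · rw [E.conj_odd hx, E.conj_odd (T_mem_part hx), E.oddConj_T hx]

/-- These vectors are T^j x / j!, and the conjugation commutes with T. -/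
theorem conj_Y_vac (x : V) (j : ℕ) :
    E.conj (A.Y x (-1 - j) A.vac) = A.Y (E.conj x) (-1 - j) A.vac := by
  induction j with
  | zero => simp [A.creation]
  | succ j ih =>
    have h1 := A.T_Y_vac x (-1 - j)
    have h2 := A.T_Y_vac (E.conj x) (-1 - j)
    rw [← ih, ← E.conj_T, h1, map_neg, neg_inj, map_zsmul, ← Int.cast_smul_eq_zsmul ℂ,
      ← Int.cast_smul_eq_zsmul ℂ] at h2
    have h3 : ((-1 - j : ℤ) : ℂ) ≠ 0 := by exact_mod_cast (by omega : (-1 - j : ℤ) ≠ 0)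
    rw [show (-1 - ((j + 1 : ℕ) : ℤ)) = -1 - j - 1 by push_cast; ring]
    exact smul_right_injective V h3 h2

/-- By skew-symmetry it suffices to check that the conjugation is multiplicative on one side. -/
theorem conj_Y_swap {p q : ZMod 2} {a b : V} (ha : a ∈ A.part p) (hb : b ∈ A.part q)
    (h : ∀ n : ℤ, E.conj (A.Y a n b) = A.Y (E.conj a) n (E.conj b)) (n : ℤ) :
    E.conj (A.Y b n a) = A.Y (E.conj b) n (E.conj a) := by
  have h1 := congrArg E.conj (A.skew_symmetry ha hb n)
  have h2 := A.skew_symmetry (E.conj_mem ha) (E.conj_mem hb) n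
  have hfin : (fun j : ℕ => Ring.choose (-1 : ℤ) j •
      A.Y (A.Y a (n + j) b) (-1 - j) A.vac).HasFiniteSupport :=
    (A.isQuantumField a).hasFiniteSupport b n
      (fun j x => Ring.choose (-1 : ℤ) j • A.Y x (-1 - j) A.vac) (by simp)
  rw [map_neg, map_finsum _ hfin] at h1
  simp only [map_zsmul, E.conj_Y_vac, h] at h1
  rw [← h2, map_smulₛₗ] at h1
  have h3 : starRingEnd ℂ (paritySign p q * (-1 : ℂ) ^ n) = paritySign p q * (-1 : ℂ) ^ n := by
    simp [paritySign]
  rw [h3] at h1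
  refine smul_right_injective V (mul_ne_zero ?_ (zpow_ne_zero n (by norm_num))) h1
  exact left_ne_zero_of_mul_eq_one (paritySign_mul_self p q)

theorem form_conj_Y (hsq : ∀ a ∈ A.part 1, E.oddConj (E.oddConj a) = a) {D : ℤ} {a : V}
    (ha : a ∈ A.wt D) (h1 : A.L 1 a = 0) (n : ℤ) (b c : V) :
    E.form (A.Y (E.conj a) n b) c = wtSign D * E.form b (A.Y a (D - n - 2) c) := by
  rcases parity_cases (D : ZMod 2) with hD | hD
  · rw [E.conj_even (part_of_parity hD ha)]
    exact E.invariant D a ha (part_of_parity hD ha) h1 n b c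
  have hao := part_of_parity hD ha
  rw [E.conj_odd hao]
  obtain ⟨b0, hb0, b1, hb1, rfl⟩ := A.exists_parity_add b
  obtain ⟨c0, hc0, c1, hc1, rfl⟩ := A.exists_parity_add c
  have hoo : E.form (A.Y (E.oddConj a) n b1) c1 = wtSign D * E.form b1 (A.Y a (D - n - 2) c1) := by
    rw [E.orthogonal _ (A.parity 1 1 _ (E.oddConj_mem hao) b1 hb1 n) c1 hc1,
      E.form_odd_even hb1 (A.parity 1 1 a hao c1 hc1 (D - n - 2)), mul_zero]
  have hoe : E.form (A.Y (E.oddConj a) n b1) c0 = wtSign D * E.form b1 (A.Y a (D - n - 2) c0) := by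
    obtain ⟨hu, hu1, -⟩ := E.oddConj_quasiPrimary hD ha h1
    -- The known relation for the conjugate of a, whose own conjugate is a by `hsq`. Hermitian
    -- symmetry interchanges the two arguments.
    have h := E.form_oddConj_Y hD hu hu1 hc0 (D - n - 2) b1
    rw [hsq a hao, show D - (D - n - 2) - 2 = n by ring] at h
    rw [E.form_symm, E.form_symm b1, h, map_mul, star_wtSign, ← mul_assoc, wtSign_mul_self, one_mul]
  rw [map_add (A.Y (E.oddConj a) n) b0, form_add_left, form_add_left,
    E.form_oddConj_Y hD ha h1 hb0, map_add (E.form (A.Y (E.oddConj a) n b1)), hoo, hoe,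
    map_add (A.Y a (D - n - 2)), map_add (E.form b1)]
  ring

theorem conj_Y_odd_even {a b : V} (ha : a ∈ A.part 1) (hb : b ∈ A.part 0) (n : ℤ) :
    E.conj (A.Y a n b) = A.Y (E.conj a) n (E.conj b) := by
  refine E.conj_Y_swap hb ha (fun n => ?_) n
  have h : A.Y b n a ∈ A.part 1 := by simpa using A.parity 0 1 b hb a ha n
  rw [E.conj_odd h, E.conj_even hb, E.conj_odd ha, E.oddConj_Y hb ha]

theorem conj_Y_odd_odd (hsq : ∀ a ∈ A.part 1, E.oddConj (E.oddConj a) = a) {a b : V}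
    (ha : a ∈ A.part 1) (hb : b ∈ A.part 1) (n : ℤ) :
    E.conj (A.Y a n b) = A.Y (E.conj a) n (E.conj b) := by
  suffices h : ∀ n : ℤ, E.conj (A.Y a n b) = A.Y (E.conj a) n (E.conj b) from h n
  refine E.part_induction (p := 1)
    (P := fun a => ∀ n : ℤ, E.conj (A.Y a n b) = A.Y (E.conj a) n (E.conj b))
    (fun D hD a ha h1 n => ?_) (fun D hD a ha ih n => ?_) (fun x y hx hy n => ?_) ha
  · have hao := part_of_parity hD ha
    have hab : A.Y a n b ∈ A.part 0 := A.parity 1 1 a hao b hb n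
    refine E.ext_form_part (E.conj_mem hab)
      (A.parity 1 1 _ (E.conj_mem hao) _ (E.conj_mem hb) n) fun c hc => ?_
    have hac : A.Y a (D - n - 2) c ∈ A.part 1 := by simpa using A.parity 1 0 a hao c hc (D - n - 2)
    -- With bars for conjugates and modes omitted, (ā b̄ | c) leads to (b̄ | a c), to the conjugate
    -- of a c paired with b, then by the settled odd-even case to (ā c̄ | b) and (c̄ | a b). The two
    -- weight signs cancel, and symmetry of θ finishes.
    rw [E.form_conj_Y hsq ha h1, E.conj_odd hb, ← E.form_oddConj_symm hac hb, ← E.conj_odd hac,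
      E.conj_Y_odd_even hao hc, E.form_conj_Y hsq ha h1, ← mul_assoc, wtSign_mul_self, one_mul,
      E.conj_even hab, E.form_θ_symm hab hc, E.conj_even hc, show D - (D - n - 2) - 2 = n by ring]
  · rw [E.conj_T, Y_T', Y_T', map_smulₛₗ, ih, map_neg, map_intCast]
  · simp only [map_add, Pi.add_apply, LinearMap.add_apply, hx, hy]

theorem conj_Y (hsq : ∀ a ∈ A.part 1, E.oddConj (E.oddConj a) = a) (a b : V) (n : ℤ) :
    E.conj (A.Y a n b) = A.Y (E.conj a) n (E.conj b) := by
  obtain ⟨a0, ha0, a1, ha1, rfl⟩ := A.exists_parity_add a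
  obtain ⟨b0, hb0, b1, hb1, rfl⟩ := A.exists_parity_add b
  have hee : E.conj (A.Y a0 n b0) = A.Y (E.conj a0) n (E.conj b0) := by
    rw [E.conj_even (A.parity 0 0 a0 ha0 b0 hb0 n), E.conj_even ha0, E.conj_even hb0,
      E.θ_Y a0 ha0 b0 hb0]
  have heo := E.conj_Y_swap hb1 ha0 (E.conj_Y_odd_even hb1 ha0) n
  simp only [map_add, Pi.add_apply, LinearMap.add_apply, hee, heo, E.conj_Y_odd_even ha1 hb0,
    E.conj_Y_odd_odd hsq ha1 hb1]

theorem conj_conj (hsq : ∀ a ∈ A.part 1, E.oddConj (E.oddConj a) = a) (x : V) :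
    E.conj (E.conj x) = x := by
  refine A.parity_induction (P := fun x => E.conj (E.conj x) = x) (fun p x hx => ?_)
    (fun a b ha hb => by rw [map_add, map_add, ha, hb]) x
  rcases parity_cases p with rfl | rfl
  · rw [E.conj_even hx, E.conj_even (E.θ_even x hx), E.θ_invol x hx]
  · rw [E.conj_odd hx, E.conj_odd (E.oddConj_mem hx), hsq x hx]

/-- The unitary structure on the whole VOSA. -/
noncomputable def unitaryStructure (hsq : ∀ a ∈ A.part 1, E.oddConj (E.oddConj a) = a) :
    A.UnitaryStructure where
  θ := E.conj
  form := E.form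
  θ_Y := E.conj_Y hsq
  θ_vac := (E.conj_even A.vac_mem).trans E.θ_vac
  θ_ν := (E.conj_even A.ν_mem).trans E.θ_ν
  θ_invol := E.conj_conj hsq
  scalarProduct := E.scalarProduct
  normalized := E.normalized
  invariant := E.isInvariantForm E.conj_T fun _ _ ha h1 => E.form_conj_Y hsq ha h1

/-- The projection onto the part of parity `p`, as a map to this part. -/
noncomputable def _root_.VOSA.toPart (A : VOSA V) (p : ZMod 2) : V →ₗ[ℂ] A.part p :=
  (A.parityProj p).codRestrict _ (A.parityProj_mem p)

theorem _root_.VOSA.toPart_of_mem (A : VOSA V) {p : ZMod 2} {x : V} (hx : x ∈ A.part p) :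
    A.toPart p x = ⟨x, hx⟩ := Subtype.ext (A.parityProj_of_mem hx)

theorem _root_.VOSA.toPart_of_mem' (A : VOSA V) {p : ZMod 2} {x : V} (hx : x ∈ A.part (1 + p)) :
    A.toPart p x = 0 := Subtype.ext (A.parityProj_of_mem' hx)

theorem _root_.VOSA.toPart_add (A : VOSA V) (x : V) :
    (A.toPart 0 x : V) + (A.toPart 1 x : V) = x := A.parityProj_add x

theorem _root_.VOSA.toPart_Y (A : VOSA V) (p : ZMod 2) (a : A.part 0) (n : ℤ) (x : V) :
    A.toPart p (A.Y a n x) = A.evenAct p a n (A.toPart p x) := by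
  obtain ⟨b, hb, c, hc, rfl⟩ := A.exists_parity_add' p x
  have h1 : A.Y a n b ∈ A.part p := by simpa using A.parity 0 p a a.2 b hb n
  have h2 : A.Y a n c ∈ A.part (1 + p) := by simpa using A.parity 0 (1 + p) a a.2 c hc n
  rw [map_add, map_add, map_add, A.toPart_of_mem h1, A.toPart_of_mem' h2, A.toPart_of_mem hb,
    A.toPart_of_mem' hc, add_zero, add_zero]
  rfl

/-- The orthogonal sum of a form on the even part and a form on the odd part. -/
noncomputable def _root_.VOSA.sumForm (A : VOSA V) (B₀ : A.part 0 →ₗ⋆[ℂ] A.part 0 →ₗ[ℂ] ℂ)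
    (B₁ : A.part 1 →ₗ⋆[ℂ] A.part 1 →ₗ[ℂ] ℂ) : V →ₗ⋆[ℂ] V →ₗ[ℂ] ℂ :=
  LinearMap.mk₂'ₛₗ (starRingEnd ℂ) (RingHom.id ℂ)
    (fun x y => B₀ (A.toPart 0 x) (A.toPart 0 y) + B₁ (A.toPart 1 x) (A.toPart 1 y))
    (fun x y z => by simp only [map_add, LinearMap.add_apply]; ring)
    (fun r x y => by
      simp only [map_smul, LinearMap.map_smulₛₗ₂, smul_eq_mul, mul_add])
    (fun x y z => by simp only [map_add]; ring)
    (fun r x y => by simp only [map_smul, smul_eq_mul, mul_add, RingHom.id_apply])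

theorem _root_.VOSA.sumForm_apply (A : VOSA V) (B₀ : A.part 0 →ₗ⋆[ℂ] A.part 0 →ₗ[ℂ] ℂ)
    (B₁ : A.part 1 →ₗ⋆[ℂ] A.part 1 →ₗ[ℂ] ℂ) (x y : V) : A.sumForm B₀ B₁ x y =
      B₀ (A.toPart 0 x) (A.toPart 0 y) + B₁ (A.toPart 1 x) (A.toPart 1 y) := rfl

theorem _root_.VOSA.sumForm_isScalarProduct (A : VOSA V)
    {B₀ : A.part 0 →ₗ⋆[ℂ] A.part 0 →ₗ[ℂ] ℂ} {B₁ : A.part 1 →ₗ⋆[ℂ] A.part 1 →ₗ[ℂ] ℂ}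
    (h0 : IsScalarProduct B₀) (h1 : IsScalarProduct B₁) : IsScalarProduct (A.sumForm B₀ B₁) where
  hermitian b c := by
    rw [A.sumForm_apply, A.sumForm_apply, map_add, ← h0.hermitian, ← h1.hermitian]
  pos b hb := by
    have hnn {p : ZMod 2} {B : A.part p →ₗ⋆[ℂ] A.part p →ₗ[ℂ] ℂ} (h : IsScalarProduct B)
        (x : A.part p) : 0 ≤ (B x x).re := by
      by_cases hx : x = 0
      · simp [hx]
      · exact (h.pos x hx).le
    rw [A.sumForm_apply, Complex.add_re]
    by_cases hx : A.toPart 0 b = 0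
    · have hy : A.toPart 1 b ≠ 0 := fun hy => hb (by rw [← A.toPart_add b, hx, hy]; simp)
      exact add_pos_of_nonneg_of_pos (hnn h0 _) (h1.pos _ hy)
    · exact add_pos_of_pos_of_nonneg (h0.pos _ hx) (hnn h1 _)

/-- The structure given by a unitary structure on the even part and an invariant scalar product
on the odd part. -/
noncomputable def ofOddForm (U : A.evenPart.UnitaryStructure)
    {B : A.part 1 →ₗ⋆[ℂ] A.part 1 →ₗ[ℂ] ℂ} (hB : IsScalarProduct B)
    (hinv : A.evenPart.IsInvariantForm A.oddPart.Y U.θ B) : A.EvenUnitary where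
  form := A.sumForm U.form B
  θ := (A.part 0).subtype.comp (U.θ.comp (A.toPart 0))
  scalarProduct := A.sumForm_isScalarProduct U.scalarProduct hB
  orthogonal x hx y hy := by
    have h1 : A.toPart 1 x = 0 := A.toPart_of_mem' hx
    have h2 : A.toPart 0 y = 0 := A.toPart_of_mem' hy
    rw [A.sumForm_apply, h1, h2]
    simp
  normalized := by
    have h1 : A.toPart 1 A.vac = 0 := A.toPart_of_mem' A.vac_mem
    rw [A.sumForm_apply, h1, A.toPart_of_mem A.vac_mem, map_zero, add_zero]
    exact U.normalized
  θ_even x _ := Subtype.coe_prop _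
  θ_odd x hx := by
    have h : A.toPart 0 x = 0 := A.toPart_of_mem' hx
    simp [h]
  θ_Y a ha b hb n := by
    have h := A.toPart_Y 0 ⟨a, ha⟩ n b
    simp only [LinearMap.comp_apply, Submodule.subtype_apply]
    rw [h, A.toPart_of_mem ha]
    exact congrArg Subtype.val (U.θ_Y ⟨a, ha⟩ (A.toPart 0 b) n)
  θ_vac := by
    simp only [LinearMap.comp_apply, Submodule.subtype_apply, A.toPart_of_mem A.vac_mem]
    exact congrArg Subtype.val U.θ_vac
  θ_ν := by
    simp only [LinearMap.comp_apply, Submodule.subtype_apply, A.toPart_of_mem A.ν_mem]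
    exact congrArg Subtype.val U.θ_ν
  θ_invol a ha := by
    simp only [LinearMap.comp_apply, Submodule.subtype_apply]
    rw [A.toPart_of_mem (Subtype.coe_prop _), A.toPart_of_mem ha]
    exact congrArg Subtype.val (U.θ_invol ⟨a, ha⟩)
  invariant D a ha ha0 h1 n b c := by
    have haw : (⟨a, ha0⟩ : A.part 0) ∈ A.evenPart.wt D := A.mem_evenPart_wt.2 ha
    have hL : A.evenPart.L 1 ⟨a, ha0⟩ = 0 := Subtype.ext h1
    have e0 := U.invariant D _ haw n (A.toPart 0 b) (A.toPart 0 c)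
    have e1 := hinv D _ haw n (A.toPart 1 b) (A.toPart 1 c)
    rw [adjointCoeff_of_L_one_eq_zero _ _ _ hL] at e0 e1
    rw [A.sumForm_apply, A.sumForm_apply, A.toPart_Y 0 ⟨a, ha0⟩, A.toPart_Y 1 ⟨a, ha0⟩]
    simp only [LinearMap.comp_apply, Submodule.subtype_apply]
    rw [A.toPart_Y, A.toPart_Y, A.toPart_of_mem ha0, mul_add]
    exact congrArg₂ (· + ·) e0 e1

theorem ofOddForm_form_vac (U : A.evenPart.UnitaryStructure)
    {B : A.part 1 →ₗ⋆[ℂ] A.part 1 →ₗ[ℂ] ℂ} (hB : IsScalarProduct B)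
    (hinv : A.evenPart.IsInvariantForm A.oddPart.Y U.θ B) (x : V) :
    (ofOddForm U hB hinv).form A.vac x = U.form (A.toPart 0 A.vac) (A.toPart 0 x) := by
  have h1 : A.toPart 1 A.vac = 0 := A.toPart_of_mem' A.vac_mem
  change A.sumForm _ _ _ _ = _
  rw [A.sumForm_apply, h1]
  simp

theorem ofOddForm_form_odd (U : A.evenPart.UnitaryStructure)
    {B : A.part 1 →ₗ⋆[ℂ] A.part 1 →ₗ[ℂ] ℂ} (hB : IsScalarProduct B)
    (hinv : A.evenPart.IsInvariantForm A.oddPart.Y U.θ B) {x : V} (hx : x ∈ A.part 1) (y : V) :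
    (ofOddForm U hB hinv).form x y = B (A.toPart 1 x) (A.toPart 1 y) := by
  have h1 : A.toPart 0 x = 0 := A.toPart_of_mem' hx
  change A.sumForm _ _ _ _ = _
  rw [A.sumForm_apply, h1]
  simp

end EvenUnitary

/-- A simple VOSA is unitary if its even part is unitary and its odd part is a unitary module. -/
theorem IsSimple.isUnitary (hA : A.IsSimple) (U : A.evenPart.UnitaryStructure)
    (hU : A.oddPart.IsUnitaryModule U) : A.IsUnitary := by
  obtain ⟨-, B, hB, hinv⟩ := hU
  obtain ⟨r, hr, hsq⟩ := (EvenUnitary.ofOddForm U hB hinv).exists_oddConj_sq hA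
  have hB' : IsScalarProduct ((r : ℂ) • B) :=
    { hermitian := fun b c => by
        simp only [LinearMap.smul_apply, smul_eq_mul, map_mul, Complex.conj_ofReal,
          ← hB.hermitian]
      pos := fun b hb => by
        simpa only [LinearMap.smul_apply, smul_eq_mul, Complex.re_ofReal_mul] using
          mul_pos hr (hB.pos b hb) }
  have hinv' : A.evenPart.IsInvariantForm A.oddPart.Y U.θ ((r : ℂ) • B) := fun D a ha n b c => by
    have h := congrArg ((r : ℂ) * ·) (hinv D a ha n b c)
    simp only [LinearMap.smul_apply, adjointCoeff] at h ⊢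
    rw [smul_eq_mul, h, mul_left_comm, ← smul_eq_mul (r : ℂ), smul_finsum]
    simp only [smul_eq_mul, mul_div_assoc]
  set E := EvenUnitary.ofOddForm U hB hinv
  set E' := EvenUnitary.ofOddForm U hB' hinv'
  have hr0 : (r : ℂ) ≠ 0 := by exact_mod_cast hr.ne'
  -- Vacuum expectations only see the form on V₀, which is unchanged. The form on V₁ is multiplied
  -- by r, so the conjugate is divided by r and the square, formerly r², becomes 1.
  have hscale : ∀ a ∈ A.part 1, E'.oddConj a = (r : ℂ)⁻¹ • E.oddConj a := by
    intro a ha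
    have h := E.isConj_oddConj ha
    refine EvenUnitary.IsConj.oddConj_eq ha ⟨Submodule.smul_mem _ _ h.1,
      fun C hC c hc hc1 j => ?_⟩
    have h2 := h.2 C hC c hc hc1 j
    rw [EvenUnitary.ofOddForm_form_vac, EvenUnitary.ofOddForm_form_odd _ _ _ h.1] at h2
    rw [EvenUnitary.form_smul_left, EvenUnitary.ofOddForm_form_vac,
      EvenUnitary.ofOddForm_form_odd _ _ _ h.1, LinearMap.smul_apply, LinearMap.smul_apply, h2,
      map_inv₀, Complex.conj_ofReal, smul_eq_mul, inv_mul_cancel_left₀ hr0]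
  refine ⟨E'.unitaryStructure fun a ha => ?_⟩
  have h1 := E.oddConj_mem ha
  rw [hscale a ha, map_smulₛₗ, hscale _ h1, hsq a ha, map_inv₀, Complex.conj_ofReal, smul_smul,
    smul_smul]
  push_cast
  rw [show (r : ℂ)⁻¹ * (r : ℂ)⁻¹ * r ^ 2 = 1 by field_simp, one_smul]

end VOSA

theorem mainTheorem8 {V : Type*} [AddCommGroup V] [Module ℂ V] (A : VOSA V) (hA : A.IsSimple) :
    (A.IsUnitary ↔
      A.evenPart.IsVOA ∧ ∃ U : A.evenPart.UnitaryStructure, A.oddPart.IsUnitaryModule U) ∧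
    (A.IsUnitary → A.evenPart.IsSimple ∧ A.oddPart.IsIrreducibleModule) :=
  ⟨⟨fun ⟨U⟩ => ⟨A.evenPart_isVOA, U.evenPart, U.oddPart⟩, fun ⟨_, U, hU⟩ => hA.isUnitary U hU⟩,
    fun _ => ⟨hA.evenPart, hA.oddPart⟩⟩
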